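/- Consider the boundary value problem $L$: $$-y''+q(x)y=\lambda r(x)y,\ 0<x<T;\qquad y'(0)-hy(0)=0,\quad V(y):=y'(T)+Hy(T)=0,$$ $$y(b+0)=d_1y(b-0),\qquad y'(b+0)=y'(b-0)/d_1+d_2y(b-0),$$ where $0<b<T$, $q\in L(0,T)$ is complex-valued, $r=a_1^2$ on $(0,b)$, $r=a_2^2$ on $(b,T)$, and $h,H,a_1,a_2,d_1,d_2$ are complex with $a_1,a_2,d_1\neq0$, $\arg d_1\in[0,\pi)$, $a_j=r_je^{i\varphi_j}$, $r_j>0$, $0\le\varphi_2<\varphi_1<\pi$, and $\omega_\pm:=d_1a_2\pm a_1/d_1\ne0$. Put $l_1=b$, $l_2=T-b$, $\theta_1=-\varphi_2$, $\theta_2=\pi-\varphi_1$, $\alpha=\varphi_1-\varphi_2+\pi/2$ and, with the principal logarithm, $$C_1=-(2ia_1l_1)^{-1}\ln(-\omega_- /\omega_+),\qquad C_2=(2ia_2l_2)^{-1}\ln(\omega_+/\omega_-).$$ Let $\varphi(x,\lambda)$ be the solution (satisfying the jump conditions) with $\varphi(0)=1$, $\varphi'(0)=h$; the multiplicity of an eigenvalue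 is its order as a zero of $\Delta(\lambda)=-V(\varphi)$. Let $\Phi(x,\lambda)$ be the solution (satisfying the jump conditions) with $\Phi'(0)-h\Phi(0)=1$, $V(\Phi)=0$, and let $M(\lambda)=\Phi(0,\lambda)$ be the Weyl function. If $z$ is an eigenvalue of multiplicity $m$, the $m$ coefficients of $(\lambda-z)^{-1},\dots,(\lambda-z)^{-m}$ in the principal part of $M$ at $z$ are attached to the $m$ copies of $z$ in the list of eigenvalues; they form the Weyl sequence. Then: (i) The eigenvalues, counted with multiplicity, can be arranged in two sequences $\lambda_{k1}$ $(k\ge N_1)$ and $\lambda_{k2}$ $(k\ge N_2)$, with some integers $N_1,N_2$, having square roots $\rho_{kj}$ such that $$\rho_{kj}=\frac{k\pi}{r_jl_j}e^{i\theta_{3-j}}+C_j+O(1/k),\qquad k\to\infty,\ j=1,2.$$ (ii) For every such arrangement, all but finitely many eigenvalues are simple, and the corresponding Weyl sequence $M_{k1},M_{k2}$ satisfies, as $k\to\infty$, $$M_{k1}=\frac{2}{a_1^2l_1}\bigl(1+O(1/k)\bigr),\qquad M_{k2}=\frac{8\,e^{2ia_1l_1C_2}}{\omega_-\omega_+l_2}\exp\Bigl(\frac{2k\pi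 r_1l_1}{r_2l_2}(\cos\alpha+i\sin\alpha)\Bigr)\bigl(1+O(1/k)\bigr),$$ where $\cos\alpha<0$, so that $M_{k2}$ decays exponentially. (iii) $a_1,b,a_2,d_1$ are recovered from $M$ and the eigenvalues as follows. For every $\delta>0$, $a_1=\lim\,(i\rho M(\rho^2))^{-1}$ as $|\rho|\to\infty$ in the set of those $\rho$ with $\operatorname{Im}(\rho a_1)\ge\delta|\rho|$ whose distance from every square root of every eigenvalue is at least $\delta$. For every arrangement as in (i), $$b=-\lim_{k\to\infty}\frac{k\pi}{a_1\rho_{k1}},\qquad a_2=\lim_{k\to\infty}\frac{k\pi}{l_2\rho_{k2}}\quad(l_2=T-b),$$ $$A:=\frac{\omega_+}{\omega_-}=\lim_{k\to\infty}\exp(2i\rho_{k2}a_2l_2)\neq1,\qquad d_1=\sqrt{\frac{a_1(A+1)}{a_2(A-1)}},$$ the square root being the one with argument in $[0,\pi)$. -/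

import Mathlib

open Complex Filter Topology Asymptotics

/-- The data of a boundary value problem
`-y'' + q y = lam r y` on `(0,T)`, `r = a₁²` on `(0,b)`, `r = a₂²` on `(b,T)`,
`y'(0) - h y(0) = 0`, `y'(T) + H y(T) = 0`,
`y(b+0) = d₁ y(b-0)`, `y'(b+0) = y'(b-0)/d₁ + d₂ y(b-0)`,
together with the standing assumptions on these data. -/
structure ComplexWeightBVP where
  T : ℝ
  b : ℝ
  q : ℝ → ℂ
  a₁ : ℂ
  a₂ : ℂ
  d₁ : ℂ
  d₂ : ℂ
  h : ℂ
  H : ℂ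
  b_pos : 0 < b
  b_lt_T : b < T
  q_integrable : MeasureTheory.IntegrableOn q (Set.Ioo 0 T)
  a₁_ne : a₁ ≠ 0
  a₂_ne : a₂ ≠ 0
  d₁_ne : d₁ ≠ 0
  arg_a₂_nonneg : 0 ≤ a₂.arg
  arg_a₂_lt : a₂.arg < a₁.arg
  arg_a₁_lt : a₁.arg < Real.pi
  arg_d₁_nonneg : 0 ≤ d₁.arg
  arg_d₁_lt : d₁.arg < Real.pi
  omega_plus_ne : d₁ * a₂ + a₁ / d₁ ≠ 0
  omega_minus_ne : d₁ * a₂ - a₁ / d₁ ≠ 0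

/-- A function on `[0,b]` with its derivative (`left`, `left'`) and a function on `[b,T]` with its
derivative (`right`, `right'`); the values of `left`, `left'` at `b` are the one-sided values at
`b-0`, those of `right`, `right'` the values at `b+0`. -/
structure BrokenFunction where
  left : ℝ → ℂ
  left' : ℝ → ℂ
  right : ℝ → ℂ
  right' : ℝ → ℂ

/-- `y` is a (Caratheodory) solution of `-y'' + q y = c y` on `[α, β]` with derivative `y'`:
`y` and `y'` are absolutely continuous and the equation holds almost everywhere, in the
equivalent integrated form. -/
structure IsSolutionOn (q : ℝ → ℂ) (c : ℂ) (α β : ℝ) (y y' : ℝ → ℂ) : Prop where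
  cont : ContinuousOn y (Set.Icc α β)
  cont' : ContinuousOn y' (Set.Icc α β)
  eq : ∀ x ∈ Set.Icc α β, y x = y α + ∫ t in α..x, y' t
  eq' : ∀ x ∈ Set.Icc α β, y' x = y' α + ∫ t in α..x, (q t - c) * y t

/-- The square root whose argument lies in `[0, π)`. -/
noncomputable def upperSqrt (z : ℂ) : ℂ :=
  if 0 ≤ (z ^ (1 / 2 : ℂ)).arg then z ^ (1 / 2 : ℂ) else -z ^ (1 / 2 : ℂ)

theorem upperSqrt_sq (z : ℂ) : upperSqrt z ^ 2 = z := by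
  have key : (z ^ (1 / 2 : ℂ)) ^ 2 = z := by
    simp
  unfold upperSqrt
  split_ifs
  · exact key
  · rw [neg_sq]; exact key

namespace ComplexWeightBVP

variable (L : ComplexWeightBVP)

/-- `l₁`, the length of the first subinterval. -/
def l₁ : ℝ := L.b

/-- `l₂`, the length of the second subinterval. -/
def l₂ : ℝ := L.T - L.b

/-- `ω₊`. -/
noncomputable def ωp : ℂ := L.d₁ * L.a₂ + L.a₁ / L.d₁

/-- `ω₋`. -/
noncomputable def ωm : ℂ := L.d₁ * L.a₂ - L.a₁ / L.d₁

/-- `r₁ = |a₁|`. -/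
noncomputable def r₁ : ℝ := ‖L.a₁‖

/-- `r₂ = |a₂|`. -/
noncomputable def r₂ : ℝ := ‖L.a₂‖

/-- `θ₁ = -φ₂`, where `φ₂ = arg a₂`. -/
noncomputable def θ₁ : ℝ := -L.a₂.arg

/-- `θ₂ = π - φ₁`, where `φ₁ = arg a₁`. -/
noncomputable def θ₂ : ℝ := Real.pi - L.a₁.arg

/-- `α = φ₁ - φ₂ + π/2`. -/
noncomputable def α : ℝ := L.a₁.arg - L.a₂.arg + Real.pi / 2

/-- `C₁`, with the principal logarithm. -/
noncomputable def C₁ : ℂ := -(2 * I * L.a₁ * L.l₁)⁻¹ * Complex.log (-L.ωm / L.ωp)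

/-- `C₂`, with the principal logarithm. -/
noncomputable def C₂ : ℂ := (2 * I * L.a₂ * L.l₂)⁻¹ * Complex.log (L.ωp / L.ωm)

/-- `y` solves the differential equation with spectral parameter `lam` on both subintervals and
satisfies the jump conditions at `b`. -/
structure IsSolution (lam : ℂ) (y : BrokenFunction) : Prop where
  left : IsSolutionOn L.q (lam * L.a₁ ^ 2) 0 L.b y.left y.left'
  right : IsSolutionOn L.q (lam * L.a₂ ^ 2) L.b L.T y.right y.right'
  jump : y.right L.b = L.d₁ * y.left L.b
  jump' : y.right' L.b = y.left' L.b / L.d₁ + L.d₂ * y.left L.b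

/-- The boundary form at `0`. -/
def U (y : BrokenFunction) : ℂ := y.left' 0 - L.h * y.left 0

/-- The boundary form at `T`. -/
def V (y : BrokenFunction) : ℂ := y.right' L.T + L.H * y.right L.T

/-- `lam` is an eigenvalue: the boundary value problem has a nontrivial solution. -/
def IsEigenvalue (lam : ℂ) : Prop :=
  ∃ y : BrokenFunction, L.IsSolution lam y ∧ L.U y = 0 ∧ L.V y = 0 ∧
    ((∃ x ∈ Set.Icc 0 L.b, y.left x ≠ 0) ∨ (∃ x ∈ Set.Icc L.b L.T, y.right x ≠ 0))

/-- The characteristic function `Δ(lam) = -V(φ)`, where `φ` is the (unique) solution with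
`φ(0) = 1`, `φ'(0) = h`. -/
noncomputable def Δ (lam : ℂ) : ℂ :=
  Classical.epsilon fun d : ℂ => ∃ φ : BrokenFunction, L.IsSolution lam φ ∧
    φ.left 0 = 1 ∧ φ.left' 0 = L.h ∧ d = -L.V φ

/-- The Weyl function `M(lam) = Φ(0)`, where `Φ` is the solution with `U(Φ) = 1`, `V(Φ) = 0`.
It exists and is unique for each `lam` that is not an eigenvalue; the value at an eigenvalue
is irrelevant. -/
noncomputable def M (lam : ℂ) : ℂ :=
  Classical.epsilon fun m : ℂ => ∃ Φ : BrokenFunction, L.IsSolution lam Φ ∧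
    L.U Φ = 1 ∧ L.V Φ = 0 ∧ m = Φ.left 0

/-- The multiplicity of an eigenvalue: its order as a zero of `Δ`. -/
noncomputable def mult (z : ℂ) : ℕ := analyticOrderNatAt L.Δ z

/-- The spectral data of `L`, arranged in two sequences: the first one is indexed by `j = 0` and
the integers `k ≥ N 0`, the second one by `j = 1` and the integers `k ≥ N 1`. The eigenvalues
are `ρ j k ^ 2`, each of them occurring as many times as its multiplicity, and `μ j k` are the
coefficients of the principal parts of the Weyl function: the `μ`'s that belong to an eigenvalue
`z` are, in some order, the coefficients of `(lam - z)⁻¹, …, (lam - z)^(-m)`, `m` being the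
multiplicity of `z`. The values of `ρ j k` and `μ j k` for `k < N j` play no role. -/
structure IsSpectralData (N : Fin 2 → ℤ) (ρ μ : Fin 2 → ℤ → ℂ) : Prop where
  eigenvalues : ∀ z : ℂ, L.IsEigenvalue z ↔ ∃ j k, N j ≤ k ∧ ρ j k ^ 2 = z
  principal_parts : ∀ z : ℂ, ∃ e : Fin (L.mult z) → Fin 2 × ℤ, Function.Injective e ∧
    Set.range e = {p | N p.1 ≤ p.2 ∧ ρ p.1 p.2 ^ 2 = z} ∧
    ∃ g : ℂ → ℂ, AnalyticAt ℂ g z ∧ ∀ᶠ lam in 𝓝[≠] z,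
      L.M lam = ∑ ν : Fin (L.mult z), μ (e ν).1 (e ν).2 / (lam - z) ^ ((ν : ℕ) + 1) + g lam

/-- The asymptotics of the square roots of the eigenvalues of the two sequences. -/
structure HasEigenvalueAsymptotics (ρ : Fin 2 → ℤ → ℂ) : Prop where
  first : (fun k : ℤ => ρ 0 k -
      ((k * Real.pi / (L.r₁ * L.l₁) : ℝ) * exp (I * L.θ₂) + L.C₁))
    =O[atTop] fun k : ℤ => (1 / k : ℝ)
  second : (fun k : ℤ => ρ 1 k -
      ((k * Real.pi / (L.r₂ * L.l₂) : ℝ) * exp (I * L.θ₁) + L.C₂))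
    =O[atTop] fun k : ℤ => (1 / k : ℝ)

/-- The part of the half-plane `Im (ρ a₁) > 0` in which `Im (ρ a₁) ≥ δ |ρ|` and which stays at
distance at least `δ` from the square roots of the eigenvalues. -/
def region (δ : ℝ) : Set ℂ :=
  {ρ | δ * ‖ρ‖ ≤ (ρ * L.a₁).im ∧ ∀ ζ : ℂ, L.IsEigenvalue (ζ ^ 2) → δ ≤ ‖ρ - ζ‖}

end ComplexWeightBVP

/-! Put λ = ρ², A = ρa₁l₁, B = ρa₂l₂, u = e^{2iA}, v = e^{2iB}, and let S be the solution with S(0)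
= 0, S'(0) = 1, Δ₀ = V(S). Every solution is y(0)φ + U(y)S, so M = Δ₀/Δ (`M_eq`) and the eigenvalues
are the zeros of the entire function Δ. Variation of constants on each interval
(`IsSolutionOn.norm_end_sub_le`) makes φ and S trigonometric up to relative errors O(1/ρ). Hence G =
(4i/ρ)e^{i(A+B)}Δ(ρ²) equals ω₊(uv − 1) + ω₋(v − u) + O(1/ρ) wherever Im A and Im B are bounded
below (`exists_G_sub_le`).

Everything rests on a₁/a₂ being non-real: then |ρ| ≤ K(|Im A| + |Im B|) (`exists_norm_le`), so Im A
and Im B cannot both stay bounded as ρ → ∞. Where both are large in modulus, |Δ| ≥ c|ρ|e^{|Im A| +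
|Im B|} (`exists_le_norm_Δ`) and there are no large eigenvalues. Since Δ(ρ²) is even in ρ, only two
half-strips remain. Where Im A is bounded and Im B ≥ 0, v is negligible and G is close to −ω₋u − ω₊;
where Im B is bounded and Im A ≥ 0, u is negligible and G is close to ω₋v − ω₊. Both are instances
of `IsStripLike`: in a local coordinate ζ at a zero of the model, G is ω(e^ζ − 1) + O(1/k), and a
contraction argument gives exactly one nearby zero, at distance O(1/k) (`zero_of_near_exp_sub_one`,
`IsStripLike.exists_roots`). The finitely many other eigenvalues are put in front of the first
sequence (`exists_arrangement`).

At a simple eigenvalue the Weyl coefficient is Δ₀/Δ'. On the first family both factors are read off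
from the asymptotics. On the second family the main part ω₊ − ω₋v of Δ₀ cancels; there the Wronskian
identity Δ₀·φ(T) = 1, valid at eigenvalues (`Δ₀_mul_phiT`), replaces Δ₀ by 1/φ(T), whose asymptotics
do not degenerate, and this produces the exponentially small factor e^{2i(A+B)}.

The root asymptotics give b, a₂ and ω₊/ω₋, and d₁² is a rational function of the data recovered so
far. For a₁, the difference iρa₁Δ₀ − Δ is smaller than Δ by a factor O(1/ρ) in the region
considered. -/

/-! ### Absolutely continuous primitives and their product rule -/

section ProductRule

open MeasureTheory

/-- The real and imaginary parts have real absolutely continuous primitives, which are recombined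
with the constant functions 1 and I. -/
theorem IntervalIntegrable.absolutelyContinuousOnInterval_primitive {f : ℝ → ℂ} {a b : ℝ}
    (h : IntervalIntegrable f volume a b) :
    AbsolutelyContinuousOnInterval (fun x => ∫ t in a..x, f t) a b := by
  have hre : IntervalIntegrable (fun t => (f t).re) volume a b :=
    ⟨h.1.re, h.2.re⟩
  have him : IntervalIntegrable (fun t => (f t).im) volume a b :=
    ⟨h.1.im, h.2.im⟩
  have c1 : ∀ c : ℂ, AbsolutelyContinuousOnInterval (fun _ : ℝ => c) a b := fun c =>
    contDiffOn_const.absolutelyContinuousOnInterval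
  have h1 := (hre.absolutelyContinuousOnInterval_intervalIntegral
    (c := a) Set.left_mem_uIcc).fun_smul (c1 1)
  have h2 := (him.absolutelyContinuousOnInterval_intervalIntegral
    (c := a) Set.left_mem_uIcc).fun_smul (c1 I)
  have h3 := h1.fun_add h2
  have hcongr : Set.EqOn (fun x => (∫ t in a..x, (f t).re) • (1 : ℂ) + (∫ t in a..x, (f t).im) • I)
      (fun x => ∫ t in a..x, f t) (Set.uIcc a b) := by
    intro x hx
    have hs : Set.uIcc a x ⊆ Set.uIcc a b := Set.uIcc_subset_uIcc_left hx
    have e1 : ∀ t, f t = ((f t).re : ℂ) + ((f t).im : ℂ) * I := fun t => (re_add_im (f t)).symm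
    simp only
    conv_rhs => rw [intervalIntegral.integral_congr (g := fun t => ((f t).re : ℂ) + ((f t).im : ℂ) * I) (fun t _ => e1 t)]
    have hre' := hre.mono_set hs
    have him' := him.mono_set hs
    have hre2 : IntervalIntegrable (fun t => ((f t).re : ℂ)) volume a x :=
      ⟨hre'.1.ofReal, hre'.2.ofReal⟩
    have him2 : IntervalIntegrable (fun t => ((f t).im : ℂ)) volume a x :=
      ⟨him'.1.ofReal, him'.2.ofReal⟩
    rw [intervalIntegral.integral_add hre2 (him2.mul_const I),
      intervalIntegral.integral_mul_const, intervalIntegral.integral_ofReal,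
      intervalIntegral.integral_ofReal]
    simp
  refine (absolutelyContinuousOnInterval_iff _ _ _).2 fun ε hε => ?_
  obtain ⟨δ, hδ, H⟩ := (absolutelyContinuousOnInterval_iff _ _ _).1 h3 ε hε
  refine ⟨δ, hδ, fun E hE hs => ?_⟩
  convert! H E hE hs using 2 with i hi
  have hm := hE.1 i hi
  exact congrArg₂ dist (hcongr hm.1).symm (hcongr hm.2).symm

/-- Product rule for two indefinite integrals. -/
theorem integral_primitive_mul_primitive {u v u' v' : ℝ → ℂ} {a b : ℝ}
    (hu' : IntervalIntegrable u' volume a b) (hv' : IntervalIntegrable v' volume a b)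
    (hu : ∀ x ∈ Set.uIcc a b, u x = u a + ∫ t in a..x, u' t)
    (hv : ∀ x ∈ Set.uIcc a b, v x = v a + ∫ t in a..x, v' t) :
    ∫ t in a..b, (u' t * v t + u t * v' t) = u b * v b - u a * v a := by
  set U : ℝ → ℂ := fun x => u a + ∫ t in a..x, u' t with hU
  set V : ℝ → ℂ := fun x => v a + ∫ t in a..x, v' t with hV
  have c1 : ∀ c : ℂ, AbsolutelyContinuousOnInterval (fun _ : ℝ => c) a b := fun c =>
    contDiffOn_const.absolutelyContinuousOnInterval
  have hUac : AbsolutelyContinuousOnInterval U a b :=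
    (c1 (u a)).fun_add hu'.absolutelyContinuousOnInterval_primitive
  have hVac : AbsolutelyContinuousOnInterval V a b :=
    (c1 (v a)).fun_add hv'.absolutelyContinuousOnInterval_primitive
  have hint : IntervalIntegrable (fun t => u' t * V t + U t * v' t) volume a b :=
    (hu'.mul_continuousOn hVac.continuousOn).add (hv'.continuousOn_mul hUac.continuousOn)
  -- The product minus the integral of its almost everywhere derivative is absolutely continuous
  -- with derivative zero almost everywhere, hence constant.
  have hac : AbsolutelyContinuousOnInterval
      (fun x => U x • V x - ∫ t in a..x, (u' t * V t + U t * v' t)) a b :=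
    (hUac.fun_smul hVac).fun_sub hint.absolutelyContinuousOnInterval_primitive
  obtain ⟨C, hC⟩ := hac.const_of_ae_hasDerivAt_zero (by
    filter_upwards [hu'.ae_hasDerivAt_integral, hv'.ae_hasDerivAt_integral,
      hint.ae_hasDerivAt_integral] with x h1 h2 h3 hx
    have d1 : HasDerivAt U (u' x) x := (h1 hx a Set.left_mem_uIcc).const_add _
    have d2 : HasDerivAt V (v' x) x := (h2 hx a Set.left_mem_uIcc).const_add _
    have d3 := h3 hx a Set.left_mem_uIcc
    have := (d1.mul d2).sub d3
    simp only [sub_self] at this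
    exact this)
  have e1 := hC a Set.left_mem_uIcc
  have e2 := hC b Set.right_mem_uIcc
  rw [intervalIntegral.integral_congr (g := fun t => u' t * V t + U t * v' t)
    (fun t ht => by simp only [hu t ht, hv t ht, hU, hV]), hu b Set.right_mem_uIcc,
    hv b Set.right_mem_uIcc]
  have hUa : U a = u a := by simp [hU]
  have hVa : V a = v a := by simp [hV]
  simp only [smul_eq_mul, hUa, hVa, intervalIntegral.integral_same, sub_zero] at e1 e2
  rw [← e1] at e2
  linear_combination -e2

end ProductRule

/-! ### Lagrange's identity and variation of constants -/

namespace IsSolutionOn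

open MeasureTheory

variable {q q₁ q₂ : ℝ → ℂ} {c : ℂ} {α β : ℝ} {y y' z z' : ℝ → ℂ}

theorem integrable_coeff_mul (hαβ : α ≤ β) (hq : IntervalIntegrable q volume α β)
    (hy : ContinuousOn y (Set.Icc α β)) :
    IntervalIntegrable (fun t => (q t - c) * y t) volume α β :=
  (hq.sub intervalIntegrable_const).mul_continuousOn (by rwa [Set.uIcc_of_le hαβ])

theorem mono {β' : ℝ} (h : IsSolutionOn q c α β y y') (hβ : β' ≤ β) :
    IsSolutionOn q c α β' y y' where
  cont := h.cont.mono (Set.Icc_subset_Icc_right hβ)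
  cont' := h.cont'.mono (Set.Icc_subset_Icc_right hβ)
  eq x hx := h.eq x (Set.Icc_subset_Icc_right hβ hx)
  eq' x hx := h.eq' x (Set.Icc_subset_Icc_right hβ hx)

/-- Lagrange's identity. -/
theorem lagrange (hαβ : α ≤ β) (hq₁ : IntervalIntegrable q₁ volume α β)
    (hq₂ : IntervalIntegrable q₂ volume α β)
    (hy : IsSolutionOn q₁ c α β y y') (hz : IsSolutionOn q₂ c α β z z') :
    (y β * z' β - y' β * z β) - (y α * z' α - y' α * z α) =
      ∫ t in α..β, (q₂ t - q₁ t) * (y t * z t) := by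
  have cy : ContinuousOn y' (Set.uIcc α β) := by simpa [Set.uIcc_of_le hαβ] using hy.cont'
  have cz : ContinuousOn z' (Set.uIcc α β) := by simpa [Set.uIcc_of_le hαβ] using hz.cont'
  have cy0 : ContinuousOn y (Set.uIcc α β) := by simpa [Set.uIcc_of_le hαβ] using hy.cont
  have cz0 : ContinuousOn z (Set.uIcc α β) := by simpa [Set.uIcc_of_le hαβ] using hz.cont
  have iy := integrable_coeff_mul (c := c) hαβ hq₁ hy.cont
  have iz := integrable_coeff_mul (c := c) hαβ hq₂ hz.cont
  have p1 := integral_primitive_mul_primitive cy.intervalIntegrable iz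
    (by simpa [Set.uIcc_of_le hαβ] using hy.eq) (by simpa [Set.uIcc_of_le hαβ] using hz.eq')
  have p2 := integral_primitive_mul_primitive iy cz.intervalIntegrable
    (by simpa [Set.uIcc_of_le hαβ] using hy.eq') (by simpa [Set.uIcc_of_le hαβ] using hz.eq)
  have : ∀ t, (q₂ t - q₁ t) * (y t * z t) = (y' t * z' t + y t * ((q₂ t - c) * z t))
      - ((q₁ t - c) * y t * z t + y' t * z' t) := fun t => by ring
  simp only [this]
  rw [intervalIntegral.integral_sub, p1, p2]
  · ring
  · exact ((cy.mul cz).intervalIntegrable).add (iz.continuousOn_mul cy0)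
  · exact (iy.mul_continuousOn cz0).add ((cy.mul cz).intervalIntegrable)

theorem wronskian (hαβ : α ≤ β) (hq : IntervalIntegrable q volume α β)
    (hy : IsSolutionOn q c α β y y') (hz : IsSolutionOn q c α β z z') :
    y β * z' β - y' β * z β = y α * z' α - y' α * z α := by
  have := lagrange hαβ hq hq hy hz
  simp only [sub_self, zero_mul, intervalIntegral.integral_zero] at this
  linear_combination this

/-- Provides the trigonometric solutions for zero potential that are paired with a given solution in
Lagrange's identity. -/
theorem of_hasDerivAt {z z' : ℝ → ℂ} {c : ℂ} (h1 : ∀ x, HasDerivAt z (z' x) x)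
    (h2 : ∀ x, HasDerivAt z' (-c * z x) x) (α β : ℝ) :
    IsSolutionOn (fun _ => 0) c α β z z' := by
  have cz : Continuous z := continuous_iff_continuousAt.2 fun x => (h1 x).continuousAt
  have cz' : Continuous z' := continuous_iff_continuousAt.2 fun x => (h2 x).continuousAt
  refine ⟨cz.continuousOn, cz'.continuousOn, fun x _ => ?_, fun x _ => ?_⟩
  · rw [intervalIntegral.integral_eq_sub_of_hasDerivAt (fun t _ => h1 t) (cz'.intervalIntegrable _ _)]
    ring
  · simp only [zero_sub]
    rw [intervalIntegral.integral_eq_sub_of_hasDerivAt (fun t _ => h2 t)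
      ((continuous_const.mul cz).intervalIntegrable _ _)]
    ring

/-- The solution through a fundamental system. -/
theorem eq_fundamental {C C' S S' : ℝ → ℂ} (hαβ : α ≤ β) (hq : IntervalIntegrable q volume α β)
    (hC : IsSolutionOn q c α β C C') (hS : IsSolutionOn q c α β S S')
    (hC0 : C α = 1) (hC1 : C' α = 0) (hS0 : S α = 0) (hS1 : S' α = 1)
    (hy : IsSolutionOn q c α β y y') {x : ℝ} (hx : x ∈ Set.Icc α β) :
    y x = y α * C x + y' α * S x ∧ y' x = y α * C' x + y' α * S' x := by
  have hqx := hq.mono_set (Set.uIcc_subset_uIcc_left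
    (by rwa [Set.uIcc_of_le hαβ] : x ∈ Set.uIcc α β))
  -- Cramer's rule: the Wronskian of `C` and `S` is 1, and those of `y` with `S` and with `C` are
  -- the initial values up to sign.
  have w1 := wronskian hx.1 hqx (hC.mono hx.2) (hS.mono hx.2)
  have w2 := wronskian hx.1 hqx (hy.mono hx.2) (hS.mono hx.2)
  have w3 := wronskian hx.1 hqx (hy.mono hx.2) (hC.mono hx.2)
  rw [hC0, hC1, hS0, hS1] at w1
  rw [hS0, hS1] at w2
  rw [hC0, hC1] at w3
  constructor
  · linear_combination C x * w2 - S x * w3 - y x * w1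
  · linear_combination C' x * w2 - S' x * w3 - y' x * w1

/-- Variation of constants. -/
theorem variation_of_constants {μ : ℂ} (hμ : μ ≠ 0) (hαβ : α ≤ β)
    (hq : IntervalIntegrable q volume α β)
    (hy : IsSolutionOn q (μ ^ 2) α β y y') {x : ℝ} (hx : x ∈ Set.Icc α β) :
    y x = y α * cos (μ * (x - α)) + y' α / μ * sin (μ * (x - α)) +
        (∫ t in α..x, q t * (y t * sin (μ * (x - t)))) / μ ∧
      y' x = - μ * y α * sin (μ * (x - α)) + y' α * cos (μ * (x - α)) +
        ∫ t in α..x, q t * (y t * cos (μ * (x - t))) := by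
  have hqx := hq.mono_set (Set.uIcc_subset_uIcc_left
    (by rwa [Set.uIcc_of_le hαβ] : x ∈ Set.uIcc α β))
  have lin : ∀ t : ℝ, HasDerivAt (fun t : ℝ => μ * ((x : ℂ) - t)) (-μ) t := fun t => by
    have := ((hasDerivAt_id t).ofReal_comp.const_sub (x : ℂ)).const_mul μ
    simpa using this
  have ds : ∀ t : ℝ, HasDerivAt (fun t : ℝ => sin (μ * ((x : ℂ) - t)))
      (-μ * cos (μ * ((x : ℂ) - t))) t := fun t => by
    convert! (Complex.hasDerivAt_sin (μ * ((x : ℂ) - t))).comp t (lin t) using 1; ring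
  have dc : ∀ t : ℝ, HasDerivAt (fun t : ℝ => cos (μ * ((x : ℂ) - t)))
      (μ * sin (μ * ((x : ℂ) - t))) t := fun t => by
    convert! (Complex.hasDerivAt_cos (μ * ((x : ℂ) - t))).comp t (lin t) using 1; ring
  have s1 := of_hasDerivAt (c := μ ^ 2) ds (fun t => by
    convert! (dc t).const_mul (-μ) using 1; ring) α x
  have s2 := of_hasDerivAt (c := μ ^ 2) dc (fun t => by
    convert! (ds t).const_mul μ using 1; ring) α x
  -- As functions of `t`, sin μ(x − t) vanishes at `t = x` and cos μ(x − t) has zero derivative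
  -- there, so the boundary term at `x` isolates `y x` in the first identity and `y' x` in the
  -- second.
  have l1 := lagrange hx.1 hqx intervalIntegrable_const (hy.mono hx.2) s1
  have l2 := lagrange hx.1 hqx intervalIntegrable_const (hy.mono hx.2) s2
  simp only [zero_sub, neg_mul, intervalIntegral.integral_neg] at l1 l2
  simp only [sub_self, mul_zero, cos_zero, sin_zero] at l1 l2
  generalize (∫ t in α..x, q t * (y t * sin (μ * (x - t)))) = J at l1 ⊢
  constructor
  · field_simp
    linear_combination (-1 : ℂ) * l1
  · linear_combination (-1 : ℂ) * l2

end IsSolutionOn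

/-! ### Existence of solutions and analytic dependence on the spectral parameter -/

/-- Solutions of linear fixed point equations depend analytically on a parameter. -/
theorem exists_differentiableOn_fixedPoint {E : Type*} [NormedAddCommGroup E] [NormedSpace ℂ E]
    [CompleteSpace E] (A B : E →L[ℂ] E) (G : E) {R : ℝ} (h : ‖A‖ + R * ‖B‖ < 1) :
    ∃ f : ℂ → E, DifferentiableOn ℂ f (Metric.ball 0 R) ∧
      ∀ c ∈ Metric.ball (0 : ℂ) R, f c = G + (A (f c) - c • B (f c)) := by
  have hunit : ∀ c ∈ Metric.ball (0 : ℂ) R, IsUnit (1 - (A - c • B)) := by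
    intro c hc
    rw [mem_ball_zero_iff] at hc
    refine isUnit_one_sub_of_norm_lt_one ?_
    calc ‖A - c • B‖ ≤ ‖A‖ + ‖c‖ * ‖B‖ := by
          rw [← norm_smul]; exact norm_sub_le _ _
      _ ≤ ‖A‖ + R * ‖B‖ := by gcongr
      _ < 1 := h
  refine ⟨fun c => (Ring.inverse (1 - (A - c • B))) G, ?_, ?_⟩
  · intro c hc
    have h2 : DifferentiableAt ℂ (fun c : ℂ => 1 - (A - c • B)) c :=
      ((differentiableAt_id.smul_const B).const_sub A).const_sub 1
    have h3 : DifferentiableAt ℂ (fun c : ℂ => Ring.inverse (1 - (A - c • B))) c :=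
      (differentiableAt_inverse (𝕜 := ℂ) (hunit c hc)).comp (f := fun c : ℂ => 1 - (A - c • B)) c h2
    exact (h3.clm_apply (differentiableAt_const G)).differentiableWithinAt
  · intro c hc
    have := Ring.mul_inverse_cancel _ (hunit c hc)
    have := congrArg (fun T : E →L[ℂ] E => T G) this
    simp only [mul_apply_eq_comp, sub_apply, one_apply_eq_self, smul_apply] at this
    exact eq_add_of_sub_eq this

section Volterra

open MeasureTheory

variable {α β : ℝ}

/-- This makes the weighted Volterra kernel uniformly small for large `τ`, so that a single Neumann
series suffices. -/
theorem mul_exp_neg_mul_le {τ s : ℝ} (hτ : 0 < τ) : s * Real.exp (-(τ * s)) ≤ 1 / τ := by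
  rw [le_div_iff₀ hτ, Real.exp_neg, mul_right_comm, ← div_eq_mul_inv, div_le_one (Real.exp_pos _)]
  have := Real.add_one_le_exp (τ * s)
  linarith

/-- The Volterra operator with kernel `(x - t) e^{-τ (x - t)} p(t)` on `C[α, β]`. -/
noncomputable def volterraOp (hαβ : α ≤ β) {τ : ℝ} (hτ : 0 < τ) {p : ℝ → ℂ}
    (hp : IntervalIntegrable p volume α β) : C(Set.Icc α β, ℂ) →L[ℂ] C(Set.Icc α β, ℂ) :=
  have hF : ∀ (f : C(Set.Icc α β, ℂ)), Continuous (Set.IccExtend hαβ f) := fun f =>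
    f.continuous.Icc_extend'
  have hint : ∀ (f : C(Set.Icc α β, ℂ)) (x : Set.Icc α β), IntervalIntegrable
      (fun t : ℝ => (((x - t) * Real.exp (-(τ * (x - t))) : ℝ) : ℂ) *
        (p t * Set.IccExtend hαβ f t)) volume α x := fun f x =>
    ((hp.mono_set (Set.uIcc_subset_uIcc_left (by rw [Set.uIcc_of_le hαβ]; exact x.2))).mul_continuousOn
      (hF f).continuousOn).continuousOn_mul (by fun_prop)
  LinearMap.mkContinuous
    { toFun := fun f =>
        { toFun := fun x => ∫ t in α..x, (((x - t) * Real.exp (-(τ * (x - t))) : ℝ) : ℂ) *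
            (p t * Set.IccExtend hαβ f t)
          continuous_toFun := by
            -- The kernel is a sum of products of a function of `x` and a function of `t`, so
            -- continuity in `x` reduces to that of two primitives.
            have e : ∀ x t : ℝ, (((x - t) * Real.exp (-(τ * (x - t))) : ℝ) : ℂ) *
                (p t * Set.IccExtend hαβ f t) =
                ((x * Real.exp (-(τ * x)) : ℝ) : ℂ) *
                  ((Real.exp (τ * t) : ℝ) * (p t * Set.IccExtend hαβ f t)) -
                (Real.exp (-(τ * x)) : ℝ) *
                  ((t * Real.exp (τ * t) : ℝ) * (p t * Set.IccExtend hαβ f t)) := by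
              intro x t
              have : Real.exp (-(τ * (x - t))) = Real.exp (-(τ * x)) * Real.exp (τ * t) := by
                rw [← Real.exp_add]; ring_nf
              rw [this]; push_cast; ring
            have i1 : IntervalIntegrable (fun t : ℝ => ((Real.exp (τ * t) : ℝ) : ℂ) *
                (p t * Set.IccExtend hαβ f t)) volume α β :=
              (hp.mul_continuousOn (hF f).continuousOn).continuousOn_mul (by fun_prop)
            have i2 : IntervalIntegrable (fun t : ℝ => ((t * Real.exp (τ * t) : ℝ) : ℂ) *
                (p t * Set.IccExtend hαβ f t)) volume α β :=
              (hp.mul_continuousOn (hF f).continuousOn).continuousOn_mul (by fun_prop)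
            have c1 := intervalIntegral.continuousOn_primitive_interval
              (μ := volume) (by rw [Set.uIcc_of_le hαβ]; exact
              (intervalIntegrable_iff_integrableOn_Icc_of_le hαβ).1 i1)
            have c2 := intervalIntegral.continuousOn_primitive_interval
              (μ := volume) (by rw [Set.uIcc_of_le hαβ]; exact
              (intervalIntegrable_iff_integrableOn_Icc_of_le hαβ).1 i2)
            rw [Set.uIcc_of_le hαβ] at c1 c2
            have : ContinuousOn (fun x : ℝ => ((x * Real.exp (-(τ * x)) : ℝ) : ℂ) *
                (∫ t in α..x, ((Real.exp (τ * t) : ℝ) : ℂ) * (p t * Set.IccExtend hαβ f t)) -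
                (Real.exp (-(τ * x)) : ℝ) *
                (∫ t in α..x, ((t * Real.exp (τ * t) : ℝ) : ℂ) * (p t * Set.IccExtend hαβ f t)))
                (Set.Icc α β) := by
              refine ContinuousOn.sub (ContinuousOn.mul (by fun_prop) c1)
                (ContinuousOn.mul (by fun_prop) c2)
            have := continuousOn_iff_continuous_domRestrict.1 this
            convert! this using 2 with x
            have hs : Set.uIcc α (x : ℝ) ⊆ Set.uIcc α β :=
              Set.uIcc_subset_uIcc_left (by rw [Set.uIcc_of_le hαβ]; exact x.2)
            simp only [e]
            rw [intervalIntegral.integral_sub ((i1.mono_set hs).const_mul _)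
              ((i2.mono_set hs).const_mul _), intervalIntegral.integral_const_mul,
              intervalIntegral.integral_const_mul]
            rfl }
      map_add' := fun f g => by
        ext x
        simp only [ContinuousMap.coe_mk, ContinuousMap.add_apply]
        rw [← intervalIntegral.integral_add (hint f x) (hint g x)]
        refine intervalIntegral.integral_congr fun t _ => ?_
        simp only [Set.IccExtend, Function.comp, ContinuousMap.add_apply]
        ring
      map_smul' := fun a f => by
        ext x
        simp only [ContinuousMap.coe_mk, ContinuousMap.smul_apply, RingHom.id_apply, smul_eq_mul]
        rw [← intervalIntegral.integral_const_mul]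
        refine intervalIntegral.integral_congr fun t _ => ?_
        simp only [Set.IccExtend, Function.comp, ContinuousMap.smul_apply, smul_eq_mul]
        ring }
    ((∫ t in α..β, ‖p t‖) / τ) (fun f => by
      have hnn : 0 ≤ ∫ t in α..β, ‖p t‖ :=
        intervalIntegral.integral_nonneg hαβ fun t _ => norm_nonneg _
      rw [ContinuousMap.norm_le _ (by positivity)]
      intro x
      simp only [LinearMap.coe_mk, AddHom.coe_mk, ContinuousMap.coe_mk]
      have hs : Set.uIcc α (x : ℝ) ⊆ Set.uIcc α β :=
        Set.uIcc_subset_uIcc_left (by rw [Set.uIcc_of_le hαβ]; exact x.2)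
      calc _ ≤ ∫ t in α..x, (1 / τ * ‖f‖) * ‖p t‖ := by
            refine intervalIntegral.norm_integral_le_of_norm_le x.2.1
              (Eventually.of_forall fun t ht => ?_) ((hp.norm.mono_set hs).const_mul _)
            rw [norm_mul, norm_mul, Complex.norm_real, Real.norm_of_nonneg
              (mul_nonneg (by linarith [ht.2]) (Real.exp_pos _).le)]
            have h1 := mul_exp_neg_mul_le (s := (x : ℝ) - t) hτ
            have h2 : ‖Set.IccExtend hαβ f t‖ ≤ ‖f‖ := f.norm_coe_le_norm _
            calc _ ≤ 1 / τ * (‖p t‖ * ‖f‖) := by gcongr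
              _ = _ := by ring
        _ ≤ ∫ t in α..β, (1 / τ * ‖f‖) * ‖p t‖ := by
            refine intervalIntegral.integral_mono_interval le_rfl x.2.1 x.2.2
              (Eventually.of_forall fun t => by positivity) (hp.norm.const_mul _)
        _ = _ := by rw [intervalIntegral.integral_const_mul]; ring)

theorem volterraOp_apply (hαβ : α ≤ β) {τ : ℝ} (hτ : 0 < τ) {p : ℝ → ℂ}
    (hp : IntervalIntegrable p volume α β) (f : C(Set.Icc α β, ℂ)) (x : Set.Icc α β) :
    volterraOp hαβ hτ hp f x = ∫ t in α..x, (((x - t) * Real.exp (-(τ * (x - t))) : ℝ) : ℂ) *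
            (p t * Set.IccExtend hαβ f t) := rfl

theorem norm_volterraOp_le (hαβ : α ≤ β) {τ : ℝ} (hτ : 0 < τ) {p : ℝ → ℂ}
    (hp : IntervalIntegrable p volume α β) :
    ‖volterraOp hαβ hτ hp‖ ≤ (∫ t in α..β, ‖p t‖) / τ :=
  by
  unfold volterraOp
  apply LinearMap.mkContinuous_norm_le
  exact div_nonneg (intervalIntegral.integral_nonneg hαβ fun _ _ => norm_nonneg _) hτ.le

/-- Integration against an integrable function, as a functional on `C[α, β]`. -/
noncomputable def integralAgainst (hαβ : α ≤ β) {p : ℝ → ℂ}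
    (hp : IntervalIntegrable p volume α β) : C(Set.Icc α β, ℂ) →L[ℂ] ℂ :=
  have hint : ∀ (f : C(Set.Icc α β, ℂ)), IntervalIntegrable
      (fun t : ℝ => p t * Set.IccExtend hαβ f t) volume α β := fun f =>
    hp.mul_continuousOn f.continuous.Icc_extend'.continuousOn
  LinearMap.mkContinuous
    { toFun := fun f => ∫ t in α..β, p t * Set.IccExtend hαβ f t
      map_add' := fun f g => by
        rw [← intervalIntegral.integral_add (hint f) (hint g)]
        refine intervalIntegral.integral_congr fun t _ => ?_
        simp only [Set.IccExtend, Function.comp, ContinuousMap.add_apply]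
        ring
      map_smul' := fun a f => by
        simp only [RingHom.id_apply, smul_eq_mul]
        rw [← intervalIntegral.integral_const_mul]
        refine intervalIntegral.integral_congr fun t _ => ?_
        simp only [Set.IccExtend, Function.comp, ContinuousMap.smul_apply, smul_eq_mul]
        ring }
    (∫ t in α..β, ‖p t‖) (fun f => by
      simp only [LinearMap.coe_mk, AddHom.coe_mk]
      rw [← intervalIntegral.integral_mul_const]
      refine intervalIntegral.norm_integral_le_of_norm_le hαβ
        (Eventually.of_forall fun t ht => ?_) (hp.norm.mul_const _)
      rw [norm_mul]
      gcongr
      exact f.norm_coe_le_norm _)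

theorem integralAgainst_apply (hαβ : α ≤ β) {p : ℝ → ℂ}
    (hp : IntervalIntegrable p volume α β) (f : C(Set.Icc α β, ℂ)) :
    integralAgainst hαβ hp f = ∫ t in α..β, p t * Set.IccExtend hαβ f t := rfl

end Volterra

namespace IsSolutionOn

open MeasureTheory

variable {q : ℝ → ℂ} {c : ℂ} {α β : ℝ}

/-- A continuous solution of the Volterra equation solves the differential equation. -/
theorem of_volterra (hαβ : α ≤ β) (hq : IntervalIntegrable q volume α β) {y : ℝ → ℂ} {y₀ y₁ : ℂ}
    (cy : ContinuousOn y (Set.Icc α β))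
    (hy : ∀ x ∈ Set.Icc α β, y x = y₀ + y₁ * (x - α) +
      ∫ t in α..x, ((x : ℂ) - t) * ((q t - c) * y t)) :
    IsSolutionOn q c α β y (fun x => y₁ + ∫ t in α..x, (q t - c) * y t) := by
  have hi := integrable_coeff_mul (c := c) hαβ hq cy
  have c1 := intervalIntegral.continuousOn_primitive_interval
    (μ := volume) (by rw [Set.uIcc_of_le hαβ]; exact
    (intervalIntegrable_iff_integrableOn_Icc_of_le hαβ).1 hi)
  rw [Set.uIcc_of_le hαβ] at c1
  have hα := hy α (Set.left_mem_Icc.2 hαβ)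
  simp only [sub_self, mul_zero, intervalIntegral.integral_same, add_zero] at hα
  refine ⟨cy, continuousOn_const.add c1, fun x hx => ?_, fun x hx => by simp⟩
  have hs : Set.uIcc α x ⊆ Set.uIcc α β :=
    Set.uIcc_subset_uIcc_left (by rwa [Set.uIcc_of_le hαβ])
  have c2 : ContinuousOn (fun x => ∫ t in α..x, (q t - c) * y t) (Set.uIcc α x) :=
    c1.mono (by rw [Set.uIcc_of_le hαβ] at hs; exact hs)
  have hix := hi.mono_set hs
  -- Integration by parts against `x - s` turns the iterated integral of the right-hand side into
  -- the integral with kernel `x - t`.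
  have pr := integral_primitive_mul_primitive (a := α) (b := x)
    (u := fun s => ∫ t in α..s, (q t - c) * y t) (v := fun s : ℝ => (x : ℂ) - s)
    (v' := fun _ => -1) hix intervalIntegrable_const
    (fun s hs => by simp) (fun s hs => by simp)
  simp only [sub_self, mul_zero, intervalIntegral.integral_same, zero_mul, mul_neg, mul_one] at pr
  have i1 : IntervalIntegrable (fun t : ℝ => (q t - c) * y t * ((x : ℂ) - t)) volume α x :=
    hix.mul_continuousOn (by fun_prop)
  have i2 : IntervalIntegrable (fun s => -∫ t in α..s, (q t - c) * y t) volume α x :=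
    c2.intervalIntegrable.neg
  rw [intervalIntegral.integral_add i1 i2, intervalIntegral.integral_neg] at pr
  rw [intervalIntegral.integral_add intervalIntegrable_const c2.intervalIntegrable,
    hy x hx, hα, intervalIntegral.integral_const]
  have e : ∀ t : ℝ, ((x : ℂ) - t) * ((q t - c) * y t) = (q t - c) * y t * ((x : ℂ) - t) :=
    fun t => by ring
  simp only [e, real_smul]
  push_cast
  linear_combination pr

/-- On each disk of spectral parameters there are solutions whose end values are analytic. -/
theorem exists_family_on_ball (hαβ : α ≤ β) (hq : IntervalIntegrable q volume α β) (y₀ y₁ : ℂ)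
    (R : ℝ) : ∃ Y Y' : ℂ → ℝ → ℂ,
      (∀ c ∈ Metric.ball (0 : ℂ) R, IsSolutionOn q c α β (Y c) (Y' c) ∧ Y c α = y₀ ∧ Y' c α = y₁) ∧
      DifferentiableOn ℂ (fun c => Y c β) (Metric.ball 0 R) ∧
      DifferentiableOn ℂ (fun c => Y' c β) (Metric.ball 0 R) := by
  rcases le_or_gt R 0 with hR | hR
  · have : Metric.ball (0 : ℂ) R = ∅ := Metric.ball_eq_empty.2 hR
    exact ⟨fun _ _ => 0, fun _ _ => 0, by simp [this]⟩
  have hnn : 0 ≤ ∫ t in α..β, ‖q t‖ :=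
    intervalIntegral.integral_nonneg hαβ fun t _ => norm_nonneg _
  -- The summand 1 makes the total norm bound `(τ - 1) / τ`, strictly below one for all spectral
  -- parameters in the disk.
  set τ : ℝ := (∫ t in α..β, ‖q t‖) + R * (β - α) + 1 with hτdef
  have hl : 0 ≤ R * (β - α) := mul_nonneg hR.le (by linarith)
  have hτ : 0 < τ := by positivity
  have h1 : IntervalIntegrable (fun _ : ℝ => (1 : ℂ)) volume α β := intervalIntegrable_const
  set Kq := volterraOp hαβ hτ hq
  set K1 := volterraOp hαβ hτ h1
  have nq : ‖Kq‖ ≤ (∫ t in α..β, ‖q t‖) / τ := norm_volterraOp_le hαβ hτ hq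
  have n1 : ‖K1‖ ≤ (β - α) / τ := by
    have := norm_volterraOp_le hαβ hτ h1
    simpa using this
  -- The fixed point is the solution times `exp (-τ (x - α))`; `Y` below removes the weight.
  let G : C(Set.Icc α β, ℂ) := ⟨fun x => (Real.exp (-(τ * (x - α))) : ℝ) * (y₀ + y₁ * ((x : ℝ) - α)),
    by fun_prop⟩
  have hlt : ‖Kq‖ + R * ‖K1‖ < 1 := by
    calc _ ≤ (∫ t in α..β, ‖q t‖) / τ + R * ((β - α) / τ) := by gcongr
      _ = ((∫ t in α..β, ‖q t‖) + R * (β - α)) / τ := by ring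
      _ < 1 := by rw [div_lt_one hτ]; linarith
  obtain ⟨f, hdf, hfix⟩ := exists_differentiableOn_fixedPoint Kq K1 G hlt
  let Y : ℂ → ℝ → ℂ := fun c x => (Real.exp (τ * (x - α)) : ℝ) * Set.IccExtend hαβ (f c) x
  have cY : ∀ c, Continuous (Y c) := fun c =>
    Continuous.mul (by fun_prop) (f c).continuous.Icc_extend'
  have key : ∀ c ∈ Metric.ball (0 : ℂ) R, ∀ x ∈ Set.Icc α β, Y c x = y₀ + y₁ * (x - α) +
      ∫ t in α..x, ((x : ℂ) - t) * ((q t - c) * Y c t) := by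
    intro c hc x hx
    have hs : Set.uIcc α x ⊆ Set.uIcc α β :=
      Set.uIcc_subset_uIcc_left (by rwa [Set.uIcc_of_le hαβ])
    have hval := congrArg (fun g : C(Set.Icc α β, ℂ) => g ⟨x, hx⟩) (hfix c hc)
    simp only [ContinuousMap.add_apply, ContinuousMap.sub_apply, ContinuousMap.smul_apply,
      smul_eq_mul] at hval
    have hYx : Y c x = (Real.exp (τ * (x - α)) : ℝ) * f c ⟨x, hx⟩ := by
      simp only [Y, Set.IccExtend_of_mem hαβ _ hx]
    rw [hYx, hval]
    simp only [Kq, K1, volterraOp_apply, G, ContinuousMap.coe_mk]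
    have cF : Continuous (Set.IccExtend hαβ (f c)) := (f c).continuous.Icc_extend'
    have j1 : IntervalIntegrable (fun t : ℝ => (((x - t) * Real.exp (-(τ * (x - t))) : ℝ) : ℂ) *
        (q t * Set.IccExtend hαβ (f c) t)) volume α x :=
      ((hq.mono_set hs).mul_continuousOn cF.continuousOn).continuousOn_mul (by fun_prop)
    have j2 : IntervalIntegrable (fun t : ℝ => (((x - t) * Real.exp (-(τ * (x - t))) : ℝ) : ℂ) *
        (1 * Set.IccExtend hαβ (f c) t)) volume α x :=
      ((h1.mono_set hs).mul_continuousOn cF.continuousOn).continuousOn_mul (by fun_prop)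
    rw [← intervalIntegral.integral_const_mul, ← intervalIntegral.integral_sub j1 (j2.const_mul c),
      mul_add, ← intervalIntegral.integral_const_mul]
    congr 1
    · rw [← mul_assoc, ← ofReal_mul, ← Real.exp_add]
      simp
    · refine intervalIntegral.integral_congr fun t _ => ?_
      have : Real.exp (τ * (t - α)) = Real.exp (τ * (x - α)) * Real.exp (-(τ * (x - t))) := by
        rw [← Real.exp_add]; ring_nf
      simp only [Y, this]
      push_cast
      ring
  have hsol := fun c hc => of_volterra hαβ hq (cY c).continuousOn (key c hc)
  refine ⟨Y, fun c x => y₁ + ∫ t in α..x, (q t - c) * Y c t, fun c hc => ⟨hsol c hc, ?_, by simp⟩,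
    ?_, ?_⟩
  · simpa using key c hc α (Set.left_mem_Icc.2 hαβ)
  · have : (fun c => Y c β) = fun c => (Real.exp (τ * (β - α)) : ℂ) *
        ContinuousMap.evalCLM ℂ (⟨β, Set.right_mem_Icc.2 hαβ⟩ : Set.Icc α β) (f c) := by
      ext c
      simp only [Y, Set.IccExtend_of_mem hαβ _ (Set.right_mem_Icc.2 hαβ)]
      simp
    rw [this]
    refine DifferentiableOn.const_mul ?_ _
    exact (ContinuousMap.evalCLM ℂ _).differentiable.comp_differentiableOn hdf
  · have i1 : IntervalIntegrable (fun t : ℝ => q t * (Real.exp (τ * (t - α)) : ℝ)) volume α β :=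
      hq.mul_continuousOn (by fun_prop)
    have i2 : IntervalIntegrable (fun t : ℝ => (1 : ℂ) * (Real.exp (τ * (t - α)) : ℝ))
        volume α β := h1.mul_continuousOn (by fun_prop)
    have : (fun c => y₁ + ∫ t in α..β, (q t - c) * Y c t) = fun c =>
        y₁ + (integralAgainst hαβ i1 (f c) - c * integralAgainst hαβ i2 (f c)) := by
      ext c
      have cF : Continuous (Set.IccExtend hαβ (f c)) := (f c).continuous.Icc_extend'
      rw [integralAgainst_apply, integralAgainst_apply, ← intervalIntegral.integral_const_mul,
        ← intervalIntegral.integral_sub (i1.mul_continuousOn cF.continuousOn)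
          ((i2.mul_continuousOn cF.continuousOn).const_mul c)]
      congr 1
      refine intervalIntegral.integral_congr fun t _ => ?_
      simp only [Y]
      ring
    rw [this]
    exact ((((integralAgainst hαβ i1).differentiable.comp_differentiableOn hdf)).sub
      (differentiableOn_id.mul ((integralAgainst hαβ i2).differentiable.comp_differentiableOn hdf))).const_add _

theorem exists_solution (hαβ : α ≤ β) (hq : IntervalIntegrable q volume α β) (y₀ y₁ c : ℂ) :
    ∃ Y Y' : ℝ → ℂ, IsSolutionOn q c α β Y Y' ∧ Y α = y₀ ∧ Y' α = y₁ := by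
  obtain ⟨Y, Y', h, -⟩ := exists_family_on_ball hαβ hq y₀ y₁ (‖c‖ + 1)
  exact ⟨Y c, Y' c, h c (by simp)⟩

/-- Both solutions are the same combination of one fundamental system, by `eq_fundamental`; no
Gronwall estimate is involved. -/
theorem unique {y y' z z' : ℝ → ℂ} (hαβ : α ≤ β) (hq : IntervalIntegrable q volume α β)
    (hy : IsSolutionOn q c α β y y') (hz : IsSolutionOn q c α β z z') (h0 : y α = z α)
    (h1 : y' α = z' α) {x : ℝ} (hx : x ∈ Set.Icc α β) : y x = z x ∧ y' x = z' x := by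
  obtain ⟨C, C', hC, hC0, hC1⟩ := exists_solution hαβ hq 1 0 c
  obtain ⟨S, S', hS, hS0, hS1⟩ := exists_solution hαβ hq 0 1 c
  have e1 := eq_fundamental hαβ hq hC hS hC0 hC1 hS0 hS1 hy hx
  have e2 := eq_fundamental hαβ hq hC hS hC0 hC1 hS0 hS1 hz hx
  rw [e1.1, e1.2, e2.1, e2.2, h0, h1]
  exact ⟨rfl, rfl⟩

/-- For all spectral parameters there are solutions with given initial values, and their end values
are entire functions of the parameter. -/
theorem exists_entire_family (hαβ : α ≤ β) (hq : IntervalIntegrable q volume α β) (y₀ y₁ : ℂ) :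
    ∃ Y Y' : ℂ → ℝ → ℂ,
      (∀ c, IsSolutionOn q c α β (Y c) (Y' c) ∧ Y c α = y₀ ∧ Y' c α = y₁) ∧
      Differentiable ℂ (fun c => Y c β) ∧ Differentiable ℂ (fun c => Y' c β) := by
  choose Y Y' h using exists_solution hαβ hq y₀ y₁
  have : ∀ c, DifferentiableAt ℂ (fun c => Y c β) c ∧ DifferentiableAt ℂ (fun c => Y' c β) c := by
    intro c
    -- Analyticity is local, and by uniqueness the pointwise chosen solutions agree on this disk
    -- with the analytic family.
    obtain ⟨Z, Z', hZ, d1, d2⟩ := exists_family_on_ball hαβ hq y₀ y₁ (‖c‖ + 1)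
    have hc : c ∈ Metric.ball (0 : ℂ) (‖c‖ + 1) := by simp
    have hn := Metric.isOpen_ball.mem_nhds hc
    have e : ∀ d ∈ Metric.ball (0 : ℂ) (‖c‖ + 1), Y d β = Z d β ∧ Y' d β = Z' d β := fun d hd =>
      unique hαβ hq (h d).1 (hZ d hd).1 ((h d).2.1.trans (hZ d hd).2.1.symm)
        ((h d).2.2.trans (hZ d hd).2.2.symm) (Set.right_mem_Icc.2 hαβ)
    exact ⟨(d1.differentiableAt hn).congr_of_eventuallyEq
        (by filter_upwards [hn] with d hd using (e _ hd).1),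
      (d2.differentiableAt hn).congr_of_eventuallyEq
        (by filter_upwards [hn] with d hd using (e _ hd).2)⟩
  exact ⟨Y, Y', h, fun c => (this c).1, fun c => (this c).2⟩

end IsSolutionOn

/-! ### End values of solutions for a large spectral parameter -/

section Asymp

open MeasureTheory

theorem norm_cos_le_exp_abs_im (z : ℂ) : ‖cos z‖ ≤ Real.exp |z.im| := by
  have h : ∀ w : ℂ, |w.re| ≤ |z.im| → ‖exp w‖ ≤ Real.exp |z.im| := fun w hw => by
    rw [Complex.norm_exp]; exact Real.exp_le_exp.2 ((le_abs_self _).trans hw)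
  rw [Complex.cos, norm_div]
  have h1 := h (z * I) (by simp)
  have h2 := h (-z * I) (by simp)
  have := norm_add_le (exp (z * I)) (exp (-z * I))
  simp only [Complex.norm_ofNat]
  linarith

theorem norm_sin_le_exp_abs_im (z : ℂ) : ‖sin z‖ ≤ Real.exp |z.im| := by
  have h : ∀ w : ℂ, |w.re| ≤ |z.im| → ‖exp w‖ ≤ Real.exp |z.im| := fun w hw => by
    rw [Complex.norm_exp]; exact Real.exp_le_exp.2 ((le_abs_self _).trans hw)
  rw [Complex.sin, norm_div, norm_mul, norm_I, mul_one]
  have h1 := h (z * I) (by simp)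
  have h2 := h (-z * I) (by simp)
  have := norm_sub_le (exp (-z * I)) (exp (z * I))
  simp only [Complex.norm_ofNat]
  linarith

variable {q : ℝ → ℂ} {α β : ℝ}

theorem abs_im_mul_real_sub {μ : ℂ} {x t : ℝ} (h : t ≤ x) :
    |(μ * ((x : ℂ) - t)).im| = |μ.im| * (x - t) := by
  rw [← ofReal_sub, im_mul_ofReal, abs_mul, abs_of_nonneg (sub_nonneg.2 h)]

/-- The growth of `y` over `[α, t]` and of the kernel over `[t, x]` multiply to the growth over `[α,
x]`, independently of `t`, so only the L¹ norm of `q` remains. -/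
theorem IsSolutionOn.norm_integral_le {μ : ℂ} {m x : ℝ} {y k : ℝ → ℂ}
    (hx : x ∈ Set.Icc α β) (hq : IntervalIntegrable q volume α β) (hm : 0 ≤ m)
    (hy : ∀ t ∈ Set.Icc α β, ‖y t‖ ≤ m * Real.exp (|μ.im| * (t - α)))
    (hk : ∀ t ∈ Set.Icc α x, ‖k t‖ ≤ Real.exp (|μ.im| * (x - t))) :
    ‖∫ t in α..x, q t * (y t * k t)‖ ≤
      m * Real.exp (|μ.im| * (x - α)) * ∫ t in α..β, ‖q t‖ := by
  have hαβ : α ≤ β := hx.1.trans hx.2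
  have hs : Set.uIcc α x ⊆ Set.uIcc α β :=
    Set.uIcc_subset_uIcc_left (by rwa [Set.uIcc_of_le hαβ])
  calc _ ≤ ∫ t in α..x, (m * Real.exp (|μ.im| * (x - α))) * ‖q t‖ := by
        refine intervalIntegral.norm_integral_le_of_norm_le hx.1
          (Eventually.of_forall fun t ht => ?_) ((hq.norm.mono_set hs).const_mul _)
        have h1 := hy t ⟨ht.1.le, ht.2.trans hx.2⟩
        have h2 := hk t ⟨ht.1.le, ht.2⟩
        have h3 : Real.exp (|μ.im| * (x - α)) =
            Real.exp (|μ.im| * (t - α)) * Real.exp (|μ.im| * (x - t)) := by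
          rw [← Real.exp_add]; ring_nf
        rw [norm_mul, norm_mul, h3, mul_comm, ← mul_assoc m]
        gcongr
    _ ≤ ∫ t in α..β, (m * Real.exp (|μ.im| * (x - α))) * ‖q t‖ :=
        intervalIntegral.integral_mono_interval le_rfl hx.1 hx.2
          (Eventually.of_forall fun t => by positivity) (hq.norm.const_mul _)
    _ = _ := by rw [intervalIntegral.integral_const_mul]

/-- The end values of a solution for a large spectral parameter. -/
theorem IsSolutionOn.norm_end_sub_le {μ : ℂ} {y y' : ℝ → ℂ} (hαβ : α ≤ β) (hμ : μ ≠ 0)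
    (hq : IntervalIntegrable q volume α β) (hy : IsSolutionOn q (μ ^ 2) α β y y')
    (hQ : 2 * ∫ t in α..β, ‖q t‖ ≤ ‖μ‖) :
    ‖y β - (y α * cos (μ * (β - α)) + y' α / μ * sin (μ * (β - α)))‖ ≤
      2 * (‖y α‖ + ‖y' α / μ‖) * Real.exp |(μ * (β - α)).im| * (∫ t in α..β, ‖q t‖) / ‖μ‖ ∧
    ‖y' β / μ - (-y α * sin (μ * (β - α)) + y' α / μ * cos (μ * (β - α)))‖ ≤
      2 * (‖y α‖ + ‖y' α / μ‖) * Real.exp |(μ * (β - α)).im| * (∫ t in α..β, ‖q t‖) / ‖μ‖ := by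
  set Q := ∫ t in α..β, ‖q t‖
  set c₀ := ‖y α‖ + ‖y' α / μ‖ with hc₀
  have hμ0 : 0 < ‖μ‖ := norm_pos_iff.2 hμ
  have ksin : ∀ x, ∀ t ∈ Set.Icc α x, ‖sin (μ * ((x : ℂ) - t))‖ ≤ Real.exp (|μ.im| * (x - t)) :=
    fun x t ht => by
      rw [← abs_im_mul_real_sub ht.2]; exact norm_sin_le_exp_abs_im _
  have kcos : ∀ x, ∀ t ∈ Set.Icc α x, ‖cos (μ * ((x : ℂ) - t))‖ ≤ Real.exp (|μ.im| * (x - t)) :=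
    fun x t ht => by
      rw [← abs_im_mul_real_sub ht.2]; exact norm_cos_le_exp_abs_im _
  -- For the maximum `m` of the weighted modulus, variation of constants at `x₀` gives m ≤ c₀ +
  -- mQ/|μ| ≤ c₀ + m/2, hence m ≤ 2c₀.
  obtain ⟨x₀, hx₀, hmax⟩ := isCompact_Icc.exists_isMaxOn (Set.nonempty_Icc.2 hαβ)
    (f := fun x => ‖y x‖ * Real.exp (-(|μ.im| * (x - α)))) (hy.cont.norm.mul (by fun_prop))
  set m := ‖y x₀‖ * Real.exp (-(|μ.im| * (x₀ - α))) with hm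
  have hm0 : 0 ≤ m := by positivity
  have hbd : ∀ t ∈ Set.Icc α β, ‖y t‖ ≤ m * Real.exp (|μ.im| * (t - α)) := by
    intro t ht
    have h1 : ‖y t‖ * Real.exp (-(|μ.im| * (t - α))) ≤ m := hmax ht
    rw [Real.exp_neg, ← div_eq_mul_inv, div_le_iff₀ (Real.exp_pos _)] at h1
    exact h1
  have hm2 : m ≤ 2 * c₀ := by
    have hv := (variation_of_constants hμ hαβ hq hy hx₀).1
    have hi := norm_integral_le (k := fun t => sin (μ * ((x₀ : ℂ) - t))) hx₀ hq hm0 hbd (ksin x₀)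
    have h1 : ‖y x₀‖ ≤ c₀ * Real.exp (|μ.im| * (x₀ - α)) +
        m * Real.exp (|μ.im| * (x₀ - α)) * Q / ‖μ‖ := by
      rw [hv]
      refine (norm_add_le _ _).trans (add_le_add ((norm_add_le _ _).trans ?_) ?_)
      · rw [norm_mul, norm_mul, hc₀, add_mul]
        have k1 := kcos x₀ α ⟨le_rfl, hx₀.1⟩
        have k2 := ksin x₀ α ⟨le_rfl, hx₀.1⟩
        gcongr
      · rw [norm_div]; gcongr
    have h2 : m ≤ c₀ + m * Q / ‖μ‖ := by
      have he : m * Real.exp (|μ.im| * (x₀ - α)) = ‖y x₀‖ := by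
        rw [hm, mul_assoc, ← Real.exp_add]; simp
      refine le_of_mul_le_mul_right ?_ (Real.exp_pos (|μ.im| * (x₀ - α)))
      calc _ = _ := he
        _ ≤ _ := h1
        _ = _ := by ring
    have h3 : m * Q / ‖μ‖ ≤ m / 2 := by
      rw [div_le_iff₀ hμ0]
      nlinarith
    linarith
  have hβ : β ∈ Set.Icc α β := Set.right_mem_Icc.2 hαβ
  have hv := variation_of_constants hμ hαβ hq hy hβ
  have hbd2 : ∀ t ∈ Set.Icc α β, ‖y t‖ ≤ 2 * c₀ * Real.exp (|μ.im| * (t - α)) := fun t ht =>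
    (hbd t ht).trans (by gcongr)
  have hc : 0 ≤ 2 * c₀ := by positivity
  rw [abs_im_mul_real_sub hαβ]
  constructor
  · rw [hv.1, add_sub_cancel_left, norm_div]
    gcongr
    exact norm_integral_le hβ hq hc hbd2 (ksin β)
  · have : y' β / μ - (-y α * sin (μ * (β - α)) + y' α / μ * cos (μ * (β - α))) =
        (∫ t in α..β, q t * (y t * cos (μ * (β - t)))) / μ := by
      rw [hv.2]; field_simp; ring
    rw [this, norm_div]
    gcongr
    exact norm_integral_le hβ hq hc hbd2 (kcos β)

/-- `y = u + O(E/ρ)` and `y' = ρ (v + O(E/ρ))` as `ρ → ∞`, with `u` and `v` of order `E`. -/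
structure HasAsymptotics (E : ℂ → ℝ) (y y' u v : ℂ → ℂ) : Prop where
  main : u =O[Bornology.cobounded ℂ] E
  main' : v =O[Bornology.cobounded ℂ] E
  rem : (fun ρ => y ρ - u ρ) =O[Bornology.cobounded ℂ] fun ρ => E ρ / ‖ρ‖
  rem' : (fun ρ => y' ρ / ρ - v ρ) =O[Bornology.cobounded ℂ] fun ρ => E ρ / ‖ρ‖

theorem isBigO_div_norm (E : ℂ → ℝ) :
    (fun ρ => E ρ / ‖ρ‖) =O[Bornology.cobounded ℂ] E := by
  refine IsBigO.of_bound 1 ?_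
  filter_upwards [eventually_cobounded_le_norm 1] with ρ hρ
  rw [norm_div, norm_norm, one_mul]
  exact div_le_self (norm_nonneg _) hρ

theorem eventually_cobounded_ne_zero : ∀ᶠ ρ : ℂ in Bornology.cobounded ℂ, ρ ≠ 0 := by
  filter_upwards [eventually_cobounded_le_norm 1] with ρ hρ
  exact norm_pos_iff.1 (by linarith)

namespace HasAsymptotics

variable {E : ℂ → ℝ} {y y' u v : ℂ → ℂ}

theorem isBigO (h : HasAsymptotics E y y' u v) : y =O[Bornology.cobounded ℂ] E := by
  have := (h.rem.trans (isBigO_div_norm E)).add h.main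
  simpa using this

theorem isBigO' (h : HasAsymptotics E y y' u v) :
    (fun ρ => y' ρ / ρ) =O[Bornology.cobounded ℂ] E := by
  have := (h.rem'.trans (isBigO_div_norm E)).add h.main'
  simpa using this

/-- Transport of asymptotics along an interval. -/
theorem transport {a : ℂ} {Y Y' : ℂ → ℝ → ℂ} (ha : a ≠ 0) (hαβ : α ≤ β)
    (hq : IntervalIntegrable q volume α β)
    (hY : ∀ ρ, IsSolutionOn q (ρ ^ 2 * a ^ 2) α β (Y ρ) (Y' ρ))
    (h : HasAsymptotics E (fun ρ => Y ρ α) (fun ρ => Y' ρ α) u v) :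
    HasAsymptotics (fun ρ => E ρ * Real.exp |(ρ * a * (β - α)).im|)
      (fun ρ => Y ρ β) (fun ρ => Y' ρ β)
      (fun ρ => u ρ * cos (ρ * a * (β - α)) + v ρ / a * sin (ρ * a * (β - α)))
      (fun ρ => -a * u ρ * sin (ρ * a * (β - α)) + v ρ * cos (ρ * a * (β - α))) := by
  have bc : (fun ρ : ℂ => cos (ρ * a * (β - α))) =O[Bornology.cobounded ℂ]
      fun ρ => Real.exp |(ρ * a * (β - α)).im| :=
    IsBigO.of_bound 1 (Eventually.of_forall fun ρ => by
      simpa using norm_cos_le_exp_abs_im (ρ * a * (β - α)))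
  have bs : (fun ρ : ℂ => sin (ρ * a * (β - α))) =O[Bornology.cobounded ℂ]
      fun ρ => Real.exp |(ρ * a * (β - α)).im| :=
    IsBigO.of_bound 1 (Eventually.of_forall fun ρ => by
      simpa using norm_sin_le_exp_abs_im (ρ * a * (β - α)))
  have va : (fun ρ => v ρ / a) =O[Bornology.cobounded ℂ] E := by
    simpa only [div_eq_inv_mul] using h.main'.const_mul_left a⁻¹
  have ev : ∀ᶠ ρ : ℂ in Bornology.cobounded ℂ, ρ ≠ 0 ∧ 2 * ∫ t in α..β, ‖q t‖ ≤ ‖ρ * a‖ := by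
    filter_upwards [eventually_cobounded_ne_zero,
      eventually_cobounded_le_norm ((2 * ∫ t in α..β, ‖q t‖) / ‖a‖)] with ρ h1 h2
    rw [div_le_iff₀ (norm_pos_iff.2 ha)] at h2
    exact ⟨h1, by rwa [norm_mul]⟩
  have bY : (fun ρ => 2 * (‖Y ρ α‖ + ‖Y' ρ α / (ρ * a)‖) * Real.exp |(ρ * a * (β - α)).im| *
      (∫ t in α..β, ‖q t‖) / ‖ρ * a‖) =O[Bornology.cobounded ℂ]
      fun ρ => E ρ * Real.exp |(ρ * a * (β - α)).im| / ‖ρ‖ := by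
    have h1 : (fun ρ => ‖Y ρ α‖ + ‖Y' ρ α / (ρ * a)‖) =O[Bornology.cobounded ℂ] E := by
      refine h.isBigO.norm_left.add ?_
      have := h.isBigO'.norm_left.const_mul_left ‖a‖⁻¹
      refine this.congr_left fun ρ => ?_
      rw [norm_div, norm_div, norm_mul]; ring
    have h2 := ((h1.mul (isBigO_refl (fun ρ : ℂ => Real.exp |(ρ * a * (β - α)).im|) _)).mul
      (isBigO_refl (fun ρ : ℂ => ‖ρ‖⁻¹) _)).const_mul_left
      (2 * (∫ t in α..β, ‖q t‖) * ‖a‖⁻¹)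
    refine (h2.congr_left fun ρ => ?_).congr_right fun ρ => ?_
    · rw [norm_mul]; ring
    · rw [div_eq_mul_inv]
  constructor
  · exact (h.main.mul bc).add (va.mul bs)
  · exact ((h.main.const_mul_left (-a)).mul bs).add (h.main'.mul bc)
  -- `r1` is the error made on this interval by dropping the potential; `r2` and `r3` propagate the
  -- error of the initial values.
  · have r1 : (fun ρ => Y ρ β - (Y ρ α * cos (ρ * a * (β - α)) +
        Y' ρ α / (ρ * a) * sin (ρ * a * (β - α)))) =O[Bornology.cobounded ℂ]
        fun ρ => E ρ * Real.exp |(ρ * a * (β - α)).im| / ‖ρ‖ := by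
      refine IsBigO.trans (IsBigO.of_bound 1 ?_) bY
      filter_upwards [ev] with ρ hρ
      have hs := hY ρ
      rw [← mul_pow] at hs
      rw [one_mul]
      exact (hs.norm_end_sub_le hαβ (mul_ne_zero hρ.1 ha) hq hρ.2).1.trans (le_abs_self _)
    have r2 := h.rem.mul bc
    have r3 := ((h.rem'.const_mul_left a⁻¹).mul bs)
    refine ((r1.add ((r2.add r3).congr_right fun ρ => ?_)).congr_left fun ρ => ?_)
    · ring
    · ring
  · have r1 : (fun ρ => Y' ρ β / (ρ * a) - (-Y ρ α * sin (ρ * a * (β - α)) +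
        Y' ρ α / (ρ * a) * cos (ρ * a * (β - α)))) =O[Bornology.cobounded ℂ]
        fun ρ => E ρ * Real.exp |(ρ * a * (β - α)).im| / ‖ρ‖ := by
      refine IsBigO.trans (IsBigO.of_bound 1 ?_) bY
      filter_upwards [ev] with ρ hρ
      have hs := hY ρ
      rw [← mul_pow] at hs
      rw [one_mul]
      exact (hs.norm_end_sub_le hαβ (mul_ne_zero hρ.1 ha) hq hρ.2).2.trans (le_abs_self _)
    have r2 := (h.rem.const_mul_left (-a)).mul bs
    have r3 := h.rem'.mul bc
    refine (((r1.const_mul_left a).add ((r2.add r3).congr_right fun ρ => ?_)).congr_left fun ρ => ?_)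
    · ring
    · field_simp; ring

end HasAsymptotics

end Asymp

/-! ### The problem with a jump: φ, S, Δ, Δ₀, M and their asymptotics -/

namespace IsSolutionOn

open MeasureTheory

theorem linearComb {q : ℝ → ℂ} {c : ℂ} {α β : ℝ} {y y' z z' : ℝ → ℂ} (hαβ : α ≤ β)
    (hq : IntervalIntegrable q volume α β)
    (hy : IsSolutionOn q c α β y y') (hz : IsSolutionOn q c α β z z') (s t : ℂ) :
    IsSolutionOn q c α β (fun x => s * y x + t * z x) (fun x => s * y' x + t * z' x) := by
  have hs : ∀ x ∈ Set.Icc α β, Set.uIcc α x ⊆ Set.uIcc α β := fun x hx =>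
    Set.uIcc_subset_uIcc_left (by rwa [Set.uIcc_of_le hαβ])
  have iy := integrable_coeff_mul (c := c) hαβ hq hy.cont
  have iz := integrable_coeff_mul (c := c) hαβ hq hz.cont
  have iy' : IntervalIntegrable y' volume α β :=
    ContinuousOn.intervalIntegrable (by rw [Set.uIcc_of_le hαβ]; exact hy.cont')
  have iz' : IntervalIntegrable z' volume α β :=
    ContinuousOn.intervalIntegrable (by rw [Set.uIcc_of_le hαβ]; exact hz.cont')
  refine ⟨(hy.cont.const_mul s).add (hz.cont.const_mul t),
    (hy.cont'.const_mul s).add (hz.cont'.const_mul t), fun x hx => ?_, fun x hx => ?_⟩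
  · rw [intervalIntegral.integral_add ((iy'.mono_set (hs x hx)).const_mul s)
      ((iz'.mono_set (hs x hx)).const_mul t), intervalIntegral.integral_const_mul,
      intervalIntegral.integral_const_mul, hy.eq x hx, hz.eq x hx]
    ring
  · have e : ∀ r, (q r - c) * (s * y r + t * z r) =
        s * ((q r - c) * y r) + t * ((q r - c) * z r) := fun r => by ring
    simp only [e]
    rw [intervalIntegral.integral_add ((iy.mono_set (hs x hx)).const_mul s)
      ((iz.mono_set (hs x hx)).const_mul t), intervalIntegral.integral_const_mul,
      intervalIntegral.integral_const_mul, hy.eq' x hx, hz.eq' x hx]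
    ring

end IsSolutionOn

/-- Linear combinations of functions with a jump. -/
def BrokenFunction.linearComb (s : ℂ) (y : BrokenFunction) (t : ℂ) (z : BrokenFunction) :
    BrokenFunction where
  left x := s * y.left x + t * z.left x
  left' x := s * y.left' x + t * z.left' x
  right x := s * y.right x + t * z.right x
  right' x := s * y.right' x + t * z.right' x

namespace ComplexWeightBVP

open MeasureTheory

variable (L : ComplexWeightBVP)

theorem b_le_T : L.b ≤ L.T := L.b_lt_T.le

theorem q_intervalIntegrable : IntervalIntegrable L.q volume 0 L.T := by
  rw [intervalIntegrable_iff_integrableOn_Ioo_of_le (L.b_pos.trans L.b_lt_T).le]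
  exact L.q_integrable

theorem q_intervalIntegrable_left : IntervalIntegrable L.q volume 0 L.b :=
  L.q_intervalIntegrable.mono_set (by
    rw [Set.uIcc_of_le L.b_pos.le, Set.uIcc_of_le (L.b_pos.trans L.b_lt_T).le]
    exact Set.Icc_subset_Icc_right L.b_le_T)

theorem q_intervalIntegrable_right : IntervalIntegrable L.q volume L.b L.T :=
  L.q_intervalIntegrable.mono_set (by
    rw [Set.uIcc_of_le L.b_le_T, Set.uIcc_of_le (L.b_pos.trans L.b_lt_T).le]
    exact Set.Icc_subset_Icc_left L.b_pos.le)

variable {L}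

theorem IsSolution.linearComb {lam : ℂ} {y z : BrokenFunction} (hy : L.IsSolution lam y)
    (hz : L.IsSolution lam z) (s t : ℂ) : L.IsSolution lam (BrokenFunction.linearComb s y t z) where
  left := hy.left.linearComb L.b_pos.le L.q_intervalIntegrable_left hz.left s t
  right := hy.right.linearComb L.b_le_T L.q_intervalIntegrable_right hz.right s t
  jump := by
    simp only [BrokenFunction.linearComb, hy.jump, hz.jump]; ring
  jump' := by
    simp only [BrokenFunction.linearComb, hy.jump', hz.jump']; ring

theorem IsSolution.unique {lam : ℂ} {y z : BrokenFunction} (hy : L.IsSolution lam y)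
    (hz : L.IsSolution lam z) (h0 : y.left 0 = z.left 0) (h1 : y.left' 0 = z.left' 0) :
    (∀ x ∈ Set.Icc 0 L.b, y.left x = z.left x) ∧
      ∀ x ∈ Set.Icc L.b L.T, y.right x = z.right x ∧ y.right' x = z.right' x := by
  have hl : ∀ x ∈ Set.Icc 0 L.b, y.left x = z.left x ∧ y.left' x = z.left' x := fun x hx =>
    hy.left.unique L.b_pos.le L.q_intervalIntegrable_left hz.left h0 h1 hx
  have hb := hl L.b (Set.right_mem_Icc.2 L.b_pos.le)
  refine ⟨fun x hx => (hl x hx).1, fun x hx =>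
    hy.right.unique L.b_le_T L.q_intervalIntegrable_right hz.right ?_ ?_ hx⟩
  · rw [hy.jump, hz.jump, hb.1]
  · rw [hy.jump', hz.jump', hb.1, hb.2]

/-- The Wronskian does not depend on the point and is not affected by the jump conditions. -/
theorem IsSolution.wronskian {lam : ℂ} {y z : BrokenFunction} (hy : L.IsSolution lam y)
    (hz : L.IsSolution lam z) :
    y.right L.T * z.right' L.T - y.right' L.T * z.right L.T =
      y.left 0 * z.left' 0 - y.left' 0 * z.left 0 := by
  rw [hy.right.wronskian L.b_le_T L.q_intervalIntegrable_right hz.right,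
    ← hy.left.wronskian L.b_pos.le L.q_intervalIntegrable_left hz.left,
    hy.jump, hy.jump', hz.jump, hz.jump']
  have := L.d₁_ne
  field_simp
  ring

variable (L)

theorem exists_entire_family (y₀ y₁ : ℂ) : ∃ Y : ℂ → BrokenFunction,
    (∀ lam, L.IsSolution lam (Y lam) ∧ (Y lam).left 0 = y₀ ∧ (Y lam).left' 0 = y₁) ∧
    Differentiable ℂ (fun lam => (Y lam).right L.T) ∧
    Differentiable ℂ (fun lam => (Y lam).right' L.T) := by
  obtain ⟨Z, Z', hZ, d1, d2⟩ :=
    IsSolutionOn.exists_entire_family L.b_pos.le L.q_intervalIntegrable_left y₀ y₁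
  obtain ⟨C, C', hC, dC, dC'⟩ :=
    IsSolutionOn.exists_entire_family L.b_le_T L.q_intervalIntegrable_right 1 0
  obtain ⟨S, S', hS, dS, dS'⟩ :=
    IsSolutionOn.exists_entire_family L.b_le_T L.q_intervalIntegrable_right 0 1
  have m1 : Differentiable ℂ (fun lam : ℂ => lam * L.a₁ ^ 2) := by fun_prop
  have m2 : Differentiable ℂ (fun lam : ℂ => lam * L.a₂ ^ 2) := by fun_prop
  have e1 : Differentiable ℂ (fun lam : ℂ => Z (lam * L.a₁ ^ 2) L.b) := d1.comp m1
  have e2 : Differentiable ℂ (fun lam : ℂ => Z' (lam * L.a₁ ^ 2) L.b) := d2.comp m1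
  have e3 : Differentiable ℂ (fun lam : ℂ => C (lam * L.a₂ ^ 2) L.T) := dC.comp m2
  have e4 : Differentiable ℂ (fun lam : ℂ => C' (lam * L.a₂ ^ 2) L.T) := dC'.comp m2
  have e5 : Differentiable ℂ (fun lam : ℂ => S (lam * L.a₂ ^ 2) L.T) := dS.comp m2
  have e6 : Differentiable ℂ (fun lam : ℂ => S' (lam * L.a₂ ^ 2) L.T) := dS'.comp m2
  refine ⟨fun lam => ⟨Z (lam * L.a₁ ^ 2), Z' (lam * L.a₁ ^ 2),
    fun x => (L.d₁ * Z (lam * L.a₁ ^ 2) L.b) * C (lam * L.a₂ ^ 2) x +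
      (Z' (lam * L.a₁ ^ 2) L.b / L.d₁ + L.d₂ * Z (lam * L.a₁ ^ 2) L.b) * S (lam * L.a₂ ^ 2) x,
    fun x => (L.d₁ * Z (lam * L.a₁ ^ 2) L.b) * C' (lam * L.a₂ ^ 2) x +
      (Z' (lam * L.a₁ ^ 2) L.b / L.d₁ + L.d₂ * Z (lam * L.a₁ ^ 2) L.b) * S' (lam * L.a₂ ^ 2) x⟩,
    fun lam => ⟨⟨(hZ _).1, ?_, ?_, ?_⟩, (hZ _).2.1, (hZ _).2.2⟩, ?_, ?_⟩
  · exact (hC _).1.linearComb L.b_le_T L.q_intervalIntegrable_right (hS _).1 _ _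
  · simp [(hC _).2.1, (hS _).2.1]
  · simp [(hC _).2.2, (hS _).2.2]
  · exact ((e1.const_mul _).mul e3).add (((e2.div_const _).add (e1.const_mul _)).mul e5)
  · exact ((e1.const_mul _).mul e4).add (((e2.div_const _).add (e1.const_mul _)).mul e6)

/-- The fundamental family `φ`, with `φ(0) = 1`, `φ'(0) = h`. -/
noncomputable def phi : ℂ → BrokenFunction := (L.exists_entire_family 1 L.h).choose

/-- The fundamental family `S`, with `S(0) = 0`, `S'(0) = 1`. -/
noncomputable def sine : ℂ → BrokenFunction := (L.exists_entire_family 0 1).choose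

theorem phi_spec (lam : ℂ) : L.IsSolution lam (L.phi lam) ∧ (L.phi lam).left 0 = 1 ∧
    (L.phi lam).left' 0 = L.h := (L.exists_entire_family 1 L.h).choose_spec.1 lam

theorem sine_spec (lam : ℂ) : L.IsSolution lam (L.sine lam) ∧ (L.sine lam).left 0 = 0 ∧
    (L.sine lam).left' 0 = 1 := (L.exists_entire_family 0 1).choose_spec.1 lam

/-- `φ(T, lam)`. -/
noncomputable def phiT (lam : ℂ) : ℂ := (L.phi lam).right L.T

/-- `V(S)` as a function of `lam`. -/
noncomputable def Δ₀ (lam : ℂ) : ℂ := L.V (L.sine lam)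

theorem differentiable_Δ₀ : Differentiable ℂ L.Δ₀ :=
  (L.exists_entire_family 0 1).choose_spec.2.2.add
    ((L.exists_entire_family 0 1).choose_spec.2.1.const_mul L.H)

/-- By uniqueness `y` is y(0)φ + U(y)S, and `V` is linear. -/
theorem V_eq_of_isSolution {lam : ℂ} {y : BrokenFunction} (hy : L.IsSolution lam y) :
    L.V y = y.left 0 * L.V (L.phi lam) + L.U y * L.Δ₀ lam := by
  have hT := ((hy.unique ((L.phi_spec lam).1.linearComb (L.sine_spec lam).1 (y.left 0) (L.U y))
    (by simp [BrokenFunction.linearComb, L.phi_spec, L.sine_spec])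
    (by simp [BrokenFunction.linearComb, L.phi_spec, L.sine_spec, U]; ring)).2 L.T
    (Set.right_mem_Icc.2 L.b_le_T))
  simp only [V, Δ₀, hT.1, hT.2, BrokenFunction.linearComb]
  ring

theorem Δ_eq (lam : ℂ) : L.Δ lam = -L.V (L.phi lam) := by
  have hp := L.phi_spec lam
  obtain ⟨φ, h1, h2, h3, h4⟩ : ∃ φ : BrokenFunction, L.IsSolution lam φ ∧
      φ.left 0 = 1 ∧ φ.left' 0 = L.h ∧ L.Δ lam = -L.V φ :=
    Classical.epsilon_spec (p := fun d : ℂ => ∃ φ : BrokenFunction, L.IsSolution lam φ ∧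
      φ.left 0 = 1 ∧ φ.left' 0 = L.h ∧ d = -L.V φ) ⟨_, L.phi lam, hp.1, hp.2.1, hp.2.2, rfl⟩
  rw [h4, L.V_eq_of_isSolution h1, h2]
  simp [U, h2, h3]

theorem differentiable_Δ : Differentiable ℂ L.Δ := by
  have : L.Δ = fun lam => -L.V (L.phi lam) := funext L.Δ_eq
  rw [this]
  exact ((L.exists_entire_family 1 L.h).choose_spec.2.2.add
    ((L.exists_entire_family 1 L.h).choose_spec.2.1.const_mul L.H)).neg

theorem isEigenvalue_iff (lam : ℂ) : L.IsEigenvalue lam ↔ L.Δ lam = 0 := by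
  have hp := L.phi_spec lam
  constructor
  · rintro ⟨y, hy, hU, hV, hne⟩
    have h0 : y.left 0 ≠ 0 := by
      intro h0
      have h1 : y.left' 0 = 0 := by simpa [U, h0] using hU
      have hz := hp.1.linearComb hp.1 0 0
      have hu := hy.unique hz (by simp [BrokenFunction.linearComb, h0])
        (by simp [BrokenFunction.linearComb, h1])
      rcases hne with ⟨x, hx, hne⟩ | ⟨x, hx, hne⟩
      · exact hne (by simp [hu.1 x hx, BrokenFunction.linearComb])
      · exact hne (by simp [(hu.2 x hx).1, BrokenFunction.linearComb])
    have := L.V_eq_of_isSolution hy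
    rw [hU, hV, zero_mul, add_zero] at this
    rw [Δ_eq, (mul_eq_zero.1 this.symm).resolve_left h0, neg_zero]
  · intro h
    rw [Δ_eq, neg_eq_zero] at h
    exact ⟨L.phi lam, hp.1, by simp [U, hp.2.1, hp.2.2], h,
      Or.inl ⟨0, Set.left_mem_Icc.2 L.b_pos.le, by simp [hp.2.1]⟩⟩

/-- The Wronskian of φ and S is 1 at 0 and is preserved by the jump; at `T`, V(φ) = 0 makes it
factor. This controls Δ₀ on the second family, where its main term cancels. -/
theorem Δ₀_mul_phiT {lam : ℂ} (h : L.Δ lam = 0) : L.Δ₀ lam * L.phiT lam = 1 := by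
  have hp := L.phi_spec lam
  have hs := L.sine_spec lam
  have hw := hp.1.wronskian hs.1
  rw [hp.2.1, hp.2.2, hs.2.1, hs.2.2] at hw
  rw [Δ_eq, neg_eq_zero] at h
  simp only [V] at h
  simp only [Δ₀, phiT, V]
  linear_combination hw + (L.sine lam).right L.T * h

/-- The Weyl solution is (Δ₀/Δ)φ + S, and the normalizations U = 1, V = 0 force its value at 0. -/
theorem M_eq {lam : ℂ} (h : L.Δ lam ≠ 0) : L.M lam = L.Δ₀ lam / L.Δ lam := by
  have hp := L.phi_spec lam
  have hs := L.sine_spec lam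
  obtain ⟨Φ, h1, h2, h3, h4⟩ : ∃ Φ : BrokenFunction, L.IsSolution lam Φ ∧
      L.U Φ = 1 ∧ L.V Φ = 0 ∧ L.M lam = Φ.left 0 := by
    refine Classical.epsilon_spec (p := fun m : ℂ => ∃ Φ : BrokenFunction, L.IsSolution lam Φ ∧
      L.U Φ = 1 ∧ L.V Φ = 0 ∧ m = Φ.left 0)
      ⟨_, BrokenFunction.linearComb (L.Δ₀ lam / L.Δ lam) (L.phi lam) 1 (L.sine lam),
        hp.1.linearComb hs.1 _ _, ?_, ?_, rfl⟩
    · simp [U, BrokenFunction.linearComb, hp, hs]; ring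
    · rw [L.V_eq_of_isSolution (hp.1.linearComb hs.1 _ _), ← neg_eq_iff_eq_neg.2 (L.Δ_eq lam)]
      simp [U, BrokenFunction.linearComb, hp, hs]
      field_simp
      ring
  have := L.V_eq_of_isSolution h1
  rw [h2, h3, ← neg_eq_iff_eq_neg.2 (L.Δ_eq lam)] at this
  rw [h4, eq_div_iff h]
  linear_combination this

/-- The exponential bound `exp (|Im ρa₁l₁| + |Im ρa₂l₂|)`. -/
noncomputable def growth (ρ : ℂ) : ℝ :=
  Real.exp |(ρ * L.a₁ * L.l₁).im| * Real.exp |(ρ * L.a₂ * L.l₂).im|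

theorem growth_pos (ρ : ℂ) : 0 < L.growth ρ := by unfold growth; positivity

/-- End values at `T` of a family of solutions with given asymptotics at `0`. -/
theorem hasAsymptotics_end {E : ℂ → ℝ} {u v : ℂ → ℂ} {Y : ℂ → BrokenFunction}
    (hY : ∀ lam, L.IsSolution lam (Y lam))
    (h : HasAsymptotics E (fun ρ => (Y (ρ ^ 2)).left 0) (fun ρ => (Y (ρ ^ 2)).left' 0) u v) :
    HasAsymptotics (fun ρ => E ρ * L.growth ρ) (fun ρ => (Y (ρ ^ 2)).right L.T)
      (fun ρ => (Y (ρ ^ 2)).right' L.T)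
      (fun ρ => L.d₁ * (u ρ * cos (ρ * L.a₁ * L.l₁) + v ρ / L.a₁ * sin (ρ * L.a₁ * L.l₁)) *
          cos (ρ * L.a₂ * L.l₂) +
        (-L.a₁ * u ρ * sin (ρ * L.a₁ * L.l₁) + v ρ * cos (ρ * L.a₁ * L.l₁)) / L.d₁ / L.a₂ *
          sin (ρ * L.a₂ * L.l₂))
      (fun ρ => -L.a₂ * (L.d₁ * (u ρ * cos (ρ * L.a₁ * L.l₁) +
          v ρ / L.a₁ * sin (ρ * L.a₁ * L.l₁))) * sin (ρ * L.a₂ * L.l₂) +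
        (-L.a₁ * u ρ * sin (ρ * L.a₁ * L.l₁) + v ρ * cos (ρ * L.a₁ * L.l₁)) / L.d₁ *
          cos (ρ * L.a₂ * L.l₂)) := by
  have h1 := h.transport L.a₁_ne L.b_pos.le L.q_intervalIntegrable_left
    (fun ρ => (hY (ρ ^ 2)).left)
  simp only [ofReal_zero, sub_zero] at h1
  have hl₁ : (L.b : ℂ) = L.l₁ := rfl
  have hl₂ : (L.T : ℂ) - L.b = L.l₂ := by simp [l₂]
  rw [hl₁] at h1
  have h2 : HasAsymptotics (fun ρ => E ρ * Real.exp |(ρ * L.a₁ * L.l₁).im|)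
      (fun ρ => (Y (ρ ^ 2)).right L.b) (fun ρ => (Y (ρ ^ 2)).right' L.b)
      (fun ρ => L.d₁ * (u ρ * cos (ρ * L.a₁ * L.l₁) + v ρ / L.a₁ * sin (ρ * L.a₁ * L.l₁)))
      (fun ρ => (-L.a₁ * u ρ * sin (ρ * L.a₁ * L.l₁) + v ρ * cos (ρ * L.a₁ * L.l₁)) / L.d₁) := by
    refine ⟨h1.main.const_mul_left L.d₁, ?_, ?_, ?_⟩
    · simpa only [div_eq_inv_mul] using h1.main'.const_mul_left L.d₁⁻¹
    · refine (h1.rem.const_mul_left L.d₁).congr_left fun ρ => ?_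
      simp only [(hY (ρ ^ 2)).jump]; ring
    · have r1 := h1.rem'.const_mul_left L.d₁⁻¹
      -- The `d₂` term is of the order of `y` itself, thus lower order after division by ρ: it
      -- enters only the remainder.
      have r2 := (h1.isBigO.mul (isBigO_refl (fun ρ : ℂ => ρ⁻¹) (Bornology.cobounded ℂ)).norm_right).const_mul_left L.d₂
      refine ((r1.add (r2.congr_right fun ρ => ?_)).congr_left fun ρ => ?_)
      · rw [norm_inv, div_eq_mul_inv]
      · simp only [(hY (ρ ^ 2)).jump']; ring
  have h3 := h2.transport L.a₂_ne L.b_le_T L.q_intervalIntegrable_right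
    (fun ρ => (hY (ρ ^ 2)).right)
  rw [hl₂] at h3
  have hE : (fun ρ => E ρ * L.growth ρ) = fun ρ => E ρ * Real.exp |(ρ * L.a₁ * L.l₁).im| *
      Real.exp |(ρ * L.a₂ * L.l₂).im| := by
    ext ρ; simp only [growth]; ring
  rw [hE]
  exact h3

theorem phi_asymptotics : HasAsymptotics (fun _ => 1) (fun ρ => (L.phi (ρ ^ 2)).left 0)
    (fun ρ => (L.phi (ρ ^ 2)).left' 0) (fun _ => 1) (fun _ => 0) where
  main := (isBigO_refl _ _).norm_right.congr_right fun _ => by simp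
  main' := isBigO_zero _ _
  rem := by simp only [L.phi_spec, sub_self]; exact isBigO_zero _ _
  rem' := by
    simp only [L.phi_spec, sub_zero]
    refine ((isBigO_refl (fun ρ : ℂ => ρ⁻¹) (Bornology.cobounded ℂ)).norm_right.const_mul_left
      L.h).congr (fun ρ => ?_) fun ρ => ?_
    · rw [div_eq_mul_inv]
    · rw [norm_inv, one_div]

theorem sine_asymptotics : HasAsymptotics (fun ρ => ‖ρ‖⁻¹) (fun ρ => (L.sine (ρ ^ 2)).left 0)
    (fun ρ => (L.sine (ρ ^ 2)).left' 0) (fun _ => 0) (fun ρ => ρ⁻¹) where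
  main := isBigO_zero _ _
  main' := (isBigO_refl _ _).norm_right.congr_right fun _ => by simp
  rem := by simp only [L.sine_spec, sub_self]; exact isBigO_zero _ _
  rem' := by
    have : ∀ ρ : ℂ, (L.sine (ρ ^ 2)).left' 0 / ρ - ρ⁻¹ = 0 := fun ρ => by
      rw [(L.sine_spec _).2.2]; simp
    simp only [this]
    exact isBigO_zero _ _

theorem phiT_asymptotics : (fun ρ => L.phiT (ρ ^ 2) - (2 * L.a₂)⁻¹ *
      (L.ωp * cos (ρ * L.a₁ * L.l₁ + ρ * L.a₂ * L.l₂) +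
        L.ωm * cos (ρ * L.a₁ * L.l₁ - ρ * L.a₂ * L.l₂)))
    =O[Bornology.cobounded ℂ] fun ρ => L.growth ρ / ‖ρ‖ := by
  have h := (L.hasAsymptotics_end (fun lam => (L.phi_spec lam).1) L.phi_asymptotics).rem
  refine h.congr (fun ρ => ?_) fun ρ => by rw [one_mul]
  simp only [phiT, cos_add, cos_sub, ωp, ωm]
  have := L.a₂_ne
  have := L.d₁_ne
  field_simp
  ring

theorem Δ_asymptotics : (fun ρ => L.Δ (ρ ^ 2) - ρ / 2 *
      (L.ωp * sin (ρ * L.a₁ * L.l₁ + ρ * L.a₂ * L.l₂) +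
        L.ωm * sin (ρ * L.a₂ * L.l₂ - ρ * L.a₁ * L.l₁)))
    =O[Bornology.cobounded ℂ] fun ρ => L.growth ρ := by
  have h := (L.hasAsymptotics_end (fun lam => (L.phi_spec lam).1) L.phi_asymptotics)
  have h1 := (isBigO_refl (fun ρ : ℂ => ρ) (Bornology.cobounded ℂ)).norm_right.mul h.rem'
  -- Division by zero gives 0, so the product of ‖ρ‖ and growth/‖ρ‖ is the growth only away from the
  -- origin.
  have h2 := (h1.congr_right (g₂ := fun ρ => if ρ = 0 then 0 else L.growth ρ) fun ρ => by
    split_ifs with h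
    · simp [h]
    · have := norm_ne_zero_iff.2 h
      field_simp).trans (IsBigO.of_bound 1 (Eventually.of_forall fun ρ => by
        split_ifs <;> simp) : _ =O[Bornology.cobounded ℂ] L.growth)
  have h3 := (h.isBigO.const_mul_left L.H).congr_right (fun ρ => one_mul (L.growth ρ))
  refine ((h2.add h3).neg_left.congr' ?_ EventuallyEq.rfl)
  filter_upwards [eventually_cobounded_ne_zero] with ρ hρ
  simp only [Δ_eq, V, sin_add, sin_sub, ωp, ωm]
  have := L.d₁_ne
  field_simp
  ring

theorem Δ₀_asymptotics : (fun ρ => L.Δ₀ (ρ ^ 2) - (2 * L.a₁)⁻¹ *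
      (L.ωp * cos (ρ * L.a₁ * L.l₁ + ρ * L.a₂ * L.l₂) -
        L.ωm * cos (ρ * L.a₁ * L.l₁ - ρ * L.a₂ * L.l₂)))
    =O[Bornology.cobounded ℂ] fun ρ => L.growth ρ / ‖ρ‖ := by
  have h := (L.hasAsymptotics_end (fun lam => (L.sine_spec lam).1) L.sine_asymptotics)
  have h1 := (isBigO_refl (fun ρ : ℂ => ρ) (Bornology.cobounded ℂ)).norm_right.mul h.rem'
  have h2 := h1.trans (IsBigO.of_bound 1 (Eventually.of_forall fun ρ => by
    rcases eq_or_ne ρ 0 with rfl | hρ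
    · simp
    · have := norm_pos_iff.2 hρ
      have := L.growth_pos ρ
      rw [one_mul]
      apply le_of_eq
      congr 1
      field_simp) : _ =O[Bornology.cobounded ℂ] fun ρ => L.growth ρ / ‖ρ‖)
  have h3 := (h.isBigO.const_mul_left L.H).congr_right
    (g₂ := fun ρ => L.growth ρ / ‖ρ‖) (fun ρ => by rw [div_eq_inv_mul])
  refine ((h2.add h3).congr' ?_ EventuallyEq.rfl)
  filter_upwards [eventually_cobounded_ne_zero] with ρ hρ
  simp only [Δ₀, V, cos_add, cos_sub, ωp, ωm]
  have := L.d₁_ne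
  have := L.a₁_ne
  field_simp
  ring

end ComplexWeightBVP

/-! ### Zeros of small perturbations of exp − 1 -/

section NearExp

/-- Zeros of a function close to `exp ζ - 1` near the origin. -/
theorem zero_of_near_exp_sub_one {H : ℂ → ℂ} {ε : ℝ} (hε : ε ≤ 1 / 16)
    (hd : ∀ ζ, ‖ζ‖ ≤ 1 → DifferentiableAt ℂ H ζ)
    (h : ∀ ζ, ‖ζ‖ ≤ 1 → ‖H ζ - (exp ζ - 1)‖ ≤ ε) :
    (∃ ζ, ‖ζ‖ ≤ 2 * ε ∧ H ζ = 0) ∧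
    (∀ ζ ζ', ‖ζ‖ ≤ 1 / 8 → ‖ζ'‖ ≤ 1 / 8 → H ζ = 0 → H ζ' = 0 → ζ = ζ') ∧
    ∀ ζ, ‖ζ‖ ≤ 1 / 8 → ‖deriv H ζ - exp ζ‖ ≤ 2 * ε := by
  have hder : ∀ ζ, ‖ζ‖ ≤ 1 / 8 → ‖deriv H ζ - exp ζ‖ ≤ 2 * ε := by
    intro ζ hζ
    have hin : ∀ w, w ∈ Metric.closedBall ζ (1 / 2) → ‖w‖ ≤ 1 := fun w hw => by
      rw [mem_closedBall_iff_norm] at hw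
      have := norm_le_norm_sub_add w ζ
      linarith
    have hdd : ∀ w, ‖w‖ ≤ 1 → DifferentiableAt ℂ (fun w => H w - (exp w - 1)) w := fun w hw =>
      (hd w hw).sub (by fun_prop)
    -- Cauchy's estimate on a circle of radius 1/2, which stays in the unit disk, doubles the error.
    have h1 := Complex.norm_deriv_le_of_forall_mem_sphere_norm_le (c := ζ) (R := 1 / 2) (C := ε)
      (f := fun w => H w - (exp w - 1)) (by norm_num)
      (DifferentiableOn.diffContOnCl (fun w hw => by
        rw [closure_ball _ (by norm_num)] at hw
        exact (hdd w (hin w hw)).differentiableWithinAt))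
      (fun w hw => h w (hin w (Metric.sphere_subset_closedBall hw)))
    have h2 : deriv (fun w => H w - (exp w - 1)) ζ = deriv H ζ - exp ζ := by
      have e1 := (hd ζ (by linarith)).hasDerivAt
      have e2 := (Complex.hasDerivAt_exp ζ).sub_const 1
      exact (e1.sub e2).deriv
    rw [h2] at h1
    linarith
  -- Zeros of `H` are fixed points of ζ − H(ζ), whose derivative is at most 2·(1/8) + 2·(1/16) <
  -- 1/2: this gives existence and uniqueness at once.
  have hcon : ∀ ζ ζ', ‖ζ‖ ≤ 1 / 8 → ‖ζ'‖ ≤ 1 / 8 →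
      ‖(ζ - H ζ) - (ζ' - H ζ')‖ ≤ 1 / 2 * ‖ζ - ζ'‖ := by
    intro ζ ζ' hζ hζ'
    refine Convex.norm_image_sub_le_of_norm_deriv_le (𝕜 := ℂ) (f := fun w => w - H w)
      (s := Metric.closedBall (0 : ℂ) (1 / 8)) (fun w hw => ?_) (fun w hw => ?_)
      (convex_closedBall _ _) (by simpa using hζ') (by simpa using hζ)
    · rw [mem_closedBall_zero_iff] at hw
      exact differentiableAt_id.sub (hd w (by linarith))
    · rw [mem_closedBall_zero_iff] at hw
      have e1 := (hasDerivAt_id w).sub (hd w (by linarith)).hasDerivAt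
      have e2 : deriv (fun w => w - H w) w = 1 - deriv H w := e1.deriv
      have e3 := hder w hw
      have e4 := Complex.norm_exp_sub_one_le (x := w) (by linarith)
      calc ‖deriv (fun w => w - H w) w‖ = ‖(exp w - 1) + (deriv H w - exp w)‖ := by
            rw [e2, ← norm_neg]; congr 1; ring
        _ ≤ 2 * ‖w‖ + 2 * ε := (norm_add_le _ _).trans (add_le_add e4 e3)
        _ ≤ 1 / 2 := by linarith
  have h0 : ‖H 0‖ ≤ ε := by simpa using h 0 (by simp)
  refine ⟨?_, fun ζ ζ' hζ hζ' e e' => ?_, hder⟩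
  · have hmaps : Set.MapsTo (fun w => w - H w) (Metric.closedBall (0 : ℂ) (1 / 8))
        (Metric.closedBall (0 : ℂ) (1 / 8)) := by
      intro w hw
      rw [mem_closedBall_zero_iff] at hw ⊢
      have h1 := hcon w 0 hw (by simp)
      simp only [sub_zero, zero_sub, sub_neg_eq_add] at h1
      have h2 := norm_sub_le (w - H w + H 0) (H 0)
      rw [add_sub_cancel_right] at h2
      linarith
    have hK : ContractingWith (1 / 2) (hmaps.restrict (fun w => w - H w) _ _) := by
      refine ⟨by rw [← NNReal.coe_lt_coe]; norm_num, LipschitzWith.of_dist_le_mul fun x y => ?_⟩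
      have := hcon x y (by simpa using x.2) (by simpa using y.2)
      rw [Subtype.dist_eq, Subtype.dist_eq, dist_eq_norm, dist_eq_norm]
      simpa using this
    obtain ⟨ζ, hζ, hfix, -⟩ := hK.exists_fixedPoint' (Metric.isClosed_closedBall.isComplete) hmaps
      (x := 0) (by simp) (edist_ne_top _ _)
    have hz : H ζ = 0 := by simpa [Function.IsFixedPt] using hfix
    refine ⟨ζ, ?_, hz⟩
    rw [mem_closedBall_zero_iff] at hζ
    have h1 := hcon ζ 0 hζ (by simp)
    simp only [sub_zero, zero_sub, sub_neg_eq_add, hz] at h1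
    have h2 := norm_sub_le (ζ + H 0) (H 0)
    rw [add_sub_cancel_right] at h2
    linarith
  · have := hcon ζ ζ' hζ hζ'
    rw [e, e', sub_zero, sub_zero] at this
    have h1 := norm_nonneg (ζ - ζ')
    exact sub_eq_zero.1 (norm_eq_zero.1 (by linarith))

theorem exists_int_of_exp_near_one {w : ℂ} {s : ℝ} (hs : s ≤ 1 / 2) (h : ‖exp w - 1‖ ≤ s) :
    ∃ n : ℤ, ‖w - n * (2 * Real.pi * I)‖ ≤ 2 * s := by
  obtain ⟨n, hn⟩ := Complex.log_exp_exists w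
  have h1 := Complex.norm_log_one_add_half_le_self (h.trans hs)
  rw [add_sub_cancel, hn] at h1
  refine ⟨-n, ?_⟩
  push_cast
  rw [neg_mul, sub_neg_eq_add]
  have := norm_nonneg (exp w - 1)
  linarith

theorem eventually_cobounded_iff {p : ℂ → Prop} :
    (∀ᶠ ρ in Bornology.cobounded ℂ, p ρ) ↔ ∃ R : ℝ, ∀ ρ, R ≤ ‖ρ‖ → p ρ := by
  rw [hasBasis_cobounded_norm.eventually_iff]
  simp

end NearExp

/-! ### Zeros of strip-like functions -/

/-- A function which in horizontal strips, in one direction, is close to `κ e^{2igρ} - ω`. -/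
structure IsStripLike (G : ℂ → ℂ) (g g' κ ω ℓ : ℂ) (σ : ℤ) : Prop where
  g_ne : g ≠ 0
  ω_ne : ω ≠ 0
  exp_ℓ : κ * exp ℓ = ω
  σ_sq : σ * σ = 1
  dir : 0 < σ * (g' / g).im
  diff : ∀ ρ, ρ ≠ 0 → DifferentiableAt ℂ G ρ
  approx : ∀ M : ℝ, ∃ C : ℝ, ∀ᶠ ρ in Bornology.cobounded ℂ, |(ρ * g).im| ≤ M → 0 ≤ (ρ * g').im →
    ‖G ρ - (κ * exp (2 * I * (ρ * g)) - ω)‖ ≤ C / ‖ρ‖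

/-- The zeros of `κ e^{2igρ} - ω`. -/
noncomputable def modelRoot (g ℓ : ℂ) (σ : ℤ) (k : ℤ) : ℂ := (σ * k * Real.pi + ℓ / (2 * I)) / g

namespace IsStripLike

variable {G : ℂ → ℂ} {g g' κ ω ℓ : ℂ} {σ : ℤ}

/-- The coordinate ζ is scaled so that the exponent becomes ℓ + ζ plus an integer multiple of 2πi.
-/
theorem mul_exp (h : IsStripLike G g g' κ ω ℓ σ) (k : ℤ) (ζ : ℂ) :
    κ * exp (2 * I * ((modelRoot g ℓ σ k + ζ / (2 * I * g)) * g)) = ω * exp ζ := by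
  have hg := h.g_ne
  have : 2 * I * ((modelRoot g ℓ σ k + ζ / (2 * I * g)) * g) =
      ℓ + ζ + ((σ * k : ℤ) : ℂ) * (2 * Real.pi * I) := by
    rw [modelRoot]
    have := I_ne_zero
    push_cast
    field_simp
    ring
  rw [this, Complex.exp_add, Complex.exp_int_mul_two_pi_mul_I, mul_one, Complex.exp_add,
    ← mul_assoc, h.exp_ℓ]

/-- Here ρg = σkπ + O(1), so ρ stays in a fixed strip, while `dir` makes Im(ρg') grow linearly in
`k` and exceed any `c₀`. Thus `approx` applies, with error O(1/k). -/
theorem near (h : IsStripLike G g g' κ ω ℓ σ) (r : ℝ) (c₀ : ℝ) : ∃ C, 0 ≤ C ∧ ∃ M : ℝ,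
    ∀ᶠ k : ℤ in atTop, ∀ ζ : ℂ, ‖ζ‖ ≤ r →
      (k : ℝ) / ‖g‖ ≤ ‖modelRoot g ℓ σ k + ζ / (2 * I * g)‖ ∧
      |((modelRoot g ℓ σ k + ζ / (2 * I * g)) * g).im| ≤ M ∧
      c₀ ≤ ((modelRoot g ℓ σ k + ζ / (2 * I * g)) * g').im ∧
      ‖G (modelRoot g ℓ σ k + ζ / (2 * I * g)) - ω * (exp ζ - 1)‖ ≤ C / k := by
  have hg := h.g_ne
  have hg0 : 0 < ‖g‖ := norm_pos_iff.2 hg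
  set b : ℝ := ‖ℓ / (2 * I)‖ + |r| / 2 with hb
  obtain ⟨C, hC⟩ := h.approx b
  obtain ⟨R, hR⟩ := eventually_cobounded_iff.1 hC
  refine ⟨|C| * ‖g‖, by positivity, b, ?_⟩
  have cast := tendsto_intCast_atTop_atTop (R := ℝ)
  have hπ := Real.pi_gt_three
  filter_upwards [eventually_gt_atTop 0, cast.eventually_ge_atTop b,
    cast.eventually_ge_atTop (R * ‖g‖),
    (cast.const_mul_atTop (mul_pos Real.pi_pos h.dir)).eventually_ge_atTop (‖g' / g‖ * b + max c₀ 0)]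
    with k hk0 hk1 hk2 hk3 ζ hζ
  have hk0' : (0 : ℝ) < k := by exact_mod_cast hk0
  set ρ := modelRoot g ℓ σ k + ζ / (2 * I * g) with hρ
  set e : ℂ := ℓ / (2 * I) + ζ / (2 * I) with he
  have hρg : ρ * g = ((σ * k * Real.pi : ℝ) : ℂ) + e := by
    rw [hρ, he, modelRoot]; push_cast; have := I_ne_zero; field_simp; ring
  have heb : ‖e‖ ≤ b := by
    refine (norm_add_le _ _).trans (add_le_add le_rfl ?_)
    rw [norm_div, norm_mul, norm_I, Complex.norm_ofNat, mul_one]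
    have := le_abs_self r
    linarith
  have hσ : |(σ : ℝ)| = 1 := by
    have h2 : (σ : ℝ) * σ = 1 := by exact_mod_cast h.σ_sq
    rw [← sq_eq_sq₀ (abs_nonneg _) zero_le_one, sq_abs, sq, h2, one_pow]
  have h1 : (k : ℝ) / ‖g‖ ≤ ‖ρ‖ := by
    rw [div_le_iff₀ hg0, ← norm_mul, hρg]
    have h2 := norm_sub_norm_le ((σ * k * Real.pi : ℝ) : ℂ) (-e)
    rw [sub_neg_eq_add, norm_neg, Complex.norm_real, Real.norm_eq_abs, abs_mul, abs_mul, hσ,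
      abs_of_pos hk0', abs_of_pos Real.pi_pos] at h2
    nlinarith
  have h2 : |(ρ * g).im| ≤ b := by
    rw [hρg, add_im, ofReal_im, zero_add]
    exact (abs_im_le_norm _).trans heb
  have h3 : max c₀ 0 ≤ (ρ * g').im := by
    have e1 : ρ * g' = (σ * k * Real.pi : ℝ) * (g' / g) + g' / g * e := by
      rw [mul_comm _ (g' / g), ← mul_add, ← hρg]; field_simp
    rw [e1, add_im, im_ofReal_mul]
    have e2 : |(g' / g * e).im| ≤ ‖g' / g‖ * b :=
      (abs_im_le_norm _).trans (by rw [norm_mul]; gcongr)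
    have e3 := neg_abs_le (g' / g * e).im
    nlinarith
  have h5 := (le_max_left c₀ 0).trans h3
  have h6 := (le_max_right c₀ 0).trans h3
  refine ⟨h1, h2, h5, ?_⟩
  have h4 := hR ρ (le_trans (by rwa [le_div_iff₀ hg0]) h1) h2 h6
  rw [hρ, h.mul_exp k ζ] at h4
  rw [mul_sub, mul_one]
  refine h4.trans ?_
  have hρ0 : 0 < ‖ρ‖ := lt_of_lt_of_le (by positivity) h1
  rw [div_le_iff₀ hg0] at h1
  rw [div_le_div_iff₀ hρ0 hk0']
  calc C * k ≤ |C| * (‖ρ‖ * ‖g‖) := by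
        have := le_abs_self C
        gcongr
    _ = _ := by ring

/-- A small value of `G` forces exp(2iρg − ℓ) close to 1, so ρ is close to some model root. A large
|ρ| makes its index large in modulus, and `dir` together with Im(ρg') ≥ 0 bounds the index below. -/
theorem localize (h : IsStripLike G g g' κ ω ℓ σ) (M : ℝ) {s : ℝ} (hs : 0 < s) (K : ℤ) :
    ∃ ε : ℝ, 0 < ε ∧ ∀ᶠ ρ in Bornology.cobounded ℂ, |(ρ * g).im| ≤ M → 0 ≤ (ρ * g').im →
      ‖G ρ‖ ≤ ε → ∃ k : ℤ, K ≤ k ∧ ‖2 * I * g * (ρ - modelRoot g ℓ σ k)‖ ≤ s := by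
  have hg := h.g_ne
  have hg0 : 0 < ‖g‖ := norm_pos_iff.2 hg
  obtain ⟨C, hC⟩ := h.approx M
  have hω0 : 0 < ‖ω‖ := norm_pos_iff.2 h.ω_ne
  set s' : ℝ := min (s / 2) (1 / 2) with hs'
  have hs'0 : 0 < s' := by positivity
  refine ⟨s' * ‖ω‖ / 2, by positivity, ?_⟩
  set b : ℝ := ‖ℓ / (2 * I)‖ + s / 2 with hb
  have hb0 : 0 ≤ b := by positivity
  set d := Real.pi * (σ * (g' / g).im) with hd
  have hd0 : 0 < d := mul_pos Real.pi_pos h.dir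
  -- Since k ≥ −‖g'/g‖b/d, having |k| ≥ R' excludes negative `k` and leaves k ≥ K.
  obtain ⟨R', hR'⟩ := exists_nat_gt (|(K : ℝ)| + ‖g' / g‖ * b / d)
  filter_upwards [hC, eventually_cobounded_le_norm (2 * |C| / (s' * ‖ω‖)),
    eventually_cobounded_le_norm 1,
    eventually_cobounded_le_norm ((R' * Real.pi + b + 1) / ‖g‖)] with ρ h1 h2 h3 h4 hM hpos hG
  have hρ0 : 0 < ‖ρ‖ := by linarith
  have e1 : ‖exp (2 * I * (ρ * g) - ℓ) - 1‖ ≤ s' := by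
    have a1 := h1 hM hpos
    have a2 : κ * exp (2 * I * (ρ * g)) - ω = ω * (exp (2 * I * (ρ * g) - ℓ) - 1) := by
      rw [Complex.exp_sub, ← h.exp_ℓ]
      have := exp_ne_zero ℓ
      field_simp
    have a3 : ‖ω * (exp (2 * I * (ρ * g) - ℓ) - 1)‖ ≤ s' * ‖ω‖ := by
      rw [← a2]
      have a4 : C / ‖ρ‖ ≤ s' * ‖ω‖ / 2 := by
        rw [div_le_iff₀ (by positivity)] at h2
        rw [div_le_iff₀ hρ0]
        have := le_abs_self C
        nlinarith
      have a5 := norm_sub_le (G ρ) (G ρ - (κ * exp (2 * I * (ρ * g)) - ω))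
      rw [sub_sub_cancel] at a5
      linarith
    rw [norm_mul, mul_comm] at a3
    exact le_of_mul_le_mul_right a3 hω0
  obtain ⟨n, hn⟩ := exists_int_of_exp_near_one (min_le_right _ _) e1
  have hn' : ‖2 * I * (ρ * g) - ℓ - n * (2 * Real.pi * I)‖ ≤ s :=
    hn.trans (by have := min_le_left (s / 2) (1 / 2 : ℝ); linarith)
  have hσσ : (σ : ℂ) * σ = 1 := by exact_mod_cast h.σ_sq
  have key : 2 * I * g * (ρ - modelRoot g ℓ σ (σ * n)) =
      2 * I * (ρ * g) - ℓ - n * (2 * Real.pi * I) := by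
    rw [modelRoot]
    have := I_ne_zero
    push_cast
    field_simp
    linear_combination (-(2 * I * Real.pi * n)) * hσσ
  refine ⟨σ * n, ?_, by rwa [key]⟩
  set k : ℤ := σ * n with hk
  set e : ℂ := ρ * g - (σ * k * Real.pi : ℝ) with he
  have heb : ‖e‖ ≤ b := by
    have : e = ℓ / (2 * I) + (2 * I * (ρ * g) - ℓ - n * (2 * Real.pi * I)) / (2 * I) := by
      rw [he, hk]
      have := I_ne_zero
      push_cast
      field_simp
      linear_combination (-(2 * I * Real.pi * n)) * hσσ
    rw [this]
    refine (norm_add_le _ _).trans (add_le_add le_rfl ?_)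
    rw [norm_div, norm_mul, norm_I, Complex.norm_ofNat, mul_one]
    linarith
  have hσ : |(σ : ℝ)| = 1 := by
    have h2 : (σ : ℝ) * σ = 1 := by exact_mod_cast h.σ_sq
    rw [← sq_eq_sq₀ (abs_nonneg _) zero_le_one, sq_abs, sq, h2, one_pow]
  have b1 : (R' : ℝ) ≤ |(k : ℝ)| := by
    rw [div_le_iff₀ hg0, ← norm_mul] at h4
    have a1 : ρ * g = ((σ * k * Real.pi : ℝ) : ℂ) + e := by rw [he]; ring
    have a2 := norm_add_le ((σ * k * Real.pi : ℝ) : ℂ) e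
    rw [← a1, Complex.norm_real, Real.norm_eq_abs, abs_mul, abs_mul, hσ,
      abs_of_pos Real.pi_pos] at a2
    have := Real.pi_pos
    by_contra hcon
    nlinarith
  have b2 : -(‖g' / g‖ * b) ≤ d * k := by
    have a1 : ρ * g' = (σ * k * Real.pi : ℝ) * (g' / g) + g' / g * e := by
      rw [he]; field_simp; ring
    rw [a1, add_im, im_ofReal_mul] at hpos
    have a2 : |(g' / g * e).im| ≤ ‖g' / g‖ * b :=
      (abs_im_le_norm _).trans (by rw [norm_mul]; gcongr)
    have a3 := le_abs_self (g' / g * e).im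
    have : d * k = σ * k * Real.pi * (g' / g).im := by rw [hd]; ring
    linarith
  have b3 : -(‖g' / g‖ * b / d) ≤ k := by
    rw [← neg_div, div_le_iff₀ hd0]; linarith
  have hKk : (K : ℝ) ≤ k := by
    have hK := le_abs_self (K : ℝ)
    have hK' := abs_nonneg (K : ℝ)
    have hq : 0 ≤ ‖g' / g‖ * b / d := by positivity
    rcases abs_cases (k : ℝ) with ⟨ha, -⟩ | ⟨ha, -⟩ <;> linarith
  exact_mod_cast hKk


/-- `zero_of_near_exp_sub_one` applied to G/ω in the coordinate ζ, with ε of order 1/k. -/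
theorem local_model (h : IsStripLike G g g' κ ω ℓ σ) : ∃ C : ℝ, 0 ≤ C ∧ ∀ᶠ k : ℤ in atTop,
    C / k ≤ 1 / 16 ∧ (∀ ζ, ‖ζ‖ ≤ 1 → modelRoot g ℓ σ k + ζ / (2 * I * g) ≠ 0) ∧
    (∃ ζ, ‖ζ‖ ≤ C / k ∧ G (modelRoot g ℓ σ k + ζ / (2 * I * g)) = 0) ∧
    (∀ ζ ζ', ‖ζ‖ ≤ 1 / 8 → ‖ζ'‖ ≤ 1 / 8 → G (modelRoot g ℓ σ k + ζ / (2 * I * g)) = 0 →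
      G (modelRoot g ℓ σ k + ζ' / (2 * I * g)) = 0 → ζ = ζ') ∧
    ∀ ζ, ‖ζ‖ ≤ 1 / 8 → ‖deriv G (modelRoot g ℓ σ k + ζ / (2 * I * g)) / (2 * I * g * ω) - exp ζ‖
      ≤ C / k := by
  have hg := h.g_ne
  have hg0 : 0 < ‖g‖ := norm_pos_iff.2 hg
  have hω := h.ω_ne
  have hω0 : 0 < ‖ω‖ := norm_pos_iff.2 hω
  obtain ⟨C, hC, M, hn⟩ := h.near 1 0
  refine ⟨2 * (C / ‖ω‖), by positivity, ?_⟩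
  have cast := tendsto_intCast_atTop_atTop (R := ℝ)
  filter_upwards [hn, eventually_gt_atTop 0, cast.eventually_ge_atTop (32 * (C / ‖ω‖))]
    with k hk hk0 hk1
  have hk0' : (0 : ℝ) < k := by exact_mod_cast hk0
  set H : ℂ → ℂ := fun ζ => G (modelRoot g ℓ σ k + ζ / (2 * I * g)) / ω with hH
  have hne : ∀ ζ : ℂ, ‖ζ‖ ≤ 1 → modelRoot g ℓ σ k + ζ / (2 * I * g) ≠ 0 := fun ζ hζ =>
    norm_pos_iff.1 (lt_of_lt_of_le (by positivity) (hk ζ hζ).1)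
  have hdH : ∀ ζ : ℂ, ‖ζ‖ ≤ 1 → HasDerivAt H
      (deriv G (modelRoot g ℓ σ k + ζ / (2 * I * g)) / (2 * I * g * ω)) ζ := fun ζ hζ => by
    have h1 := (h.diff _ (hne ζ hζ)).hasDerivAt
    have h2 : HasDerivAt (fun ζ : ℂ => modelRoot g ℓ σ k + ζ / (2 * I * g)) (1 / (2 * I * g)) ζ :=
      ((hasDerivAt_id ζ).div_const _).const_add _
    have h3 := (h1.comp ζ h2).div_const ω
    convert! h3 using 1
    field_simp
  have hε : C / ‖ω‖ / k ≤ 1 / 16 / 2 := by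
    rw [div_le_iff₀ hk0']; linarith
  obtain ⟨z1, z2, z3⟩ := zero_of_near_exp_sub_one (H := H) (ε := C / ‖ω‖ / k) (by linarith)
    (fun ζ hζ => (hdH ζ hζ).differentiableAt) (fun ζ hζ => by
      have h1 := (hk ζ hζ).2.2.2
      have h2 : H ζ - (exp ζ - 1) =
          (G (modelRoot g ℓ σ k + ζ / (2 * I * g)) - ω * (exp ζ - 1)) / ω := by
        simp only [hH]; field_simp
      rw [h2, norm_div, div_right_comm]
      gcongr)
  have e : 2 * (C / ‖ω‖) / k = 2 * (C / ‖ω‖ / k) := by ring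
  have hz : ∀ ζ, H ζ = 0 ↔ G (modelRoot g ℓ σ k + ζ / (2 * I * g)) = 0 := fun ζ => by
    simp [hH, hω]
  simp only [hz] at z1 z2
  rw [e]
  refine ⟨by linarith, hne, z1, z2, fun ζ hζ => ?_⟩
  have := z3 ζ hζ
  rwa [(hdH ζ (by linarith)).deriv] at this

/-- The last two claims come from `localize`. With radius 1/8, local uniqueness identifies a zero
with the constructed root. With radius at most δ‖g‖, a point where `G` is small lies within δ/2 of a
model root, and the true root is closer than δ/2 to it for large `k`. -/
theorem exists_roots (h : IsStripLike G g g' κ ω ℓ σ) : ∃ (K : ℤ) (z : ℤ → ℂ),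
    (∀ k, K ≤ k → z k ≠ 0 ∧ G (z k) = 0) ∧
    ((fun k => z k - modelRoot g ℓ σ k) =O[atTop] fun k : ℤ => (1 / k : ℝ)) ∧
    (∀ (M : ℝ) (K' : ℤ), ∀ᶠ ρ in Bornology.cobounded ℂ, |(ρ * g).im| ≤ M → 0 ≤ (ρ * g').im →
      G ρ = 0 → ∃ k, K' ≤ k ∧ ρ = z k) ∧
    (∀ M δ : ℝ, 0 < δ → ∃ c : ℝ, 0 < c ∧ ∀ᶠ ρ in Bornology.cobounded ℂ, |(ρ * g).im| ≤ M →
      0 ≤ (ρ * g').im → (∀ k, K ≤ k → δ ≤ ‖ρ - z k‖) → c ≤ ‖G ρ‖) := by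
  have hg := h.g_ne
  have hg0 : 0 < ‖g‖ := norm_pos_iff.2 hg
  obtain ⟨C, hC, hloc⟩ := h.local_model
  obtain ⟨K, hK⟩ := eventually_atTop.1 (hloc.and (eventually_gt_atTop 0))
  have hex : ∀ k, ∃ ζ : ℂ, K ≤ k → ‖ζ‖ ≤ C / k ∧ G (modelRoot g ℓ σ k + ζ / (2 * I * g)) = 0 := by
    intro k
    by_cases hk : K ≤ k
    · obtain ⟨ζ, hζ⟩ := (hK k hk).1.2.2.1
      exact ⟨ζ, fun _ => hζ⟩
    · exact ⟨0, fun h => absurd h hk⟩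
  choose ζ hζ using hex
  have hnorm : ∀ w : ℂ, ‖w / (2 * I * g)‖ = ‖w‖ / (2 * ‖g‖) := fun w => by
    rw [norm_div, norm_mul, norm_mul, norm_I, Complex.norm_ofNat, mul_one]
  refine ⟨K, fun k => modelRoot g ℓ σ k + ζ k / (2 * I * g), fun k hk =>
    ⟨(hK k hk).1.2.1 _ ((hζ k hk).1.trans ((hK k hk).1.1.trans (by norm_num))), (hζ k hk).2⟩,
    ?_, ?_, ?_⟩
  · refine IsBigO.of_bound (C / (2 * ‖g‖)) ?_
    filter_upwards [eventually_ge_atTop K, eventually_gt_atTop 0] with k hk hk0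
    have hk0' : (0 : ℝ) < k := by exact_mod_cast hk0
    rw [add_sub_cancel_left, hnorm, norm_div, norm_one, Real.norm_of_nonneg hk0'.le]
    have := (hζ k hk).1
    calc _ ≤ C / k / (2 * ‖g‖) := by gcongr
      _ = _ := by ring
  · intro M K'
    obtain ⟨ε, hε, hev⟩ := h.localize M (s := 1 / 8) (by norm_num) (max K K')
    filter_upwards [hev] with ρ hρ hM hpos hG
    obtain ⟨k, hk, hks⟩ := hρ hM hpos (by rw [hG, norm_zero]; exact hε.le)
    have hk1 := (le_max_left K K').trans hk
    refine ⟨k, (le_max_right K K').trans hk, ?_⟩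
    have heq : ρ = modelRoot g ℓ σ k + 2 * I * g * (ρ - modelRoot g ℓ σ k) / (2 * I * g) := by
      have := I_ne_zero; field_simp; ring
    have hu := (hK k hk1).1.2.2.2.1 (2 * I * g * (ρ - modelRoot g ℓ σ k)) (ζ k) hks
      ((hζ k hk1).1.trans ((hK k hk1).1.1.trans (by norm_num))) (by rw [← heq]; exact hG)
      (hζ k hk1).2
    rw [← hu]
    exact heq
  · intro M δ hδ
    set s := min (δ * ‖g‖) 1 with hs
    have hs0 : 0 < s := by positivity
    obtain ⟨K₁, hK₁⟩ := eventually_atTop.1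
      ((tendsto_intCast_atTop_atTop (R := ℝ)).eventually_gt_atTop (C / (δ * ‖g‖)))
    obtain ⟨ε, hε, hev⟩ := h.localize M hs0 (max K K₁)
    refine ⟨ε, hε, ?_⟩
    filter_upwards [hev] with ρ hρ hM hpos hfar
    by_contra hcon
    obtain ⟨k, hk, hks⟩ := hρ hM hpos (not_le.1 hcon).le
    have hk1 := (le_max_left K K₁).trans hk
    have hk2 := hK₁ k ((le_max_right K K₁).trans hk)
    have hk0' : (0 : ℝ) < k := by exact_mod_cast (hK k hk1).2
    have h1 := hfar k hk1
    have h2 : ‖ρ - modelRoot g ℓ σ k‖ ≤ δ / 2 := by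
      rw [norm_mul, norm_mul, norm_mul, norm_I, Complex.norm_ofNat, mul_one] at hks
      have := min_le_left (δ * ‖g‖) 1
      refine le_of_mul_le_mul_left ?_ (mul_pos two_pos hg0)
      linarith
    have h3 : ‖ζ k / (2 * I * g)‖ < δ / 2 := by
      rw [hnorm, div_lt_iff₀ (by positivity)]
      refine (hζ k hk1).1.trans_lt ?_
      rw [div_lt_iff₀ (by positivity)] at hk2
      rw [div_lt_iff₀ hk0']
      linarith
    have h4 := norm_sub_le (ρ - modelRoot g ℓ σ k) (ζ k / (2 * I * g))
    rw [sub_sub] at h4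
    linarith

section Sequences

variable {w : ℤ → ℂ}

theorem exists_displacement (h : IsStripLike G g g' κ ω ℓ σ)
    (hw : (fun k => w k - modelRoot g ℓ σ k) =O[atTop] fun k : ℤ => (1 / k : ℝ)) :
    ∃ ζ : ℤ → ℂ, (∀ k, w k = modelRoot g ℓ σ k + ζ k / (2 * I * g)) ∧
      (ζ =O[atTop] fun k : ℤ => (1 / k : ℝ)) ∧ ∀ᶠ k in atTop, ‖ζ k‖ ≤ 1 / 8 := by
  have hg := h.g_ne
  have hI := I_ne_zero
  have hb : (fun k => 2 * I * g * (w k - modelRoot g ℓ σ k)) =O[atTop]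
    fun k : ℤ => (1 / k : ℝ) := hw.const_mul_left _
  have ht : Tendsto (fun k : ℤ => (1 / k : ℝ)) atTop (𝓝 0) :=
    tendsto_const_nhds.div_atTop tendsto_intCast_atTop_atTop
  refine ⟨fun k => 2 * I * g * (w k - modelRoot g ℓ σ k), fun k => by field_simp; ring, hb, ?_⟩
  have := (hb.trans_tendsto ht).norm
  rw [norm_zero] at this
  exact this.eventually_le_const (by norm_num)

theorem seq_strip (h : IsStripLike G g g' κ ω ℓ σ)
    (hw : (fun k => w k - modelRoot g ℓ σ k) =O[atTop] fun k : ℤ => (1 / k : ℝ)) (c₀ : ℝ) :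
    ∃ M : ℝ, ∀ᶠ k : ℤ in atTop, (k : ℝ) / ‖g‖ ≤ ‖w k‖ ∧ |(w k * g).im| ≤ M ∧
      c₀ ≤ (w k * g').im := by
  obtain ⟨ζ, h1, -, h3⟩ := h.exists_displacement hw
  obtain ⟨C, -, M, hn⟩ := h.near 1 c₀
  refine ⟨M, ?_⟩
  filter_upwards [hn, h3] with k hk hk3
  have := hk (ζ k) (by linarith)
  rw [← h1 k] at this
  exact ⟨this.1, this.2.1, this.2.2.1⟩

theorem exp_sub_one_isBigO {ζ : ℤ → ℂ} (h : ζ =O[atTop] fun k : ℤ => (1 / k : ℝ)) :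
    (fun k => exp (ζ k) - 1) =O[atTop] fun k : ℤ => (1 / k : ℝ) := by
  have ht : Tendsto (fun k : ℤ => (1 / k : ℝ)) atTop (𝓝 0) :=
    tendsto_const_nhds.div_atTop tendsto_intCast_atTop_atTop
  have := (h.trans_tendsto ht).norm
  rw [norm_zero] at this
  refine IsBigO.trans (IsBigO.of_bound 2 ?_) h
  filter_upwards [this.eventually_le_const (show (0 : ℝ) < 1 by norm_num)] with k hk
  exact Complex.norm_exp_sub_one_le hk

theorem seq_exp (h : IsStripLike G g g' κ ω ℓ σ)
    (hw : (fun k => w k - modelRoot g ℓ σ k) =O[atTop] fun k : ℤ => (1 / k : ℝ)) :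
    (fun k => κ / ω * exp (2 * I * (w k * g)) - 1) =O[atTop] fun k : ℤ => (1 / k : ℝ) := by
  obtain ⟨ζ, h1, h2, -⟩ := h.exists_displacement hw
  refine (exp_sub_one_isBigO h2).congr_left fun k => ?_
  have h3 := h.mul_exp k (ζ k)
  rw [← h1 k] at h3
  have := h.ω_ne
  rw [div_mul_eq_mul_div, h3]
  field_simp

/-- The derivative estimate is uniform near the model roots, so `w` need not consist of zeros; any
arrangement with the right asymptotics is covered. -/
theorem seq_deriv (h : IsStripLike G g g' κ ω ℓ σ)
    (hw : (fun k => w k - modelRoot g ℓ σ k) =O[atTop] fun k : ℤ => (1 / k : ℝ)) :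
    (fun k => deriv G (w k) / (2 * I * g * ω) - 1) =O[atTop] fun k : ℤ => (1 / k : ℝ) := by
  obtain ⟨ζ, h1, h2, h3⟩ := h.exists_displacement hw
  obtain ⟨C, hC, hloc⟩ := h.local_model
  have h4 : (fun k => deriv G (w k) / (2 * I * g * ω) - exp (ζ k)) =O[atTop]
      fun k : ℤ => (1 / k : ℝ) := by
    refine IsBigO.of_bound C ?_
    filter_upwards [hloc, h3, eventually_gt_atTop 0] with k hk hk3 hk0
    have hk0' : (0 : ℝ) < k := by exact_mod_cast hk0
    have := hk.2.2.2.2 (ζ k) hk3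
    rw [← h1 k] at this
    rwa [norm_div, norm_one, Real.norm_of_nonneg hk0'.le, mul_one_div]
  exact (h4.add (exp_sub_one_isBigO h2)).congr_left fun k => by ring

end Sequences

end IsStripLike

/-! ### Exponential form and lower bounds of the trigonometric main terms -/

section SinComb

theorem norm_exp_two_I_mul (z : ℂ) : ‖exp (2 * I * z)‖ = Real.exp (-(2 * z.im)) := by
  rw [Complex.norm_exp]; congr 1; simp

theorem exp_neg_le_inv {x : ℝ} (hx : 0 ≤ x) : Real.exp (-x) ≤ 1 / (1 + x) := by
  rw [Real.exp_neg, ← one_div]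
  exact one_div_le_one_div_of_le (by linarith) (by linarith [Real.add_one_le_exp x])

theorem exp_mul_cos_comb (p m A B : ℂ) :
    exp (I * (A + B)) * (p * cos (A + B) + m * cos (A - B)) =
      (p * (1 + exp (2 * I * A) * exp (2 * I * B)) + m * (exp (2 * I * A) + exp (2 * I * B))) / 2 := by
  have hA : exp (I * A) ≠ 0 := exp_ne_zero _
  have hB : exp (I * B) ≠ 0 := exp_ne_zero _
  have e1 : exp (2 * I * A) = exp (I * A) ^ 2 := by rw [← Complex.exp_nat_mul]; ring_nf
  have e2 : exp (2 * I * B) = exp (I * B) ^ 2 := by rw [← Complex.exp_nat_mul]; ring_nf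
  have e3 : exp ((A + B) * I) = exp (I * A) * exp (I * B) := by rw [← Complex.exp_add]; ring_nf
  have e4 : exp (-(A + B) * I) = (exp (I * A))⁻¹ * (exp (I * B))⁻¹ := by
    rw [← Complex.exp_neg, ← Complex.exp_neg, ← Complex.exp_add]; ring_nf
  have e5 : exp ((A - B) * I) = exp (I * A) * (exp (I * B))⁻¹ := by
    rw [← Complex.exp_neg, ← Complex.exp_add]; ring_nf
  have e6 : exp (-(A - B) * I) = (exp (I * A))⁻¹ * exp (I * B) := by
    rw [← Complex.exp_neg, ← Complex.exp_add]; ring_nf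
  rw [Complex.cos, Complex.cos, e3, e4, e5, e6, e1, e2, mul_add I, Complex.exp_add]
  field_simp
  ring

/-- The factor e^{i(A+B)} turns the main term into a polynomial in e^{2iA} and e^{2iB}, which are
bounded when Im A and Im B are bounded below. -/
theorem exp_mul_sin_comb (p m A B : ℂ) :
    exp (I * (A + B)) * (p * sin (A + B) + m * sin (B - A)) =
      (p * (exp (2 * I * A) * exp (2 * I * B) - 1) + m * (exp (2 * I * B) - exp (2 * I * A))) /
        (2 * I) := by
  have hA : exp (I * A) ≠ 0 := exp_ne_zero _
  have hB : exp (I * B) ≠ 0 := exp_ne_zero _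
  have hI := I_ne_zero
  have e1 : exp (2 * I * A) = exp (I * A) ^ 2 := by rw [← Complex.exp_nat_mul]; ring_nf
  have e2 : exp (2 * I * B) = exp (I * B) ^ 2 := by rw [← Complex.exp_nat_mul]; ring_nf
  have e3 : exp ((A + B) * I) = exp (I * A) * exp (I * B) := by rw [← Complex.exp_add]; ring_nf
  have e4 : exp (-(A + B) * I) = (exp (I * A))⁻¹ * (exp (I * B))⁻¹ := by
    rw [← Complex.exp_neg, ← Complex.exp_neg, ← Complex.exp_add]; ring_nf
  have e5 : exp ((B - A) * I) = (exp (I * A))⁻¹ * exp (I * B) := by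
    rw [← Complex.exp_neg, ← Complex.exp_add]; ring_nf
  have e6 : exp (-(B - A) * I) = exp (I * A) * (exp (I * B))⁻¹ := by
    rw [← Complex.exp_neg, ← Complex.exp_add]; ring_nf
  rw [Complex.sin, Complex.sin, e3, e4, e5, e6, e1, e2, mul_add I, Complex.exp_add]
  field_simp
  linear_combination (p * (1 - exp (I * A) ^ 2 * exp (I * B) ^ 2) +
    m * (exp (I * A) ^ 2 - exp (I * B) ^ 2)) * I_sq

theorem norm_exp_I_mul_add (A B : ℂ) :
    ‖exp (I * (A + B))‖ = (Real.exp A.im * Real.exp B.im)⁻¹ := by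
  rw [Complex.norm_exp, ← Real.exp_add, ← Real.exp_neg]; congr 1; simp

theorem norm_sin_comb_ge_of_im_ge {p : ℂ} (hp : p ≠ 0) (m : ℂ) : ∃ M : ℝ, 0 ≤ M ∧
    ∀ A B : ℂ, M ≤ A.im → M ≤ B.im →
      ‖p‖ / 4 * (Real.exp A.im * Real.exp B.im) ≤ ‖p * sin (A + B) + m * sin (B - A)‖ := by
  have hp0 : 0 < ‖p‖ := norm_pos_iff.2 hp
  -- If u and v are at most `t`, the terms other than −p sum to at most ‖p‖t + 2‖m‖t = ‖p‖/2.
  set t := ‖p‖ / (2 * (‖p‖ + 2 * ‖m‖)) with ht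
  have ht0 : 0 < t := by positivity
  refine ⟨1 / t, by positivity, fun A B hA hB => ?_⟩
  have small : ∀ z : ℂ, 1 / t ≤ z.im → ‖exp (2 * I * z)‖ ≤ t := by
    intro z hz
    have h0 : 0 < z.im := lt_of_lt_of_le (by positivity) hz
    rw [norm_exp_two_I_mul]
    refine (exp_neg_le_inv (by positivity)).trans ?_
    rw [div_le_iff₀ ht0] at hz
    rw [div_le_iff₀ (by positivity)]
    nlinarith
  have t1 : t ≤ 1 := by
    rw [ht, div_le_one (by positivity)]; nlinarith [norm_nonneg m]
  have hu := small A hA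
  have hv := small B hB
  set u := exp (2 * I * A)
  set v := exp (2 * I * B)
  have key : ‖p‖ / 2 ≤ ‖p * (u * v - 1) + m * (v - u)‖ := by
    have h1 : ‖p * (u * v) + m * (v - u)‖ ≤ ‖p‖ / 2 := by
      calc _ ≤ ‖p‖ * (‖u‖ * ‖v‖) + ‖m‖ * (‖v‖ + ‖u‖) := by
            refine (norm_add_le _ _).trans ?_
            rw [norm_mul, norm_mul, norm_mul]
            gcongr
            exact norm_sub_le _ _
        _ ≤ ‖p‖ * (t * 1) + ‖m‖ * (t + t) := by
            gcongr
            exact hv.trans t1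
        _ = ‖p‖ / 2 := by rw [ht]; field_simp; ring
    have h2 := norm_sub_le (p * (u * v - 1) + m * (v - u)) (p * (u * v) + m * (v - u))
    have h3 : p * (u * v - 1) + m * (v - u) - (p * (u * v) + m * (v - u)) = -p := by ring
    rw [h3, norm_neg] at h2
    linarith
  have h4 := congrArg norm (exp_mul_sin_comb p m A B)
  rw [norm_mul, norm_exp_I_mul_add, norm_div, norm_mul, norm_I, mul_one, Complex.norm_ofNat,
    inv_mul_eq_iff_eq_mul₀ (by positivity)] at h4
  rw [h4]
  have : 0 < Real.exp A.im * Real.exp B.im := by positivity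
  nlinarith

/-- Sign changes of A and B reduce all quadrants to the first; changing one sign exchanges the roles
of `p` and `m`, so both must be nonzero. -/
theorem norm_sin_comb_ge {p m : ℂ} (hp : p ≠ 0) (hm : m ≠ 0) : ∃ M c : ℝ, 0 < c ∧
    ∀ A B : ℂ, M ≤ |A.im| → M ≤ |B.im| →
      c * (Real.exp |A.im| * Real.exp |B.im|) ≤ ‖p * sin (A + B) + m * sin (B - A)‖ := by
  obtain ⟨M₁, h₁, H₁⟩ := norm_sin_comb_ge_of_im_ge hp m
  obtain ⟨M₂, h₂, H₂⟩ := norm_sin_comb_ge_of_im_ge hm p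
  obtain ⟨M₃, h₃, H₃⟩ := norm_sin_comb_ge_of_im_ge (neg_ne_zero.2 hm) (-p)
  obtain ⟨M₄, h₄, H₄⟩ := norm_sin_comb_ge_of_im_ge (neg_ne_zero.2 hp) (-m)
  have hp0 : 0 < ‖p‖ := norm_pos_iff.2 hp
  have hm0 : 0 < ‖m‖ := norm_pos_iff.2 hm
  have cp : min ‖p‖ ‖m‖ / 4 ≤ ‖p‖ / 4 := by gcongr; exact min_le_left _ _
  have cm : min ‖p‖ ‖m‖ / 4 ≤ ‖m‖ / 4 := by gcongr; exact min_le_right _ _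
  refine ⟨M₁ + M₂ + M₃ + M₄, min ‖p‖ ‖m‖ / 4, by positivity, fun A B hA hB => ?_⟩
  have pos : ∀ x y : ℝ, 0 ≤ Real.exp x * Real.exp y := fun x y => by positivity
  rcases abs_cases A.im with ⟨ha, -⟩ | ⟨ha, -⟩ <;> rcases abs_cases B.im with ⟨hb, -⟩ | ⟨hb, -⟩ <;>
    rw [ha, hb] <;> rw [ha] at hA <;> rw [hb] at hB
  · exact (mul_le_mul_of_nonneg_right cp (pos _ _)).trans (H₁ A B (by linarith) (by linarith))
  · have := H₃ A (-B) (by linarith) (by rw [neg_im]; linarith)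
    rw [neg_im, norm_neg] at this
    refine (mul_le_mul_of_nonneg_right cm (pos _ _)).trans (this.trans_eq ?_)
    congr 1
    rw [show A + -B = -(B - A) by ring, show -B - A = -(A + B) by ring, sin_neg, sin_neg]; ring
  · have := H₂ (-A) B (by rw [neg_im]; linarith) (by linarith)
    rw [neg_im] at this
    refine (mul_le_mul_of_nonneg_right cm (pos _ _)).trans (this.trans_eq ?_)
    congr 1
    rw [show -A + B = B - A by ring, show B - -A = A + B by ring]; ring
  · have := H₄ (-A) (-B) (by rw [neg_im]; linarith) (by rw [neg_im]; linarith)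
    rw [neg_im, neg_im, norm_neg] at this
    refine (mul_le_mul_of_nonneg_right cp (pos _ _)).trans (this.trans_eq ?_)
    congr 1
    rw [show -A + -B = -(A + B) by ring, show -B - -A = -(B - A) by ring, sin_neg, sin_neg]; ring

end SinComb

/-! ### Asymptotics of Δ, Δ₀ and φ(T) in the two half-strips -/

namespace ComplexWeightBVP

variable (L : ComplexWeightBVP)

/-- `a₁ l₁`. -/
noncomputable def g₁ : ℂ := L.a₁ * L.l₁

/-- `a₂ l₂`. -/
noncomputable def g₂ : ℂ := L.a₂ * L.l₂

theorem l₁_pos : 0 < L.l₁ := L.b_pos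

theorem l₂_pos : 0 < L.l₂ := sub_pos.2 L.b_lt_T

theorem l₁_ne : (L.l₁ : ℂ) ≠ 0 := ofReal_ne_zero.2 L.l₁_pos.ne'

theorem l₂_ne : (L.l₂ : ℂ) ≠ 0 := ofReal_ne_zero.2 L.l₂_pos.ne'

theorem g₁_ne : L.g₁ ≠ 0 := mul_ne_zero L.a₁_ne L.l₁_ne

theorem g₂_ne : L.g₂ ≠ 0 := mul_ne_zero L.a₂_ne L.l₂_ne

theorem ωp_ne : L.ωp ≠ 0 := L.omega_plus_ne

theorem ωm_ne : L.ωm ≠ 0 := L.omega_minus_ne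

theorem sin_arg_sub_pos : 0 < Real.sin (L.a₁.arg - L.a₂.arg) :=
  Real.sin_pos_of_pos_of_lt_pi (by linarith [L.arg_a₂_lt])
    (by linarith [L.arg_a₁_lt, L.arg_a₂_nonneg])

/-- The argument of this quotient is φ₁ − φ₂, which lies in (0, π). -/
theorem im_g₁_div_g₂_pos : 0 < (L.g₁ / L.g₂).im := by
  have h1 : L.g₁ / L.g₂ = (‖L.a₁‖ * L.l₁ / (‖L.a₂‖ * L.l₂) : ℝ) *
      exp ((L.a₁.arg - L.a₂.arg : ℝ) * I) := by
    have e1 := norm_mul_exp_arg_mul_I L.a₁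
    have e2 := norm_mul_exp_arg_mul_I L.a₂
    rw [g₁, g₂]
    conv_lhs => rw [← e1, ← e2]
    push_cast
    rw [sub_mul, Complex.exp_sub]
    ring
  rw [h1, im_ofReal_mul, exp_ofReal_mul_I_im]
  have := norm_pos_iff.2 L.a₁_ne
  have := norm_pos_iff.2 L.a₂_ne
  have := L.l₁_pos
  have := L.l₂_pos
  have := L.sin_arg_sub_pos
  positivity

theorem im_g₂_div_g₁_neg : (L.g₂ / L.g₁).im < 0 := by
  have h := L.im_g₁_div_g₂_pos
  rw [← inv_div, inv_im]
  have : 0 < normSq (L.g₁ / L.g₂) := normSq_pos.2 (div_ne_zero L.g₁_ne L.g₂_ne)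
  exact div_neg_of_neg_of_pos (by linarith) this

/-- As g₁/g₂ is not real, ρ ↦ (Im ρg₁, Im ρg₂) is an injective real linear map of the plane. -/
theorem exists_norm_le : ∃ K : ℝ, 0 < K ∧
    ∀ ρ : ℂ, ‖ρ‖ ≤ K * (|(ρ * L.g₁).im| + |(ρ * L.g₂).im|) := by
  have hg := L.g₂_ne
  have hd := L.im_g₁_div_g₂_pos
  have hg0 : 0 < ‖L.g₂‖ := norm_pos_iff.2 hg
  set d := L.g₁ / L.g₂ with hd'
  have hK : 0 < (1 + ‖d‖) / d.im / ‖L.g₂‖ + 1 / ‖L.g₂‖ := by positivity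
  refine ⟨_, hK, fun ρ => ?_⟩
  set z := ρ * L.g₂ with hz
  have h1 : ρ * L.g₁ = z * d := by rw [hz, hd']; field_simp
  rw [h1]
  have h2 : (z * d).im = z.re * d.im + z.im * d.re := mul_im _ _
  have h3 : |z.re| ≤ (|(z * d).im| + ‖d‖ * |z.im|) / d.im := by
    rw [le_div_iff₀ hd]
    have e1 : |z.re| * d.im = |(z * d).im - z.im * d.re| := by
      rw [h2, add_sub_cancel_right, abs_mul, abs_of_pos hd]
    have e2 : |z.im * d.re| ≤ ‖d‖ * |z.im| := by
      rw [abs_mul, mul_comm]; gcongr; exact abs_re_le_norm d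
    rw [e1]
    exact (abs_sub _ _).trans (by linarith)
  have h4 : ‖z‖ ≤ |z.re| + |z.im| := norm_le_abs_re_add_abs_im z
  have h5 : ‖ρ‖ = ‖z‖ / ‖L.g₂‖ := by rw [hz, norm_mul]; field_simp
  have n1 := abs_nonneg (z * d).im
  have n2 := abs_nonneg z.im
  rw [h5, div_le_iff₀ hg0]
  have h6 : ((1 + ‖d‖) / d.im / ‖L.g₂‖ + 1 / ‖L.g₂‖) * (|(z * d).im| + |z.im|) * ‖L.g₂‖ =
      ((1 + ‖d‖) * (|(z * d).im| + |z.im|)) / d.im + (|(z * d).im| + |z.im|) := by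
    field_simp
  rw [h6]
  have h7 : (|(z * d).im| + ‖d‖ * |z.im|) / d.im ≤
      ((1 + ‖d‖) * (|(z * d).im| + |z.im|)) / d.im := by
    gcongr
    nlinarith [norm_nonneg d]
  linarith

theorem growth_eq (ρ : ℂ) :
    L.growth ρ = Real.exp |(ρ * L.g₁).im| * Real.exp |(ρ * L.g₂).im| := by
  simp only [growth, g₁, g₂, mul_assoc]

/-- The exponential cancels the growth exactly when both imaginary parts are nonnegative; down to −M
each costs at most a factor e^{2|M|}. -/
theorem exists_norm_exp_mul_le {X : ℂ → ℂ}
    (hX : X =O[Bornology.cobounded ℂ] fun ρ => L.growth ρ / ‖ρ‖) (M : ℝ) :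
    ∃ C : ℝ, ∀ᶠ ρ in Bornology.cobounded ℂ, -M ≤ (ρ * L.g₁).im → -M ≤ (ρ * L.g₂).im →
      ‖exp (I * (ρ * L.g₁ + ρ * L.g₂)) * X ρ‖ ≤ C / ‖ρ‖ := by
  obtain ⟨C, hC⟩ := hX.bound
  refine ⟨|C| * (Real.exp (2 * |M|) * Real.exp (2 * |M|)), ?_⟩
  filter_upwards [hC] with ρ h h1 h2
  have e : ∀ x : ℝ, -M ≤ x → Real.exp |x| ≤ Real.exp (2 * |M|) * Real.exp x := fun x hx => by
    rw [← Real.exp_add, Real.exp_le_exp]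
    have := le_abs_self M
    have := abs_nonneg M
    rcases abs_cases x with ⟨h, -⟩ | ⟨h, -⟩ <;> linarith
  have h3 := e _ h1
  have h4 := e _ h2
  have hg := L.growth_pos ρ
  rw [norm_div, norm_norm, Real.norm_of_nonneg hg.le] at h
  rw [norm_mul, norm_exp_I_mul_add, inv_mul_le_iff₀ (by positivity)]
  calc ‖X ρ‖ ≤ C * (L.growth ρ / ‖ρ‖) := h
    _ ≤ |C| * (L.growth ρ / ‖ρ‖) := by gcongr; exact le_abs_self C
    _ ≤ |C| * ((Real.exp (2 * |M|) * Real.exp (ρ * L.g₁).im) *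
        (Real.exp (2 * |M|) * Real.exp (ρ * L.g₂).im) / ‖ρ‖) := by
        rw [growth_eq]; gcongr
    _ = _ := by ring

/-- By `exists_norm_le`, Im ρg₂ is at least a multiple of |ρ| up to a constant. The decay is
exponential, but order 1/ρ is all that is used. -/
theorem exists_norm_exp_g₂_le (M : ℝ) : ∃ C : ℝ, ∀ ρ : ℂ, ρ ≠ 0 → |(ρ * L.g₁).im| ≤ M →
    0 ≤ (ρ * L.g₂).im → ‖exp (2 * I * (ρ * L.g₂))‖ ≤ C / ‖ρ‖ := by
  obtain ⟨K, hK, h⟩ := L.exists_norm_le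
  refine ⟨K * (M + 1), fun ρ hρ hM hpos => ?_⟩
  have hρ0 := norm_pos_iff.2 hρ
  have hM0 := (abs_nonneg _).trans hM
  have h1 := h ρ
  rw [abs_of_nonneg hpos] at h1
  rw [norm_exp_two_I_mul]
  refine (exp_neg_le_inv (by positivity)).trans ?_
  rw [div_le_div_iff₀ (by positivity) hρ0, one_mul]
  calc ‖ρ‖ ≤ K * (|(ρ * L.g₁).im| + (ρ * L.g₂).im) := h1
    _ ≤ K * ((M + 1) * (1 + 2 * (ρ * L.g₂).im)) := by
        gcongr
        nlinarith
    _ = _ := by ring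

theorem exists_norm_exp_g₁_le (M : ℝ) : ∃ C : ℝ, ∀ ρ : ℂ, ρ ≠ 0 → |(ρ * L.g₂).im| ≤ M →
    0 ≤ (ρ * L.g₁).im → ‖exp (2 * I * (ρ * L.g₁))‖ ≤ C / ‖ρ‖ := by
  obtain ⟨K, hK, h⟩ := L.exists_norm_le
  refine ⟨K * (M + 1), fun ρ hρ hM hpos => ?_⟩
  have hρ0 := norm_pos_iff.2 hρ
  have hM0 := (abs_nonneg _).trans hM
  have h1 := h ρ
  rw [abs_of_nonneg hpos] at h1
  rw [norm_exp_two_I_mul]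
  refine (exp_neg_le_inv (by positivity)).trans ?_
  rw [div_le_div_iff₀ (by positivity) hρ0, one_mul]
  calc ‖ρ‖ ≤ K * ((ρ * L.g₁).im + |(ρ * L.g₂).im|) := h1
    _ ≤ K * ((M + 1) * (1 + 2 * (ρ * L.g₁).im)) := by
        gcongr
        nlinarith
    _ = _ := by ring

theorem norm_exp_two_I_mul_le {z : ℂ} {M : ℝ} (h : |z.im| ≤ M) :
    ‖exp (2 * I * z)‖ ≤ Real.exp (2 * M) := by
  rw [norm_exp_two_I_mul]
  exact Real.exp_le_exp.2 (by linarith [(abs_le.1 h).1])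

theorem phiT_asymptotics' : (fun ρ => L.phiT (ρ ^ 2) - (2 * L.a₂)⁻¹ *
      (L.ωp * cos (ρ * L.g₁ + ρ * L.g₂) + L.ωm * cos (ρ * L.g₁ - ρ * L.g₂)))
    =O[Bornology.cobounded ℂ] fun ρ => L.growth ρ / ‖ρ‖ := by
  simpa only [g₁, g₂, mul_assoc] using L.phiT_asymptotics

theorem Δ₀_asymptotics' : (fun ρ => L.Δ₀ (ρ ^ 2) - (2 * L.a₁)⁻¹ *
      (L.ωp * cos (ρ * L.g₁ + ρ * L.g₂) + -L.ωm * cos (ρ * L.g₁ - ρ * L.g₂)))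
    =O[Bornology.cobounded ℂ] fun ρ => L.growth ρ / ‖ρ‖ := by
  simpa only [g₁, g₂, mul_assoc, neg_mul, ← sub_eq_add_neg] using L.Δ₀_asymptotics

theorem Δ_asymptotics' : (fun ρ => L.Δ (ρ ^ 2) - ρ / 2 *
      (L.ωp * sin (ρ * L.g₁ + ρ * L.g₂) + L.ωm * sin (ρ * L.g₂ - ρ * L.g₁)))
    =O[Bornology.cobounded ℂ] fun ρ => L.growth ρ := by
  simpa only [g₁, g₂, mul_assoc] using L.Δ_asymptotics

/-- The normalized characteristic function in the `ρ`-plane. -/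
noncomputable def G (ρ : ℂ) : ℂ := 4 * I / ρ * exp (I * (ρ * L.g₁ + ρ * L.g₂)) * L.Δ (ρ ^ 2)

theorem G_eq_zero_iff {ρ : ℂ} (hρ : ρ ≠ 0) : L.G ρ = 0 ↔ L.Δ (ρ ^ 2) = 0 := by
  simp [G, hρ]

theorem differentiableAt_G {ρ : ℂ} (hρ : ρ ≠ 0) : DifferentiableAt ℂ L.G ρ := by
  have h1 : DifferentiableAt ℂ (fun ρ : ℂ => L.Δ (ρ ^ 2)) ρ :=
    (L.differentiable_Δ (ρ ^ 2)).comp (f := fun ρ : ℂ => ρ ^ 2) ρ (by fun_prop)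
  have h2 : DifferentiableAt ℂ (fun ρ : ℂ => 4 * I / ρ * exp (I * (ρ * L.g₁ + ρ * L.g₂))) ρ := by
    fun_prop (disch := exact hρ)
  exact h2.mul h1

theorem exists_G_sub_le (M : ℝ) : ∃ C : ℝ, ∀ᶠ ρ in Bornology.cobounded ℂ,
    -M ≤ (ρ * L.g₁).im → -M ≤ (ρ * L.g₂).im →
      ‖L.G ρ - (L.ωp * (exp (2 * I * (ρ * L.g₁)) * exp (2 * I * (ρ * L.g₂)) - 1) +
        L.ωm * (exp (2 * I * (ρ * L.g₂)) - exp (2 * I * (ρ * L.g₁))))‖ ≤ C / ‖ρ‖ := by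
  have h1 := (isBigO_refl (fun ρ : ℂ => ρ⁻¹) (Bornology.cobounded ℂ)).norm_right.mul
    L.Δ_asymptotics'
  obtain ⟨C, hC⟩ := L.exists_norm_exp_mul_le
    (h1.congr_right fun ρ => by rw [norm_inv, div_eq_inv_mul]) M
  refine ⟨4 * C, ?_⟩
  filter_upwards [hC, eventually_cobounded_ne_zero] with ρ h hρ hA hB
  have h2 := h hA hB
  have h3 := exp_mul_sin_comb L.ωp L.ωm (ρ * L.g₁) (ρ * L.g₂)
  have h4 : L.G ρ - (L.ωp * (exp (2 * I * (ρ * L.g₁)) * exp (2 * I * (ρ * L.g₂)) - 1) +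
        L.ωm * (exp (2 * I * (ρ * L.g₂)) - exp (2 * I * (ρ * L.g₁)))) =
      4 * I * (exp (I * (ρ * L.g₁ + ρ * L.g₂)) * (ρ⁻¹ * (L.Δ (ρ ^ 2) - ρ / 2 *
      (L.ωp * sin (ρ * L.g₁ + ρ * L.g₂) + L.ωm * sin (ρ * L.g₂ - ρ * L.g₁))))) := by
    rw [eq_div_iff (mul_ne_zero two_ne_zero I_ne_zero)] at h3
    rw [← h3, G]
    field_simp
    ring
  rw [h4, norm_mul, norm_mul, norm_I, Complex.norm_ofNat, mul_one, mul_div_assoc]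
  gcongr

/-- With v negligible the main term is −ω₋u − ω₊. The sign −1 reflects Im(g₂/g₁) < 0: the roots in
the half-strip Im ρg₂ ≥ 0 have ρg₁ near −kπ. -/
theorem isStripLike_first : IsStripLike L.G L.g₁ L.g₂ (-L.ωm) L.ωp (-log (-L.ωm / L.ωp)) (-1) where
  g_ne := L.g₁_ne
  ω_ne := L.ωp_ne
  exp_ℓ := by
    have := L.ωm_ne
    have := L.ωp_ne
    rw [Complex.exp_neg, Complex.exp_log (div_ne_zero (neg_ne_zero.2 L.ωm_ne) L.ωp_ne)]
    field_simp
  σ_sq := rfl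
  dir := by have := L.im_g₂_div_g₁_neg; push_cast; linarith
  diff _ := L.differentiableAt_G
  approx M := by
    obtain ⟨C₁, h₁⟩ := L.exists_G_sub_le M
    obtain ⟨C₂, h₂⟩ := L.exists_norm_exp_g₂_le M
    refine ⟨C₁ + C₂ * (‖L.ωp‖ * Real.exp (2 * M) + ‖L.ωm‖), ?_⟩
    filter_upwards [h₁, eventually_cobounded_ne_zero] with ρ h hρ hA hB
    have hM := (abs_nonneg _).trans hA
    have e1 := h (abs_le.1 hA).1 (by linarith)
    have e2 := h₂ ρ hρ hA hB
    have e3 := norm_exp_two_I_mul_le hA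
    set u := exp (2 * I * (ρ * L.g₁))
    set v := exp (2 * I * (ρ * L.g₂))
    have e4 : L.G ρ - (-L.ωm * u - L.ωp) = (L.G ρ - (L.ωp * (u * v - 1) + L.ωm * (v - u))) +
        v * (L.ωp * u + L.ωm) := by ring
    rw [e4, add_div]
    refine (norm_add_le _ _).trans (add_le_add e1 ?_)
    rw [norm_mul, mul_div_right_comm]
    have e5 := norm_add_le (L.ωp * u) L.ωm
    rw [norm_mul] at e5
    have e6 : ‖L.ωp * u + L.ωm‖ ≤ ‖L.ωp‖ * Real.exp (2 * M) + ‖L.ωm‖ := e5.trans (by gcongr)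
    exact mul_le_mul e2 e6 (norm_nonneg _) ((norm_nonneg _).trans e2)

/-- With u negligible the main term is ω₋v − ω₊. -/
theorem isStripLike_second : IsStripLike L.G L.g₂ L.g₁ L.ωm L.ωp (log (L.ωp / L.ωm)) 1 where
  g_ne := L.g₂_ne
  ω_ne := L.ωp_ne
  exp_ℓ := by
    have := L.ωm_ne
    rw [Complex.exp_log (div_ne_zero L.ωp_ne L.ωm_ne)]
    field_simp
  σ_sq := rfl
  dir := by have := L.im_g₁_div_g₂_pos; push_cast; linarith
  diff _ := L.differentiableAt_G
  approx M := by
    obtain ⟨C₁, h₁⟩ := L.exists_G_sub_le M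
    obtain ⟨C₂, h₂⟩ := L.exists_norm_exp_g₁_le M
    refine ⟨C₁ + C₂ * (‖L.ωp‖ * Real.exp (2 * M) + ‖L.ωm‖), ?_⟩
    filter_upwards [h₁, eventually_cobounded_ne_zero] with ρ h hρ hA hB
    have hM := (abs_nonneg _).trans hA
    have e1 := h (by linarith) (abs_le.1 hA).1
    have e2 := h₂ ρ hρ hA hB
    have e3 := norm_exp_two_I_mul_le hA
    set u := exp (2 * I * (ρ * L.g₁))
    set v := exp (2 * I * (ρ * L.g₂))
    have e4 : L.G ρ - (L.ωm * v - L.ωp) = (L.G ρ - (L.ωp * (u * v - 1) + L.ωm * (v - u))) +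
        u * (L.ωp * v - L.ωm) := by ring
    rw [e4, add_div]
    refine (norm_add_le _ _).trans (add_le_add e1 ?_)
    rw [norm_mul, mul_div_right_comm]
    have e5 := norm_sub_le (L.ωp * v) L.ωm
    rw [norm_mul] at e5
    have e6 : ‖L.ωp * v - L.ωm‖ ≤ ‖L.ωp‖ * Real.exp (2 * M) + ‖L.ωm‖ := e5.trans (by gcongr)
    exact mul_le_mul e2 e6 (norm_nonneg _) ((norm_nonneg _).trans e2)

theorem exists_Δ₀_sub_le (M : ℝ) : ∃ C : ℝ, ∀ᶠ ρ in Bornology.cobounded ℂ,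
    |(ρ * L.g₁).im| ≤ M → 0 ≤ (ρ * L.g₂).im →
      ‖4 * L.a₁ * (exp (I * (ρ * L.g₁ + ρ * L.g₂)) * L.Δ₀ (ρ ^ 2)) -
        (L.ωp - L.ωm * exp (2 * I * (ρ * L.g₁)))‖ ≤ C / ‖ρ‖ := by
  obtain ⟨C₁, h₁⟩ := L.exists_norm_exp_mul_le L.Δ₀_asymptotics' M
  obtain ⟨C₂, h₂⟩ := L.exists_norm_exp_g₂_le M
  refine ⟨‖4 * L.a₁‖ * C₁ + C₂ * (‖L.ωp‖ * Real.exp (2 * M) + ‖L.ωm‖), ?_⟩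
  filter_upwards [h₁, eventually_cobounded_ne_zero] with ρ h hρ hA hB
  have hM := (abs_nonneg _).trans hA
  have e1 := h (abs_le.1 hA).1 (by linarith)
  have e2 := h₂ ρ hρ hA hB
  have e3 := norm_exp_two_I_mul_le hA
  have e0 := exp_mul_cos_comb L.ωp (-L.ωm) (ρ * L.g₁) (ρ * L.g₂)
  set u := exp (2 * I * (ρ * L.g₁))
  set v := exp (2 * I * (ρ * L.g₂))
  rw [mul_sub, mul_left_comm, e0] at e1
  set E := exp (I * (ρ * L.g₁ + ρ * L.g₂)) * L.Δ₀ (ρ ^ 2)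
  have e4 : 4 * L.a₁ * E - (L.ωp - L.ωm * u) = 4 * L.a₁ * (E - (2 * L.a₁)⁻¹ *
      ((L.ωp * (1 + u * v) + -L.ωm * (u + v)) / 2)) + v * (L.ωp * u - L.ωm) := by
    have := L.a₁_ne
    field_simp
    ring
  rw [e4, add_div (‖4 * L.a₁‖ * C₁)]
  refine (norm_add_le _ _).trans (add_le_add ?_ ?_)
  · rw [norm_mul, mul_div_assoc]; gcongr
  rw [norm_mul, mul_div_right_comm]
  have e5 := norm_sub_le (L.ωp * u) L.ωm
  rw [norm_mul] at e5
  have e6 : ‖L.ωp * u - L.ωm‖ ≤ ‖L.ωp‖ * Real.exp (2 * M) + ‖L.ωm‖ := e5.trans (by gcongr)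
  exact mul_le_mul e2 e6 (norm_nonneg _) ((norm_nonneg _).trans e2)

theorem exists_phiT_sub_le (M : ℝ) : ∃ C : ℝ, ∀ᶠ ρ in Bornology.cobounded ℂ,
    |(ρ * L.g₂).im| ≤ M → 0 ≤ (ρ * L.g₁).im →
      ‖4 * L.a₂ * (exp (I * (ρ * L.g₁ + ρ * L.g₂)) * L.phiT (ρ ^ 2)) -
        (L.ωp + L.ωm * exp (2 * I * (ρ * L.g₂)))‖ ≤ C / ‖ρ‖ := by
  obtain ⟨C₁, h₁⟩ := L.exists_norm_exp_mul_le L.phiT_asymptotics' M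
  obtain ⟨C₂, h₂⟩ := L.exists_norm_exp_g₁_le M
  refine ⟨‖4 * L.a₂‖ * C₁ + C₂ * (‖L.ωp‖ * Real.exp (2 * M) + ‖L.ωm‖), ?_⟩
  filter_upwards [h₁, eventually_cobounded_ne_zero] with ρ h hρ hA hB
  have hM := (abs_nonneg _).trans hA
  have e1 := h (by linarith) (abs_le.1 hA).1
  have e2 := h₂ ρ hρ hA hB
  have e3 := norm_exp_two_I_mul_le hA
  have e0 := exp_mul_cos_comb L.ωp L.ωm (ρ * L.g₁) (ρ * L.g₂)
  set u := exp (2 * I * (ρ * L.g₁))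
  set v := exp (2 * I * (ρ * L.g₂))
  rw [mul_sub, mul_left_comm, e0] at e1
  set E := exp (I * (ρ * L.g₁ + ρ * L.g₂)) * L.phiT (ρ ^ 2)
  have e4 : 4 * L.a₂ * E - (L.ωp + L.ωm * v) = 4 * L.a₂ * (E - (2 * L.a₂)⁻¹ *
      ((L.ωp * (1 + u * v) + L.ωm * (u + v)) / 2)) + u * (L.ωp * v + L.ωm) := by
    have := L.a₂_ne
    field_simp
    ring
  rw [e4, add_div (‖4 * L.a₂‖ * C₁)]
  refine (norm_add_le _ _).trans (add_le_add ?_ ?_)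
  · rw [norm_mul, mul_div_assoc]; gcongr
  rw [norm_mul, mul_div_right_comm]
  have e5 := norm_add_le (L.ωp * v) L.ωm
  rw [norm_mul] at e5
  have e6 : ‖L.ωp * v + L.ωm‖ ≤ ‖L.ωp‖ * Real.exp (2 * M) + ‖L.ωm‖ := e5.trans (by gcongr)
  exact mul_le_mul e2 e6 (norm_nonneg _) ((norm_nonneg _).trans e2)

/-- Off both strips the main term has full size ‖ρ‖ times the growth and dominates the remainder,
which lacks the factor ‖ρ‖. -/
theorem exists_le_norm_Δ : ∃ M c : ℝ, 0 < c ∧ ∀ᶠ ρ in Bornology.cobounded ℂ,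
    M ≤ |(ρ * L.g₁).im| → M ≤ |(ρ * L.g₂).im| → c * (‖ρ‖ * L.growth ρ) ≤ ‖L.Δ (ρ ^ 2)‖ := by
  obtain ⟨M, c, hc, h⟩ := norm_sin_comb_ge L.ωp_ne L.ωm_ne
  obtain ⟨C, hC⟩ := L.Δ_asymptotics'.bound
  refine ⟨M, c / 4, by positivity, ?_⟩
  filter_upwards [hC, eventually_cobounded_le_norm (4 * C / c)] with ρ h1 h2 hA hB
  have h3 := h _ _ hA hB
  rw [← growth_eq] at h3
  have hg := L.growth_pos ρ
  rw [Real.norm_of_nonneg hg.le] at h1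
  rw [div_le_iff₀ hc] at h2
  set X := L.ωp * sin (ρ * L.g₁ + ρ * L.g₂) + L.ωm * sin (ρ * L.g₂ - ρ * L.g₁)
  have h4 := norm_sub_le (L.Δ (ρ ^ 2)) (L.Δ (ρ ^ 2) - ρ / 2 * X)
  rw [sub_sub_cancel, norm_mul, norm_div, Complex.norm_ofNat] at h4
  have h5 : ‖ρ‖ / 2 * (c * L.growth ρ) ≤ ‖ρ‖ / 2 * ‖X‖ := by gcongr
  have h6 : C * L.growth ρ ≤ (‖ρ‖ * c / 4) * L.growth ρ := by gcongr; linarith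
  nlinarith

end ComplexWeightBVP

/-! ### Relative errors O(1/k) along root sequences -/

section RelativeErrors

theorem tendsto_one_div_intCast : Tendsto (fun k : ℤ => (1 / k : ℝ)) atTop (𝓝 0) :=
  tendsto_const_nhds.div_atTop tendsto_intCast_atTop_atTop

variable {f g : ℤ → ℂ}

theorem tendsto_one_of_sub_one_isBigO
    (hf : (fun k => f k - 1) =O[atTop] fun k : ℤ => (1 / k : ℝ)) : Tendsto f atTop (𝓝 1) := by
  simpa using (hf.trans_tendsto tendsto_one_div_intCast).add_const 1

theorem mul_sub_one_isBigO (hf : (fun k => f k - 1) =O[atTop] fun k : ℤ => (1 / k : ℝ))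
    (hg : (fun k => g k - 1) =O[atTop] fun k : ℤ => (1 / k : ℝ)) :
    (fun k => f k * g k - 1) =O[atTop] fun k : ℤ => (1 / k : ℝ) := by
  have h1 := hf.mul ((tendsto_one_of_sub_one_isBigO hg).isBigO_one ℝ)
  refine ((h1.congr_right fun k => mul_one _).add hg).congr_left fun k => by ring

theorem inv_sub_one_isBigO (hf : (fun k => f k - 1) =O[atTop] fun k : ℤ => (1 / k : ℝ)) :
    (fun k => (f k)⁻¹ - 1) =O[atTop] fun k : ℤ => (1 / k : ℝ) := by
  have ht := tendsto_one_of_sub_one_isBigO hf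
  have h1 := hf.neg_left.mul ((ht.inv₀ one_ne_zero).isBigO_one ℝ)
  refine (h1.congr_right fun k => mul_one _).congr' ?_ EventuallyEq.rfl
  filter_upwards [ht.eventually_ne one_ne_zero] with k hk
  field_simp
  ring

end RelativeErrors

namespace IsStripLike

variable {G : ℂ → ℂ} {g g' κ ω ℓ : ℂ} {σ : ℤ} {w : ℤ → ℂ}

theorem seq_tendsto_cobounded (h : IsStripLike G g g' κ ω ℓ σ)
    (hw : (fun k => w k - modelRoot g ℓ σ k) =O[atTop] fun k : ℤ => (1 / k : ℝ)) :
    Tendsto w atTop (Bornology.cobounded ℂ) := by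
  rw [← tendsto_norm_atTop_iff_cobounded]
  obtain ⟨M, hM⟩ := h.seq_strip hw 0
  have hg0 : 0 < ‖g‖ := norm_pos_iff.2 h.g_ne
  refine tendsto_atTop_mono' _ (hM.mono fun k hk => hk.1)
    ((tendsto_intCast_atTop_atTop (R := ℝ)).atTop_div_const hg0)

theorem seq_inv_norm_isBigO (h : IsStripLike G g g' κ ω ℓ σ)
    (hw : (fun k => w k - modelRoot g ℓ σ k) =O[atTop] fun k : ℤ => (1 / k : ℝ)) :
    (fun k => 1 / ‖w k‖) =O[atTop] fun k : ℤ => (1 / k : ℝ) := by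
  obtain ⟨M, hM⟩ := h.seq_strip hw 0
  have hg0 : 0 < ‖g‖ := norm_pos_iff.2 h.g_ne
  refine IsBigO.of_bound ‖g‖ ?_
  filter_upwards [hM, eventually_gt_atTop 0] with k hk hk0
  have hk0' : (0 : ℝ) < k := by exact_mod_cast hk0
  have h1 := hk.1
  have hw0 : 0 < ‖w k‖ := lt_of_lt_of_le (by positivity) h1
  rw [Real.norm_of_nonneg (by positivity), Real.norm_of_nonneg (by positivity), mul_one_div,
    div_le_div_iff₀ hw0 hk0']
  rw [div_le_iff₀ hg0] at h1
  linarith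

/-- Estimates of order `1/ρ` in the strip give estimates of order `1/k` along the sequence. -/
theorem seq_isBigO_of_strip (h : IsStripLike G g g' κ ω ℓ σ)
    (hw : (fun k => w k - modelRoot g ℓ σ k) =O[atTop] fun k : ℤ => (1 / k : ℝ)) {X : ℂ → ℂ}
    (hX : ∀ M : ℝ, ∃ C : ℝ, ∀ᶠ ρ in Bornology.cobounded ℂ, |(ρ * g).im| ≤ M → 0 ≤ (ρ * g').im →
      ‖X ρ‖ ≤ C / ‖ρ‖) :
    (fun k => X (w k)) =O[atTop] fun k : ℤ => (1 / k : ℝ) := by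
  obtain ⟨M, hM⟩ := h.seq_strip hw 0
  obtain ⟨C, hC⟩ := hX M
  refine IsBigO.trans (IsBigO.of_bound C ?_) (h.seq_inv_norm_isBigO hw)
  filter_upwards [hM, (h.seq_tendsto_cobounded hw).eventually hC] with k h1 h2
  rw [Real.norm_of_nonneg (by positivity), mul_one_div]
  exact h2 h1.2.1 h1.2.2

theorem seq_div_tendsto (h : IsStripLike G g g' κ ω ℓ σ)
    (hw : (fun k => w k - modelRoot g ℓ σ k) =O[atTop] fun k : ℤ => (1 / k : ℝ)) :
    Tendsto (fun k : ℤ => (k : ℂ) * Real.pi / w k) atTop (𝓝 (σ * g)) := by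
  have hg := h.g_ne
  have hσσ : (σ : ℂ) * σ = 1 := by exact_mod_cast h.σ_sq
  have hσ : (σ : ℂ) ≠ 0 := fun h0 => by simp [h0] at hσσ
  have hπ : (Real.pi : ℂ) ≠ 0 := ofReal_ne_zero.2 Real.pi_ne_zero
  have hinv : Tendsto (fun k : ℤ => (k : ℂ)⁻¹) atTop (𝓝 0) := by
    have h1 := (continuous_ofReal.tendsto (0 : ℝ)).comp tendsto_one_div_intCast
    rw [ofReal_zero] at h1
    refine h1.congr fun k => ?_
    simp
  have h0 : Tendsto (fun k => w k - modelRoot g ℓ σ k) atTop (𝓝 0) :=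
    hw.trans_tendsto tendsto_one_div_intCast
  have h1 : Tendsto (fun k : ℤ => w k * ((k : ℂ)⁻¹)) atTop (𝓝 (σ * Real.pi / g)) := by
    have h2 : Tendsto (fun k : ℤ => (w k - modelRoot g ℓ σ k) * (k : ℂ)⁻¹ +
        (σ * Real.pi / g + ℓ / (2 * I) / g * (k : ℂ)⁻¹)) atTop
        (𝓝 (0 * 0 + (σ * Real.pi / g + ℓ / (2 * I) / g * 0))) :=
      (h0.mul hinv).add ((hinv.const_mul _).const_add _)
    simp only [mul_zero, add_zero, zero_add] at h2
    refine h2.congr' ?_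
    filter_upwards [eventually_gt_atTop 0] with k hk
    have hk0 : (k : ℂ) ≠ 0 := by exact_mod_cast hk.ne'
    rw [modelRoot]
    have := I_ne_zero
    field_simp
    ring
  have h3 := (h1.inv₀ (div_ne_zero (mul_ne_zero hσ hπ) hg)).const_mul (Real.pi : ℂ)
  have e : (Real.pi : ℂ) * (σ * Real.pi / g)⁻¹ = σ * g := by
    field_simp
    linear_combination -hσσ
  rw [e] at h3
  refine h3.congr fun k => ?_
  rw [mul_inv, inv_inv]
  ring

end IsStripLike

/-! ### Weyl coefficients and recovery of the parameters -/

namespace ComplexWeightBVP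

variable (L : ComplexWeightBVP)

theorem modelRoot_first (k : ℤ) : modelRoot L.g₁ (-log (-L.ωm / L.ωp)) (-1) k =
    (k * Real.pi / (L.r₁ * L.l₁) : ℝ) * exp (I * L.θ₂) + L.C₁ := by
  have h1 := norm_mul_exp_arg_mul_I L.a₁
  have h2 : exp (I * L.θ₂) = -(exp (L.a₁.arg * I))⁻¹ := by
    rw [θ₂, ← Complex.exp_neg]
    push_cast
    rw [mul_sub, Complex.exp_sub, mul_comm I, Complex.exp_pi_mul_I, Complex.exp_neg, mul_comm I]
    ring
  have h3 : (‖L.a₁‖ : ℂ) ≠ 0 := ofReal_ne_zero.2 (norm_ne_zero_iff.2 L.a₁_ne)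
  have h4 := L.l₁_ne
  have h5 := exp_ne_zero (L.a₁.arg * I)
  have h6 := I_ne_zero
  rw [modelRoot, h2, C₁, g₁, r₁, add_div]
  congr 1
  · conv_lhs => rw [← h1]
    push_cast
    field_simp
  · have := L.a₁_ne
    field_simp

theorem modelRoot_second (k : ℤ) : modelRoot L.g₂ (log (L.ωp / L.ωm)) 1 k =
    (k * Real.pi / (L.r₂ * L.l₂) : ℝ) * exp (I * L.θ₁) + L.C₂ := by
  have h1 := norm_mul_exp_arg_mul_I L.a₂
  have h2 : exp (I * L.θ₁) = (exp (L.a₂.arg * I))⁻¹ := by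
    rw [θ₁, ← Complex.exp_neg]
    push_cast
    ring_nf
  have h3 : (‖L.a₂‖ : ℂ) ≠ 0 := ofReal_ne_zero.2 (norm_ne_zero_iff.2 L.a₂_ne)
  have h4 := L.l₂_ne
  have h5 := exp_ne_zero (L.a₂.arg * I)
  have h6 := I_ne_zero
  rw [modelRoot, h2, C₂, g₂, r₂, add_div]
  congr 1
  · conv_lhs => rw [← h1]
    push_cast
    field_simp
  · have := L.a₂_ne
    field_simp

variable {L}

theorem HasEigenvalueAsymptotics.first' {ρ : Fin 2 → ℤ → ℂ} (h : L.HasEigenvalueAsymptotics ρ) :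
    (fun k => ρ 0 k - modelRoot L.g₁ (-log (-L.ωm / L.ωp)) (-1) k) =O[atTop]
      fun k : ℤ => (1 / k : ℝ) := by
  simpa only [modelRoot_first] using h.first

theorem HasEigenvalueAsymptotics.second' {ρ : Fin 2 → ℤ → ℂ} (h : L.HasEigenvalueAsymptotics ρ) :
    (fun k => ρ 1 k - modelRoot L.g₂ (log (L.ωp / L.ωm)) 1 k) =O[atTop]
      fun k : ℤ => (1 / k : ℝ) := by
  simpa only [modelRoot_second] using h.second

variable (L)

/-- At a zero only the derivative of Δ(ρ²) survives the product rule, and (4i/ρ)·2ρ = 8i. -/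
theorem deriv_G {ρ : ℂ} (hρ : ρ ≠ 0) (h : L.G ρ = 0) :
    deriv L.G ρ = 8 * I * exp (I * (ρ * L.g₁ + ρ * L.g₂)) * deriv L.Δ (ρ ^ 2) := by
  rw [L.G_eq_zero_iff hρ] at h
  have h1 : HasDerivAt (fun ρ : ℂ => L.Δ (ρ ^ 2)) (deriv L.Δ (ρ ^ 2) * (2 * ρ)) ρ := by
    have h0 := (L.differentiable_Δ (ρ ^ 2)).hasDerivAt
    have h2 := HasDerivAt.comp (h := fun ρ : ℂ => ρ ^ 2) ρ h0 (hasDerivAt_pow 2 ρ)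
    have e : ((2 : ℕ) : ℂ) * ρ ^ (2 - 1) = 2 * ρ := by norm_num
    rw [e] at h2
    exact h2
  have h2 : DifferentiableAt ℂ (fun ρ : ℂ => 4 * I / ρ * exp (I * (ρ * L.g₁ + ρ * L.g₂))) ρ := by
    fun_prop (disch := exact hρ)
  have h3 := h2.hasDerivAt.mul h1
  have h4 : deriv L.G ρ = _ := h3.deriv
  rw [h4, h]
  field_simp
  ring

theorem analyticAt_Δ (z : ℂ) : AnalyticAt ℂ L.Δ z := L.differentiable_Δ.analyticAt z

theorem mult_eq_one {z : ℂ} (h : L.Δ z = 0) (h' : deriv L.Δ z ≠ 0) : L.mult z = 1 := by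
  have h1 : analyticOrderAt L.Δ z = (1 : ℕ) := by
    rw [(L.analyticAt_Δ z).analyticOrderAt_eq_natCast]
    refine ⟨dslope L.Δ z, ?_, by rwa [dslope_same], Eventually.of_forall fun x => ?_⟩
    · exact ((Complex.differentiableOn_dslope (s := Set.univ) univ_mem).2
        L.differentiable_Δ.differentiableOn).analyticAt univ_mem
    · have := sub_smul_dslope L.Δ z x
      rw [h, sub_zero] at this
      rw [pow_one, this]
  rw [mult, analyticOrderNatAt, h1]
  rfl

/-- Along a sequence with the model asymptotics, zeros of `Δ` are simple. -/
theorem eventually_deriv_ne_zero {g g' κ ω ℓ : ℂ} {σ : ℤ} (h : IsStripLike L.G g g' κ ω ℓ σ)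
    {w : ℤ → ℂ}
    (hw : (fun k => w k - modelRoot g ℓ σ k) =O[atTop] fun k : ℤ => (1 / k : ℝ)) :
    ∀ᶠ k in atTop, w k ≠ 0 ∧ (L.Δ (w k ^ 2) = 0 → deriv L.Δ (w k ^ 2) ≠ 0) := by
  have h1 := (tendsto_one_of_sub_one_isBigO (h.seq_deriv hw)).eventually_ne one_ne_zero
  filter_upwards [h1, (h.seq_tendsto_cobounded hw).eventually eventually_cobounded_ne_zero]
    with k hk hk0
  refine ⟨hk0, fun hz hd => hk ?_⟩
  rw [← L.G_eq_zero_iff hk0] at hz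
  rw [L.deriv_G hk0 hz, hd]
  simp

variable {L}

/-- The Weyl number of a simple eigenvalue. -/
theorem IsSpectralData.weyl_eq {N : Fin 2 → ℤ} {ρ μ : Fin 2 → ℤ → ℂ} (h : L.IsSpectralData N ρ μ)
    {j : Fin 2} {k : ℤ} (hk : N j ≤ k) (h' : deriv L.Δ (ρ j k ^ 2) ≠ 0) :
    L.Δ (ρ j k ^ 2) = 0 ∧ μ j k = L.Δ₀ (ρ j k ^ 2) / deriv L.Δ (ρ j k ^ 2) := by
  have hz : L.Δ (ρ j k ^ 2) = 0 :=
    (L.isEigenvalue_iff _).1 ((h.eigenvalues _).2 ⟨j, k, hk, rfl⟩)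
  refine ⟨hz, ?_⟩
  set z := ρ j k ^ 2 with hzdef
  have hm := L.mult_eq_one hz h'
  obtain ⟨e, -, hr, g, hg, hM⟩ := h.principal_parts z
  have hp : (j, k) ∈ Set.range e := by rw [hr]; exact ⟨hk, rfl⟩
  obtain ⟨ν₀, hν₀⟩ := hp
  have hsub : ∀ ν : Fin (L.mult z), ν = ν₀ := fun ν => by
    have := ν.2; have := ν₀.2; exact Fin.ext (by omega)
  have hν0 : (ν₀ : ℕ) = 0 := by have := ν₀.2; omega
  have hsum : ∀ lam : ℂ, ∑ ν : Fin (L.mult z), μ (e ν).1 (e ν).2 / (lam - z) ^ ((ν : ℕ) + 1) =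
      μ j k / (lam - z) := fun lam => by
    have hu : (Finset.univ : Finset (Fin (L.mult z))) = {ν₀} :=
      Finset.eq_singleton_iff_unique_mem.2 ⟨Finset.mem_univ _, fun ν _ => hsub ν⟩
    rw [hu, Finset.sum_singleton, hν₀, hν0, zero_add, pow_one]
  simp only [hsum] at hM
  have hsl : Tendsto (slope L.Δ z) (𝓝[≠] z) (𝓝 (deriv L.Δ z)) :=
    hasDerivAt_iff_tendsto_slope.1 (L.differentiable_Δ z).hasDerivAt
  have hne : ∀ᶠ lam in 𝓝[≠] z, L.Δ lam ≠ 0 := by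
    filter_upwards [hsl.eventually_ne h'] with lam hl h0
    exact hl (by simp [slope, h0, hz])
  -- The residue is computed twice, from M = Δ₀/Δ and from the one-term principal part.
  have t1 : Tendsto (fun lam => (lam - z) * L.M lam) (𝓝[≠] z)
      (𝓝 (L.Δ₀ z / deriv L.Δ z)) := by
    have h0 : Tendsto L.Δ₀ (𝓝[≠] z) (𝓝 (L.Δ₀ z)) :=
      (L.differentiable_Δ₀ z).continuousAt.tendsto.mono_left nhdsWithin_le_nhds
    refine (h0.div hsl h').congr' ?_
    filter_upwards [hne, self_mem_nhdsWithin] with lam hl hlz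
    have : lam - z ≠ 0 := sub_ne_zero.2 hlz
    simp only [Pi.div_apply]
    rw [L.M_eq hl, slope_def_field, hz, sub_zero]
    field_simp
  have t2 : Tendsto (fun lam => (lam - z) * L.M lam) (𝓝[≠] z) (𝓝 (μ j k)) := by
    have h0 : Tendsto (fun lam => μ j k + (lam - z) * g lam) (𝓝[≠] z)
        (𝓝 (μ j k + (z - z) * g z)) := by
      have : ContinuousAt (fun lam => μ j k + (lam - z) * g lam) z :=
        continuousAt_const.add ((continuousAt_id.sub continuousAt_const).mul hg.continuousAt)
      exact this.tendsto.mono_left nhdsWithin_le_nhds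
    rw [sub_self, zero_mul, add_zero] at h0
    refine h0.congr' ?_
    filter_upwards [hM, self_mem_nhdsWithin] with lam hl hlz
    have : lam - z ≠ 0 := sub_ne_zero.2 hlz
    rw [hl]
    field_simp
  exact tendsto_nhds_unique t2 t1

theorem IsSpectralData.eventually_simple {N : Fin 2 → ℤ} {ρ μ : Fin 2 → ℤ → ℂ}
    (h : L.IsSpectralData N ρ μ) (ha : L.HasEigenvalueAsymptotics ρ) (j : Fin 2) :
    ∀ᶠ k in atTop, ρ j k ≠ 0 ∧ L.Δ (ρ j k ^ 2) = 0 ∧ deriv L.Δ (ρ j k ^ 2) ≠ 0 ∧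
      μ j k = L.Δ₀ (ρ j k ^ 2) / deriv L.Δ (ρ j k ^ 2) := by
  have hd : ∀ᶠ k in atTop, ρ j k ≠ 0 ∧ (L.Δ (ρ j k ^ 2) = 0 → deriv L.Δ (ρ j k ^ 2) ≠ 0) := by
    fin_cases j
    · exact L.eventually_deriv_ne_zero L.isStripLike_first ha.first'
    · exact L.eventually_deriv_ne_zero L.isStripLike_second ha.second'
  filter_upwards [hd, eventually_ge_atTop (N j)] with k hk hN
  have hz : L.Δ (ρ j k ^ 2) = 0 :=
    (L.isEigenvalue_iff _).1 ((h.eigenvalues _).2 ⟨j, k, hN, rfl⟩)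
  have h' := hk.2 hz
  exact ⟨hk.1, hz, h', (h.weyl_eq hN h').2⟩

/-- Asymptotics of the first Weyl sequence. -/
theorem IsSpectralData.weyl_first {N : Fin 2 → ℤ} {ρ μ : Fin 2 → ℤ → ℂ}
    (h : L.IsSpectralData N ρ μ) (ha : L.HasEigenvalueAsymptotics ρ) :
    (fun k : ℤ => μ 0 k / (2 / (L.a₁ ^ 2 * L.l₁)) - 1) =O[atTop] (fun k : ℤ => (1 / k : ℝ)) := by
  have hs := L.isStripLike_first
  have hw := ha.first'
  have hp := L.ωp_ne
  have hY := hs.seq_deriv hw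
  have hu := hs.seq_exp hw
  have hX := hs.seq_isBigO_of_strip hw L.exists_Δ₀_sub_le
  -- On this family −ω₋u tends to ω₊, so ω₊ − ω₋u tends to 2ω₊.
  have hX' : (fun k => (4 * L.a₁ * (exp (I * (ρ 0 k * L.g₁ + ρ 0 k * L.g₂)) *
      L.Δ₀ (ρ 0 k ^ 2))) / (2 * L.ωp) - 1) =O[atTop] fun k : ℤ => (1 / k : ℝ) := by
    refine ((hX.const_mul_left (2 * L.ωp)⁻¹).add (hu.const_mul_left 2⁻¹)).congr_left fun k => ?_
    field_simp
    ring
  refine (mul_sub_one_isBigO hX' (inv_sub_one_isBigO hY)).congr' ?_ EventuallyEq.rfl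
  filter_upwards [h.eventually_simple ha 0] with k ⟨hk0, hz, hd, hμ⟩
  rw [hμ, L.deriv_G hk0 ((L.G_eq_zero_iff hk0).2 hz), g₁]
  have := L.a₁_ne
  have := L.l₁_ne
  have := I_ne_zero
  have := exp_ne_zero (I * (ρ 0 k * (L.a₁ * L.l₁) + ρ 0 k * L.g₂))
  congr 1
  field_simp
  ring

/-- The phases of a₁, of e^{iθ₁} and of the factor i add up to φ₁ − φ₂ + π/2 = α. -/
theorem exp_g₁_modelRoot_second (k : ℤ) :
    exp (2 * I * L.g₁ * modelRoot L.g₂ (log (L.ωp / L.ωm)) 1 k) =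
      exp (2 * I * L.a₁ * L.l₁ * L.C₂) *
        exp ((2 * k * Real.pi * L.r₁ * L.l₁ / (L.r₂ * L.l₂) : ℝ) *
          (Real.cos L.α + I * Real.sin L.α)) := by
  rw [modelRoot_second, ← Complex.exp_add]
  have h1 := norm_mul_exp_arg_mul_I L.a₁
  have h2 : (Real.cos L.α : ℂ) + I * Real.sin L.α =
      exp (L.a₁.arg * I) * exp (I * L.θ₁) * I := by
    have e : exp ((L.α : ℂ) * I) = Real.cos L.α + I * Real.sin L.α := by
      rw [Complex.exp_mul_I, ofReal_cos, ofReal_sin, mul_comm I]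
    have e' : (L.α : ℂ) * I = L.a₁.arg * I + I * L.θ₁ + Real.pi / 2 * I := by
      rw [α, θ₁]
      push_cast
      ring
    rw [← e, e', Complex.exp_add, Complex.exp_add, Complex.exp_pi_div_two_mul_I]
  rw [h2, g₁]
  congr 1
  have h3 : L.a₁ = L.r₁ * exp (L.a₁.arg * I) := by rw [r₁]; exact h1.symm
  push_cast
  linear_combination (2 * I * L.l₁ * (k * Real.pi / (L.r₂ * L.l₂)) * exp (I * L.θ₁)) * h3

/-- Asymptotics of the second Weyl sequence. -/
theorem IsSpectralData.weyl_second {N : Fin 2 → ℤ} {ρ μ : Fin 2 → ℤ → ℂ}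
    (h : L.IsSpectralData N ρ μ) (ha : L.HasEigenvalueAsymptotics ρ) :
    (fun k : ℤ => μ 1 k / (8 / (L.ωm * L.ωp * L.l₂) * exp (2 * I * L.a₁ * L.l₁ * L.C₂) *
          exp ((2 * k * Real.pi * L.r₁ * L.l₁ / (L.r₂ * L.l₂) : ℝ) *
            (Real.cos L.α + I * Real.sin L.α))) - 1)
        =O[atTop] (fun k : ℤ => (1 / k : ℝ)) := by
  have hs := L.isStripLike_second
  have hw := ha.second'
  have hp := L.ωp_ne
  have hm := L.ωm_ne
  have hY := hs.seq_deriv hw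
  have hu := hs.seq_exp hw
  -- Here ω₋v tends to ω₊, so ω₊ − ω₋v, the main term of Δ₀, tends to 0, while ω₊ + ω₋v, that of
  -- φ(T), tends to 2ω₊.
  have hX := hs.seq_isBigO_of_strip hw L.exists_phiT_sub_le
  have hX' : (fun k => (4 * L.a₂ * (exp (I * (ρ 1 k * L.g₁ + ρ 1 k * L.g₂)) *
      L.phiT (ρ 1 k ^ 2))) / (2 * L.ωp) - 1) =O[atTop] fun k : ℤ => (1 / k : ℝ) := by
    refine ((hX.const_mul_left (2 * L.ωp)⁻¹).add (hu.const_mul_left 2⁻¹)).congr_left fun k => ?_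
    field_simp
    ring
  -- Replacing the root by its model inside u, which is exponentially small, costs only a relative
  -- error O(1/k).
  have hE := IsStripLike.exp_sub_one_isBigO (hw.const_mul_left (2 * I * L.g₁))
  refine (mul_sub_one_isBigO (mul_sub_one_isBigO hE hu)
    (mul_sub_one_isBigO (inv_sub_one_isBigO hX') (inv_sub_one_isBigO hY))).congr' ?_ EventuallyEq.rfl
  filter_upwards [h.eventually_simple ha 1] with k ⟨hk0, hz, hd, hμ⟩
  have hw := L.Δ₀_mul_phiT hz
  have hφ : L.phiT (ρ 1 k ^ 2) ≠ 0 := fun h0 => by simp [h0] at hw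
  have h0 : L.Δ₀ (ρ 1 k ^ 2) = 1 / L.phiT (ρ 1 k ^ 2) := by rw [eq_div_iff hφ, hw]
  have h1 := L.exp_g₁_modelRoot_second k
  have h2 := exp_ne_zero (2 * I * L.g₁ * modelRoot L.g₂ (log (L.ωp / L.ωm)) 1 k)
  have h3 : exp (I * (ρ 1 k * L.g₁ + ρ 1 k * L.g₂)) ^ 2 =
      exp (2 * I * L.g₁ * ρ 1 k) * exp (2 * I * (ρ 1 k * L.g₂)) := by
    rw [← Complex.exp_nat_mul, ← Complex.exp_add]; congr 1; push_cast; ring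
  rw [mul_assoc (8 / _), ← h1, hμ, h0, L.deriv_G hk0 ((L.G_eq_zero_iff hk0).2 hz), mul_sub,
    Complex.exp_sub]
  have := L.a₂_ne
  have := L.l₂_ne
  have := I_ne_zero
  have := exp_ne_zero (I * (ρ 1 k * L.g₁ + ρ 1 k * L.g₂))
  set E := exp (I * (ρ 1 k * L.g₁ + ρ 1 k * L.g₂))
  congr 1
  rw [show L.g₂ = L.a₂ * L.l₂ from rfl] at *
  field_simp
  rw [h3]
  ring_nf

variable (L)

theorem cos_α_neg : Real.cos L.α < 0 := by
  rw [α, Real.cos_add_pi_div_two]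
  linarith [L.sin_arg_sub_pos]

theorem tendsto_b {ρ : Fin 2 → ℤ → ℂ} (ha : L.HasEigenvalueAsymptotics ρ) :
    Tendsto (fun k : ℤ => -((k : ℂ) * Real.pi / (L.a₁ * ρ 0 k))) atTop (𝓝 (L.b : ℂ)) := by
  have h := (L.isStripLike_first.seq_div_tendsto ha.first').const_mul (-L.a₁⁻¹)
  have ha₁ := L.a₁_ne
  have e : -L.a₁⁻¹ * (((-1 : ℤ) : ℂ) * L.g₁) = L.b := by
    rw [g₁, l₁]; push_cast; field_simp
  rw [e] at h
  refine h.congr fun k => ?_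
  rw [← div_div, div_right_comm]
  ring

theorem tendsto_a₂ {ρ : Fin 2 → ℤ → ℂ} (ha : L.HasEigenvalueAsymptotics ρ) :
    Tendsto (fun k : ℤ => (k : ℂ) * Real.pi / ((L.T - L.b : ℝ) * ρ 1 k)) atTop (𝓝 L.a₂) := by
  have h := (L.isStripLike_second.seq_div_tendsto ha.second').const_mul ((L.l₂ : ℂ)⁻¹)
  have hl := L.l₂_ne
  have e : (L.l₂ : ℂ)⁻¹ * (((1 : ℤ) : ℂ) * L.g₂) = L.a₂ := by
    rw [g₂]; push_cast; field_simp
  rw [e] at h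
  refine h.congr fun k => ?_
  rw [← div_div, div_right_comm, l₂]
  ring

theorem tendsto_exp {ρ : Fin 2 → ℤ → ℂ} (ha : L.HasEigenvalueAsymptotics ρ) :
    Tendsto (fun k : ℤ => exp (2 * I * ρ 1 k * L.a₂ * L.l₂)) atTop (𝓝 (L.ωp / L.ωm)) := by
  have h := (tendsto_one_of_sub_one_isBigO
    (L.isStripLike_second.seq_exp ha.second')).const_mul (L.ωp / L.ωm)
  rw [mul_one] at h
  refine h.congr fun k => ?_
  have := L.ωp_ne
  have := L.ωm_ne
  rw [← mul_assoc]
  have e : L.ωp / L.ωm * (L.ωm / L.ωp) = 1 := by field_simp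
  rw [e, one_mul, g₂]
  congr 1
  ring

theorem ωp_div_ωm_ne_one : L.ωp / L.ωm ≠ 1 := by
  rw [Ne, div_eq_one_iff_eq L.ωm_ne, ωp, ωm]
  intro h
  have h1 : L.a₁ / L.d₁ ≠ 0 := div_ne_zero L.a₁_ne L.d₁_ne
  apply h1
  linear_combination h / 2

theorem d₁_eq_upperSqrt :
    L.d₁ = upperSqrt (L.a₁ * (L.ωp / L.ωm + 1) / (L.a₂ * (L.ωp / L.ωm - 1))) := by
  have h1 := L.a₁_ne
  have h2 := L.a₂_ne
  have h3 := L.d₁_ne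
  have h4 := L.ωm_ne
  -- The sum and the difference of ω₊ and ω₋ are 2d₁a₂ and 2a₁/d₁.
  have e : L.a₁ * (L.ωp / L.ωm + 1) / (L.a₂ * (L.ωp / L.ωm - 1)) = L.d₁ ^ 2 := by
    have e1 : L.ωp / L.ωm + 1 = 2 * (L.d₁ * L.a₂) / L.ωm := by
      field_simp; rw [ωp, ωm]; ring
    have e2 : L.ωp / L.ωm - 1 = 2 * (L.a₁ / L.d₁) / L.ωm := by
      field_simp; rw [ωp, ωm]; field_simp; ring
    rw [e1, e2]
    field_simp
  rw [e]
  have hsq : (L.d₁ ^ 2 : ℂ) ^ (1 / 2 : ℂ) = L.d₁ ∨ (L.d₁ ^ 2 : ℂ) ^ (1 / 2 : ℂ) = -L.d₁ :=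
    sq_eq_sq_iff_eq_or_eq_neg.1 (by simp)
  rw [upperSqrt]
  rcases hsq with h | h
  · rw [h, if_pos L.arg_d₁_nonneg]
  -- If d₁ and −d₁ both had nonnegative argument, d₁ would be positive real; but here −d₁ is a
  -- principal square root, with nonnegative real part.
  · have hneg : ¬ 0 ≤ (-L.d₁).arg := by
      intro h0
      have him1 := arg_nonneg_iff.1 h0
      have him2 := arg_nonneg_iff.1 L.arg_d₁_nonneg
      rw [neg_im] at him1
      have him : L.d₁.im = 0 := by linarith
      have hre : 0 < L.d₁.re := by
        rcases lt_trichotomy L.d₁.re 0 with h5 | h5 | h5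
        · exact absurd (arg_eq_pi_iff.2 ⟨h5, him⟩) L.arg_d₁_lt.ne
        · exact absurd (Complex.ext h5 him) L.d₁_ne
        · exact h5
      have h6 : 0 ≤ ((L.d₁ ^ 2 : ℂ) ^ (1 / 2 : ℂ)).re := by
        have h7 : (L.d₁ ^ 2 : ℂ) ^ (1 / 2 : ℂ) = exp (log (L.d₁ ^ 2) * (1 / 2 : ℂ)) :=
          Complex.cpow_def_of_ne_zero (pow_ne_zero 2 L.d₁_ne) _
        rw [h7, Complex.exp_re]
        refine mul_nonneg (Real.exp_pos _).le (Real.cos_nonneg_of_neg_pi_div_two_le_of_le ?_ ?_)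
        all_goals
          have h8 : (log (L.d₁ ^ 2) * (1 / 2 : ℂ)).im = (L.d₁ ^ 2).arg / 2 := by
            rw [show (1 / 2 : ℂ) = ((1 / 2 : ℝ) : ℂ) by push_cast; rfl, im_mul_ofReal, log_im]
            ring
          rw [h8]
          have := neg_pi_lt_arg (L.d₁ ^ 2)
          have := arg_le_pi (L.d₁ ^ 2)
          linarith
      rw [h, neg_re] at h6
      linarith
    rw [h, if_neg hneg, neg_neg]

theorem im_mul_g₁ (ρ : ℂ) : (ρ * L.g₁).im = (ρ * L.a₁).im * L.l₁ := by
  rw [g₁, ← mul_assoc, im_mul_ofReal]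

theorem norm_G (ρ : ℂ) : ‖L.G ρ‖ =
    4 / ‖ρ‖ * (Real.exp (ρ * L.g₁).im * Real.exp (ρ * L.g₂).im)⁻¹ * ‖L.Δ (ρ ^ 2)‖ := by
  rw [G, norm_mul, norm_mul, norm_exp_I_mul_add, norm_div, norm_mul, norm_I, mul_one]
  norm_num

/-- `Δ` has maximal growth in the region. -/
theorem exists_le_norm_Δ_of_mem_region {δ : ℝ} (hδ : 0 < δ) : ∃ c : ℝ, 0 < c ∧
    ∀ᶠ ρ in Bornology.cobounded ℂ, ρ ∈ L.region δ → c * (‖ρ‖ * L.growth ρ) ≤ ‖L.Δ (ρ ^ 2)‖ := by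
  obtain ⟨M, c₁, hc₁, h₁⟩ := L.exists_le_norm_Δ
  obtain ⟨K, z, hz, -, -, h₂⟩ := L.isStripLike_second.exists_roots
  obtain ⟨c₂, hc₂, h₂⟩ := h₂ M δ hδ
  refine ⟨min c₁ (c₂ / 4 * Real.exp (-(2 * M))), by positivity, ?_⟩
  have hl := L.l₁_pos
  filter_upwards [h₁, h₂, eventually_cobounded_ne_zero,
    eventually_cobounded_le_norm (M / (δ * L.l₁))] with ρ h₁ h₂ h0 hM ⟨hr, hr'⟩
  have hρ := norm_pos_iff.2 h0
  have hg := L.growth_pos ρ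
  have hA : δ * ‖ρ‖ * L.l₁ ≤ (ρ * L.g₁).im := by
    rw [im_mul_g₁]; exact mul_le_mul_of_nonneg_right hr hl.le
  have hA0 : 0 ≤ (ρ * L.g₁).im := le_trans (by positivity) hA
  rcases le_total M |(ρ * L.g₂).im| with hB | hB
  · refine le_trans (mul_le_mul_of_nonneg_right (min_le_left _ _) (by positivity)) (h₁ ?_ hB)
    rw [abs_of_nonneg hA0]
    rw [div_le_iff₀ (by positivity)] at hM
    linarith
  -- Inside the second strip the distance `δ` from the roots bounds |G| below; undoing the
  -- normalization gives the 4, and comparing Im B with |Im B| the factor e^{−2M}.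
  · refine le_trans (mul_le_mul_of_nonneg_right (min_le_right _ _) (by positivity)) ?_
    have h3 := h₂ hB hA0 fun k hk => hr' _ <| (L.isEigenvalue_iff _).2 <|
      (L.G_eq_zero_iff (hz k hk).1).1 (hz k hk).2
    rw [norm_G] at h3
    have h4 : Real.exp (-(2 * M)) * L.growth ρ ≤
        Real.exp (ρ * L.g₁).im * Real.exp (ρ * L.g₂).im := by
      rw [growth_eq, ← Real.exp_add, ← Real.exp_add, ← Real.exp_add, abs_of_nonneg hA0]
      exact Real.exp_le_exp.2 (by linarith [neg_abs_le (ρ * L.g₂).im])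
    have h5 : 0 < Real.exp (ρ * L.g₁).im * Real.exp (ρ * L.g₂).im := by positivity
    set X := Real.exp (ρ * L.g₁).im * Real.exp (ρ * L.g₂).im
    have h6 : c₂ / 4 * ‖ρ‖ * X ≤ ‖L.Δ (ρ ^ 2)‖ := by
      have h7 := mul_le_mul_of_nonneg_left h3 (show 0 ≤ ‖ρ‖ * X / 4 by positivity)
      have e : ‖ρ‖ * X / 4 * (4 / ‖ρ‖ * X⁻¹ * ‖L.Δ (ρ ^ 2)‖) = ‖L.Δ (ρ ^ 2)‖ := by
        field_simp
      rw [e] at h7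
      linarith
    calc _ = c₂ / 4 * ‖ρ‖ * (Real.exp (-(2 * M)) * L.growth ρ) := by ring
      _ ≤ c₂ / 4 * ‖ρ‖ * X := by gcongr
      _ ≤ _ := h6

/-- The main parts combine to (iρ/2)(ω₊e^{i(A+B)} − ω₋e^{i(A−B)}). The factor e^{−Im A} is at most 1
and |ρ| is absorbed by e^{Im A}, because Im A ≥ δl₁|ρ| in the region. -/
theorem exists_norm_sub_le_of_mem_region {δ : ℝ} (hδ : 0 < δ) : ∃ C : ℝ,
    ∀ᶠ ρ in Bornology.cobounded ℂ, ρ ∈ L.region δ →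
      ‖I * ρ * L.a₁ * L.Δ₀ (ρ ^ 2) - L.Δ (ρ ^ 2)‖ ≤ C * L.growth ρ := by
  obtain ⟨C₁, h₁⟩ := L.Δ₀_asymptotics'.bound
  obtain ⟨C₂, h₂⟩ := L.Δ_asymptotics'.bound
  have hl := L.l₁_pos
  refine ⟨‖L.a₁‖ * C₁ + C₂ + (‖L.ωp‖ + ‖L.ωm‖) / (2 * (δ * L.l₁)), ?_⟩
  filter_upwards [h₁, h₂, eventually_cobounded_ne_zero] with ρ h₁ h₂ h0 ⟨hr, _⟩
  have hρ := norm_pos_iff.2 h0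
  have hg := L.growth_pos ρ
  have hA : δ * ‖ρ‖ * L.l₁ ≤ (ρ * L.g₁).im := by
    rw [im_mul_g₁]; exact mul_le_mul_of_nonneg_right hr hl.le
  have hA0 : 0 ≤ (ρ * L.g₁).im := le_trans (by positivity) hA
  rw [Real.norm_of_nonneg (by positivity)] at h₁
  rw [Real.norm_of_nonneg hg.le] at h₂
  rw [growth_eq] at h₁ h₂ ⊢
  rw [abs_of_nonneg hA0] at h₁ h₂ ⊢
  set A := ρ * L.g₁
  set B := ρ * L.g₂
  set X := Real.exp A.im * Real.exp |B.im| with hX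
  have hX0 : 0 < X := by positivity
  have ha₁ := L.a₁_ne
  have key : I * ρ * L.a₁ * L.Δ₀ (ρ ^ 2) - L.Δ (ρ ^ 2) =
      I * ρ * L.a₁ * (L.Δ₀ (ρ ^ 2) - (2 * L.a₁)⁻¹ *
        (L.ωp * cos (A + B) + -L.ωm * cos (A - B))) -
      (L.Δ (ρ ^ 2) - ρ / 2 * (L.ωp * sin (A + B) + L.ωm * sin (B - A))) +
      I * ρ / 2 * (L.ωp * exp ((A + B) * I) - L.ωm * exp ((A - B) * I)) := by
    rw [Complex.exp_mul_I, Complex.exp_mul_I, ← neg_sub A B, Complex.sin_neg]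
    field_simp
    linear_combination (-ρ * (L.ωp * sin (A + B) - L.ωm * sin (A - B))) * I_sq
  rw [key]
  refine (norm_add_le _ _).trans ?_
  rw [add_mul _ _ X]
  refine add_le_add (le_trans (norm_sub_le _ _) ?_) ?_
  · rw [add_mul _ _ X]
    refine add_le_add ?_ h₂
    rw [norm_mul, norm_mul, norm_mul, norm_I, one_mul]
    calc _ ≤ ‖ρ‖ * ‖L.a₁‖ * (C₁ * (X / ‖ρ‖)) := by gcongr
      _ = _ := by field_simp
  · have e1 : ∀ z : ℂ, z.im = A.im + B.im ∨ z.im = A.im - B.im →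
        ‖exp (z * I)‖ ≤ Real.exp (-A.im) * Real.exp |B.im| := fun z hz => by
      rw [Complex.norm_exp, ← Real.exp_add]
      refine Real.exp_le_exp.2 ?_
      have : (z * I).re = -z.im := by simp
      rw [this]
      rcases hz with hz | hz <;> rw [hz] <;> linarith [neg_abs_le B.im, le_abs_self B.im]
    have e2 := e1 (A + B) (Or.inl (add_im _ _))
    have e3 := e1 (A - B) (Or.inr (sub_im _ _))
    have e4 : ‖ρ‖ * (Real.exp (-A.im) * Real.exp |B.im|) ≤ X / (δ * L.l₁) := by
      rw [le_div_iff₀ (by positivity), hX]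
      have e5 : ‖ρ‖ * (δ * L.l₁) ≤ Real.exp A.im := by linarith [Real.add_one_le_exp A.im]
      have e6 : Real.exp (-A.im) ≤ 1 := Real.exp_le_one_iff.2 (by linarith)
      calc _ = ‖ρ‖ * (δ * L.l₁) * (Real.exp (-A.im) * Real.exp |B.im|) := by ring
        _ ≤ Real.exp A.im * (1 * Real.exp |B.im|) := by gcongr
        _ = _ := by ring
    calc _ ≤ ‖ρ‖ / 2 * (‖L.ωp‖ * (Real.exp (-A.im) * Real.exp |B.im|) +
          ‖L.ωm‖ * (Real.exp (-A.im) * Real.exp |B.im|)) := by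
          rw [norm_mul]
          have : ‖I * ρ / 2‖ = ‖ρ‖ / 2 := by simp
          rw [this]
          refine mul_le_mul_of_nonneg_left ((norm_sub_le _ _).trans ?_) (by positivity)
          rw [norm_mul, norm_mul]
          gcongr
      _ = (‖L.ωp‖ + ‖L.ωm‖) / 2 * (‖ρ‖ * (Real.exp (-A.im) * Real.exp |B.im|)) := by ring
      _ ≤ (‖L.ωp‖ + ‖L.ωm‖) / 2 * (X / (δ * L.l₁)) := by gcongr
      _ = _ := by field_simp

/-- Recovery of `a₁` from the Weyl function. -/
theorem tendsto_a₁ {δ : ℝ} (hδ : 0 < δ) : Tendsto (fun ρ : ℂ => (I * ρ * L.M (ρ ^ 2))⁻¹)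
    (Bornology.cobounded ℂ ⊓ 𝓟 (L.region δ)) (𝓝 L.a₁) := by
  obtain ⟨c, hc, h₁⟩ := L.exists_le_norm_Δ_of_mem_region hδ
  obtain ⟨C, h₂⟩ := L.exists_norm_sub_le_of_mem_region hδ
  have ha₁ := L.a₁_ne
  have ev : ∀ᶠ ρ in Bornology.cobounded ℂ ⊓ 𝓟 (L.region δ),
      ‖I * ρ * L.M (ρ ^ 2) * L.a₁ - 1‖ ≤ C / c * ‖ρ‖⁻¹ := by
    rw [eventually_inf_principal]
    filter_upwards [h₁, h₂, eventually_cobounded_ne_zero] with ρ h₁ h₂ h0 hr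
    have hρ := norm_pos_iff.2 h0
    have hg := L.growth_pos ρ
    have h3 := h₁ hr
    have h4 : 0 < ‖L.Δ (ρ ^ 2)‖ := lt_of_lt_of_le (by positivity) h3
    have h5 : L.Δ (ρ ^ 2) ≠ 0 := norm_pos_iff.1 h4
    have e : I * ρ * L.M (ρ ^ 2) * L.a₁ - 1 =
        (I * ρ * L.a₁ * L.Δ₀ (ρ ^ 2) - L.Δ (ρ ^ 2)) / L.Δ (ρ ^ 2) := by
      rw [L.M_eq h5]; field_simp
    rw [e, norm_div, div_le_iff₀ h4]
    have hC : 0 ≤ C := by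
      have := (norm_nonneg _).trans (h₂ hr)
      exact nonneg_of_mul_nonneg_left this hg
    calc _ ≤ C * L.growth ρ := h₂ hr
      _ = C / c * ‖ρ‖⁻¹ * (c * (‖ρ‖ * L.growth ρ)) := by field_simp
      _ ≤ _ := by gcongr
  have h0 : Tendsto (fun ρ : ℂ => C / c * ‖ρ‖⁻¹) (Bornology.cobounded ℂ ⊓ 𝓟 (L.region δ))
      (𝓝 0) := by
    have := (tendsto_inv_atTop_zero.comp (tendsto_norm_cobounded_atTop (E := ℂ))).const_mul (C / c)
    rw [mul_zero] at this
    exact this.mono_left inf_le_left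
  have h1 : Tendsto (fun ρ : ℂ => I * ρ * L.M (ρ ^ 2) * L.a₁)
      (Bornology.cobounded ℂ ⊓ 𝓟 (L.region δ)) (𝓝 1) := by
    have := (squeeze_zero_norm' ev h0).add_const 1
    simpa using this
  have h2 := (h1.inv₀ one_ne_zero).mul_const L.a₁
  rw [inv_one, one_mul] at h2
  refine h2.congr fun ρ => ?_
  rw [mul_inv (I * ρ * L.M (ρ ^ 2)), mul_assoc, inv_mul_cancel₀ ha₁, mul_one]

end ComplexWeightBVP

/-! ### Inserting the finitely many remaining eigenvalues -/

section Arrangement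

theorem exists_sq_eq (lam : ℂ) : ∃ ρ : ℂ, ρ ^ 2 = lam := ⟨lam ^ (1 / 2 : ℂ), by simp⟩

/-- Two sequences of square roots, whose squares are distinct and of multiplicity one, can be
completed by finitely many terms to exhaust a multiset of complex numbers. -/
theorem exists_arrangement {m : ℂ → ℕ} {K : ℤ} {z : Fin 2 → ℤ → ℂ}
    (hinj : ∀ j k j' k', K ≤ k → K ≤ k' → z j k ^ 2 = z j' k' ^ 2 → j = j' ∧ k = k')
    (hone : ∀ j k, K ≤ k → m (z j k ^ 2) = 1)
    (hfin : {lam | m lam ≠ 0 ∧ ∀ j k, K ≤ k → z j k ^ 2 ≠ lam}.Finite) :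
    ∃ (N : Fin 2 → ℤ) (ρ : Fin 2 → ℤ → ℂ), (∀ j k, K ≤ k → ρ j k = z j k) ∧
      ∀ lam, ∃ e : Fin (m lam) → Fin 2 × ℤ, Function.Injective e ∧
        Set.range e = {p | N p.1 ≤ p.2 ∧ ρ p.1 p.2 ^ 2 = lam} := by
  set S := {lam | m lam ≠ 0 ∧ ∀ j k, K ≤ k → z j k ^ 2 ≠ lam} with hS
  have : Finite S := hfin
  let Φ := Finite.equivFin (Σ lam : S, Fin (m lam))
  set n := Nat.card (Σ lam : S, Fin (m lam)) with hn
  choose sqrt hsqrt using exists_sq_eq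
  let w : ℕ → ℂ := fun i => if h : i < n then sqrt (Φ.symm ⟨i, h⟩).1 else 0
  have hw : ∀ i (h : i < n), w i ^ 2 = (Φ.symm ⟨i, h⟩).1 := fun i h => by
    simp only [w, dif_pos h, hsqrt]
  -- The `n` leftover copies, counted with multiplicity, fill the indices K − n, …, K − 1 of the
  -- first sequence; the default value of `w` is never reached there.
  let N : Fin 2 → ℤ := fun j => if j = 0 then K - n else K
  let ρ : Fin 2 → ℤ → ℂ := fun j k => if K ≤ k then z j k else w (k - (K - n)).toNat
  have hρ : ∀ j k, K ≤ k → ρ j k = z j k := fun j k hk => if_pos hk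
  have hρ' : ∀ j k, ¬ K ≤ k → ρ j k = w (k - (K - n)).toNat := fun j k hk => if_neg hk
  have hlow : ∀ p : Fin 2 × ℤ, N p.1 ≤ p.2 → ¬ K ≤ p.2 →
      p.1 = 0 ∧ K - n ≤ p.2 ∧ (p.2 - (K - n)).toNat < n := fun p hp hK => by
    by_cases h0 : p.1 = 0
    · simp only [N, h0, if_true] at hp
      exact ⟨h0, hp, by omega⟩
    · simp only [N, h0, if_false] at hp
      exact absurd hp hK
  refine ⟨N, ρ, hρ, fun lam => ?_⟩
  by_cases hlam : lam ∈ S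
  · let idx : Fin (m lam) → Fin n := fun ν => Φ ⟨⟨lam, hlam⟩, ν⟩
    have hidx : Function.Injective idx := fun ν ν' h => by
      have := Φ.injective h
      simpa using this
    have hlt : ∀ ν, ¬ K ≤ K - (n : ℤ) + (idx ν : ℕ) := fun ν => by
      have := (idx ν).2
      omega
    refine ⟨fun ν => (0, K - n + (idx ν : ℕ)), fun ν ν' h => hidx (Fin.ext ?_), ?_⟩
    · simp only [Prod.mk.injEq, true_and] at h
      omega
    · ext ⟨j, k⟩
      simp only [Set.mem_range, Set.mem_ofPred_eq, Prod.mk.injEq]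
      constructor
      · rintro ⟨ν, rfl, rfl⟩
        refine ⟨by simp [N], ?_⟩
        have e : (K - (n : ℤ) + (idx ν : ℕ) - (K - n)).toNat = (idx ν : ℕ) := by omega
        rw [hρ' _ _ (hlt ν), e, hw _ (idx ν).2]
        simp [idx]
      · rintro ⟨hN, hk⟩
        have hK : ¬ K ≤ k := fun hK => hlam.2 j k hK (by rw [← hρ j k hK, hk])
        obtain ⟨hj, h1, h2⟩ := hlow (j, k) hN hK
        dsimp only at hj h1 h2
        rw [hρ' _ _ hK, hw _ h2] at hk
        obtain ⟨ν, hν⟩ : ∃ ν, idx ν = ⟨(k - (K - n)).toNat, h2⟩ := by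
          rcases hs : Φ.symm ⟨(k - (K - n)).toNat, h2⟩ with ⟨⟨lam', hlam'⟩, ν⟩
          rw [hs] at hk
          dsimp only at hk
          subst hk
          exact ⟨ν, by rw [← Equiv.eq_symm_apply]; exact hs.symm⟩
        refine ⟨ν, hj.symm, ?_⟩
        rw [hν]
        dsimp only
        omega
  · have hlow' : ∀ p : Fin 2 × ℤ, N p.1 ≤ p.2 → ρ p.1 p.2 ^ 2 = lam → K ≤ p.2 := fun p hp hpl => by
      by_contra hK
      obtain ⟨-, -, h2⟩ := hlow p hp hK
      rw [hρ' _ _ hK, hw _ h2] at hpl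
      exact hlam (hpl ▸ Subtype.coe_prop _)
    by_cases hex : ∃ j k, K ≤ k ∧ z j k ^ 2 = lam
    · obtain ⟨j, k, hk, rfl⟩ := hex
      refine ⟨fun _ => (j, k), fun ν ν' _ => ?_, ?_⟩
      · have := hone j k hk
        have := ν.2
        have := ν'.2
        exact Fin.ext (by omega)
      · have : Nonempty (Fin (m (z j k ^ 2))) := by rw [hone j k hk]; infer_instance
        rw [Set.range_const]
        ext p
        simp only [Set.mem_singleton_iff, Set.mem_ofPred_eq]
        constructor
        · rintro rfl
          refine ⟨?_, by rw [hρ j k hk]⟩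
          simp only [N]
          split_ifs <;> omega
        · rintro ⟨h1, h2⟩
          have h3 := hlow' p h1 h2
          rw [hρ _ _ h3] at h2
          have := hinj _ _ _ _ h3 hk h2
          exact Prod.ext this.1 this.2
    · push Not at hex
      have hm : m lam = 0 := by
        by_contra h0
        exact hlam ⟨h0, hex⟩
      have : IsEmpty (Fin (m lam)) := by rw [hm]; infer_instance
      refine ⟨isEmptyElim, Function.injective_of_subsingleton _, ?_⟩
      rw [Set.range_eq_empty]
      ext p
      simp only [Set.mem_empty_iff_false, Set.mem_ofPred_eq, false_iff, not_and]
      intro h1 h2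
      have h3 := hlow' p h1 h2
      exact hex _ _ h3 (by rw [← hρ _ _ h3, h2])

end Arrangement

/-! ### Principal parts of quotients -/

section PrincipalPart

/-- Induction on the pole order: f(x) = f(z) + (x − z)·`dslope f z x` splits off the coefficient of
highest order. -/
theorem exists_principal_part {f : ℂ → ℂ} {z : ℂ} (hf : AnalyticAt ℂ f z) (m : ℕ) :
    ∃ (c : ℕ → ℂ) (g : ℂ → ℂ), AnalyticAt ℂ g z ∧ ∀ x, x ≠ z →
      f x / (x - z) ^ m = ∑ ν ∈ Finset.range m, c ν / (x - z) ^ (ν + 1) + g x := by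
  induction m generalizing f with
  | zero => exact ⟨0, f, hf, fun x _ => by simp⟩
  | succ m ih =>
    obtain ⟨p, hp⟩ := hf
    obtain ⟨c, g, hg, h⟩ := ih (f := dslope f z) ⟨_, hp.has_fpower_series_dslope_fslope⟩
    refine ⟨Function.update c m (f z), g, hg, fun x hx => ?_⟩
    have hxz : x - z ≠ 0 := sub_ne_zero.2 hx
    have h1 : ∑ ν ∈ Finset.range m, Function.update c m (f z) ν / (x - z) ^ (ν + 1) =
        ∑ ν ∈ Finset.range m, c ν / (x - z) ^ (ν + 1) :=
      Finset.sum_congr rfl fun ν hν => by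
        rw [Function.update_of_ne (Finset.mem_range.1 hν).ne]
    rw [Finset.sum_range_succ, h1, Function.update_self, add_right_comm, ← h x hx]
    have h2 := sub_smul_dslope f z x
    rw [smul_eq_mul] at h2
    have h3 : f x = f z + (x - z) * dslope f z x := by rw [h2]; ring
    rw [h3]
    field_simp
    ring

end PrincipalPart

/-! ### Distinctness of the squared roots -/

namespace IsStripLike

variable {G : ℂ → ℂ} {g g' κ ω ℓ : ℂ} {σ : ℤ} {w : ℤ → ℂ}

/-- Equal roots are excluded since model roots are π/‖g‖ apart while displacements are below
π/(4‖g‖); opposite roots are excluded since Im(ρg') ≥ 1 for both. -/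
theorem eventually_sq_injective (h : IsStripLike G g g' κ ω ℓ σ)
    (hw : (fun k => w k - modelRoot g ℓ σ k) =O[atTop] fun k : ℤ => (1 / k : ℝ)) :
    ∃ K : ℤ, ∀ k k', K ≤ k → K ≤ k' → w k ^ 2 = w k' ^ 2 → k = k' := by
  have hg := norm_pos_iff.2 h.g_ne
  obtain ⟨M, hM⟩ := h.seq_strip hw 1
  have hε : 0 < Real.pi / (4 * ‖g‖) := by positivity
  have h0 := (tendsto_zero_iff_norm_tendsto_zero.1
    (hw.trans_tendsto tendsto_one_div_intCast)).eventually_lt_const hε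
  obtain ⟨K, hK⟩ := eventually_atTop.1 (hM.and h0)
  refine ⟨K, fun k k' hk hk' he => ?_⟩
  obtain ⟨⟨-, -, h1⟩, h2⟩ := hK k hk
  obtain ⟨⟨-, -, h1'⟩, h2'⟩ := hK k' hk'
  rcases sq_eq_sq_iff_eq_or_eq_neg.1 he with he | he
  · have e : modelRoot g ℓ σ k - modelRoot g ℓ σ k' = (σ * (k - k') * Real.pi) / g := by
      rw [modelRoot, modelRoot]; ring
    have hσ : ‖(σ : ℂ)‖ = 1 := by
      have h3 : ‖(σ : ℂ)‖ * ‖(σ : ℂ)‖ = 1 := by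
        rw [← norm_mul, ← Int.cast_mul, h.σ_sq, Int.cast_one, norm_one]
      nlinarith [norm_nonneg (σ : ℂ)]
    have h3 : ‖modelRoot g ℓ σ k - modelRoot g ℓ σ k'‖ < Real.pi / (2 * ‖g‖) := by
      have e2 : modelRoot g ℓ σ k - modelRoot g ℓ σ k' =
          (w k' - modelRoot g ℓ σ k') - (w k - modelRoot g ℓ σ k) := by rw [he]; ring
      rw [e2]
      refine (norm_sub_le _ _).trans_lt ?_
      have : Real.pi / (2 * ‖g‖) = Real.pi / (4 * ‖g‖) + Real.pi / (4 * ‖g‖) := by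
        field_simp; norm_num
      linarith
    have h4 : ‖((k : ℂ) - k')‖ = |((k - k' : ℤ) : ℝ)| := by
      rw [← Int.cast_sub, Complex.norm_intCast]
    rw [e, norm_div, norm_mul, norm_mul, hσ, one_mul, h4, Complex.norm_real, Real.norm_eq_abs,
      abs_of_pos Real.pi_pos, div_lt_div_iff₀ hg (by positivity)] at h3
    have h5 : |((k - k' : ℤ) : ℝ)| < 1 := by
      have : 0 < Real.pi * ‖g‖ := by positivity
      nlinarith
    have h6 : |k - k'| < 1 := by exact_mod_cast h5
    rw [Int.abs_lt_one_iff] at h6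
    omega
  · rw [he, neg_mul, neg_im] at h1
    linarith

end IsStripLike

/-- One family has |Im ρg| ≤ M, the other eventually Im ρg ≥ M + 1, so they differ even up to sign.
-/
theorem eventually_sq_ne {G : ℂ → ℂ} {g g' κ ω ℓ κ' ω' ℓ' : ℂ} {σ σ' : ℤ} {w w' : ℤ → ℂ}
    (h : IsStripLike G g g' κ ω ℓ σ) (h' : IsStripLike G g' g κ' ω' ℓ' σ')
    (hw : (fun k => w k - modelRoot g ℓ σ k) =O[atTop] fun k : ℤ => (1 / k : ℝ))
    (hw' : (fun k => w' k - modelRoot g' ℓ' σ' k) =O[atTop] fun k : ℤ => (1 / k : ℝ)) :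
    ∃ K : ℤ, ∀ k k', K ≤ k → K ≤ k' → w k ^ 2 ≠ w' k' ^ 2 := by
  obtain ⟨M, hM⟩ := h.seq_strip hw 0
  obtain ⟨M', hM'⟩ := h'.seq_strip hw' (M + 1)
  obtain ⟨K, hK⟩ := eventually_atTop.1 (hM.and hM')
  refine ⟨K, fun k k' hk hk' he => ?_⟩
  have h1 := abs_le.1 (hK k hk).1.2.1
  have h2 := (hK k' hk').2.2.2
  rcases sq_eq_sq_iff_eq_or_eq_neg.1 he with he | he
  · rw [he] at h1
    linarith
  · rw [he, neg_mul, neg_im] at h1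
    linarith

/-! ### Completeness of the two families and construction of the spectral data -/

namespace ComplexWeightBVP

variable (L : ComplexWeightBVP)

/-- By the identity theorem Δ would vanish identically, contradicting the nonzero derivative at
zeros far along the first family. -/
theorem analyticOrderAt_Δ_ne_top (z : ℂ) : analyticOrderAt L.Δ z ≠ ⊤ := by
  rw [Ne, analyticOrderAt_eq_top]
  intro h
  have h0 : AnalyticOnNhd ℂ L.Δ Set.univ := fun x _ => L.analyticAt_Δ x
  have h1 := h0.eqOn_zero_of_preconnected_of_eventuallyEq_zero isPreconnected_univ
    (Set.mem_univ z) h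
  have h2 : L.Δ = fun _ => 0 := funext fun x => h1 (Set.mem_univ x)
  obtain ⟨K, w, -, hw, -⟩ := L.isStripLike_first.exists_roots
  obtain ⟨k, hk⟩ := (L.eventually_deriv_ne_zero L.isStripLike_first hw).exists
  exact hk.2 (by rw [h2]) (by rw [h2, deriv_const])

theorem mult_ne_zero_iff (z : ℂ) : L.mult z ≠ 0 ↔ L.Δ z = 0 := by
  rw [← (L.analyticAt_Δ z).analyticOrderAt_ne_zero, mult, analyticOrderNatAt, Ne, Ne,
    ENat.toNat_eq_zero]
  simp [L.analyticOrderAt_Δ_ne_top z]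

theorem finite_zeros_of_norm_le (R : ℝ) : {lam : ℂ | L.Δ lam = 0 ∧ ‖lam‖ ≤ R}.Finite := by
  by_contra hinf
  obtain ⟨z, -, hz⟩ := Set.Infinite.exists_accPt_of_subset_isCompact hinf
    (isCompact_closedBall (0 : ℂ) R) fun lam hlam => by simpa using hlam.2
  rw [accPt_iff_frequently_nhdsNE] at hz
  have h1 := (L.analyticAt_Δ z).frequently_zero_iff_eventually_zero.1 (hz.mono fun x hx => hx.1)
  exact L.analyticOrderAt_Δ_ne_top z (analyticOrderAt_eq_top.2 h1)

/-- The two families of roots and the finitely many remaining zeros of `Δ`. -/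
theorem exists_root_families : ∃ (K : ℤ) (z : Fin 2 → ℤ → ℂ), L.HasEigenvalueAsymptotics z ∧
    (∀ j k j' k', K ≤ k → K ≤ k' → z j k ^ 2 = z j' k' ^ 2 → j = j' ∧ k = k') ∧
    (∀ j k, K ≤ k → L.mult (z j k ^ 2) = 1) ∧
    {lam | L.mult lam ≠ 0 ∧ ∀ j k, K ≤ k → z j k ^ 2 ≠ lam}.Finite := by
  have hs := L.isStripLike_first
  have hs' := L.isStripLike_second
  obtain ⟨K₁, w, hwG, hw, hcls, -⟩ := hs.exists_roots
  obtain ⟨K₂, w', hwG', hw', hcls', -⟩ := hs'.exists_roots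
  obtain ⟨K₃, hK₃⟩ := hs.eventually_sq_injective hw
  obtain ⟨K₄, hK₄⟩ := hs'.eventually_sq_injective hw'
  obtain ⟨K₅, hK₅⟩ := eventually_sq_ne hs hs' hw hw'
  obtain ⟨K₆, hK₆⟩ := eventually_atTop.1
    ((L.eventually_deriv_ne_zero hs hw).and (L.eventually_deriv_ne_zero hs' hw'))
  obtain ⟨K, h₁, h₂, h₃, h₄, h₅, h₆⟩ : ∃ K : ℤ, K₁ ≤ K ∧ K₂ ≤ K ∧ K₃ ≤ K ∧ K₄ ≤ K ∧ K₅ ≤ K ∧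
      K₆ ≤ K :=
    ⟨max K₁ (max K₂ (max K₃ (max K₄ (max K₅ K₆)))), by simp⟩
  refine ⟨K, ![w, w'], ⟨by simpa [modelRoot_first] using hw, by simpa [modelRoot_second] using hw'⟩,
    ?_, ?_, ?_⟩
  · intro j k j' k' hk hk' he
    fin_cases j <;> fin_cases j' <;> simp at he ⊢
    · exact hK₃ k k' (by omega) (by omega) he
    · exact hK₅ k k' (by omega) (by omega) he
    · exact hK₅ k' k (by omega) (by omega) he.symm
    · exact hK₄ k k' (by omega) (by omega) he
  · intro j k hk
    have hk6 := hK₆ k (by omega)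
    fin_cases j
    · have h0 := hwG k (by omega)
      have h1 := (L.G_eq_zero_iff h0.1).1 h0.2
      exact L.mult_eq_one h1 (hk6.1.2 h1)
    · have h0 := hwG' k (by omega)
      have h1 := (L.G_eq_zero_iff h0.1).1 h0.2
      exact L.mult_eq_one h1 (hk6.2.2 h1)
  · obtain ⟨M, c, hc, hM⟩ := L.exists_le_norm_Δ
    obtain ⟨R, hR⟩ := eventually_cobounded_iff.1
      (((hM.and (hcls M K)).and (hcls' M K)).and eventually_cobounded_ne_zero)
    refine (L.finite_zeros_of_norm_le (max R 0 ^ 2)).subset fun lam hlam => ?_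
    obtain ⟨hm, hlam⟩ := hlam
    rw [mult_ne_zero_iff] at hm
    refine ⟨hm, ?_⟩
    by_contra! hlt
    obtain ⟨ρ, rfl⟩ := exists_sq_eq lam
    rw [norm_pow] at hlt
    have hρR : R ≤ ‖ρ‖ := (le_max_left _ _).trans (lt_of_pow_lt_pow_left₀ 2 (norm_nonneg _) hlt).le
    have hρ := hR ρ hρR
    have hρ' := hR (-ρ) (by rwa [norm_neg])
    have hG : L.G ρ = 0 := (L.G_eq_zero_iff hρ.2).2 hm
    have hG' : L.G (-ρ) = 0 := (L.G_eq_zero_iff hρ'.2).2 (by rwa [neg_sq])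
    have habs : ∀ g : ℂ, |(-ρ * g).im| = |(ρ * g).im| := fun g => by rw [neg_mul, neg_im, abs_neg]
    have hsgn : ∀ g : ℂ, 0 ≤ (ρ * g).im ∨ 0 ≤ (-ρ * g).im := fun g => by
      rw [neg_mul, neg_im, neg_nonneg]; exact le_total _ _
    have hj : ∀ j k, K ≤ k → ρ ^ 2 = ![w, w'] j k ^ 2 → False := fun j k hk he => hlam j k hk he.symm
    -- A large zero off both strips contradicts the lower bound for Δ; in a strip, ρ or −ρ lies in
    -- the half-strip whose zeros are already listed.
    rcases le_total M |(ρ * L.g₁).im| with h1 | h1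
    · rcases le_total M |(ρ * L.g₂).im| with h2 | h2
      · have h3 := hρ.1.1.1 h1 h2
        rw [hm, norm_zero] at h3
        have := L.growth_pos ρ
        have := norm_pos_iff.2 hρ.2
        have : 0 < c * (‖ρ‖ * L.growth ρ) := by positivity
        linarith
      · rcases hsgn L.g₁ with h3 | h3
        · obtain ⟨k, hk, he⟩ := hρ.1.2 h2 h3 hG
          exact hj 1 k hk (by rw [he]; rfl)
        · obtain ⟨k, hk, he⟩ := hρ'.1.2 (by rwa [habs]) h3 hG'
          exact hj 1 k hk (by rw [← neg_sq, he]; rfl)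
    · rcases hsgn L.g₂ with h3 | h3
      · obtain ⟨k, hk, he⟩ := hρ.1.1.2 h1 h3 hG
        exact hj 0 k hk (by rw [he]; rfl)
      · obtain ⟨k, hk, he⟩ := hρ'.1.1.2 (by rwa [habs]) h3 hG'
        exact hj 0 k hk (by rw [← neg_sq, he]; rfl)

theorem exists_principal_part_M (z : ℂ) : ∃ (c : ℕ → ℂ) (g : ℂ → ℂ), AnalyticAt ℂ g z ∧
    ∀ᶠ lam in 𝓝[≠] z, L.M lam =
      ∑ ν : Fin (L.mult z), c ν / (lam - z) ^ ((ν : ℕ) + 1) + g lam := by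
  obtain ⟨u, hu, hu0, h⟩ := (L.analyticAt_Δ z).analyticOrderAt_ne_top.1
    (L.analyticOrderAt_Δ_ne_top z)
  have hf : AnalyticAt ℂ (fun x => L.Δ₀ x / u x) z :=
    (L.differentiable_Δ₀.analyticAt z).div hu hu0
  obtain ⟨c, g, hg, hc⟩ := exists_principal_part hf (L.mult z)
  refine ⟨c, g, hg, ?_⟩
  filter_upwards [h.filter_mono nhdsWithin_le_nhds,
    (hu.continuousAt.eventually_ne hu0).filter_mono nhdsWithin_le_nhds, self_mem_nhdsWithin]
    with x hx hux hxz
  have h1 : x - z ≠ 0 := sub_ne_zero.2 hxz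
  rw [smul_eq_mul] at hx
  have h2 : L.Δ x ≠ 0 := by rw [hx]; exact mul_ne_zero (pow_ne_zero _ h1) hux
  rw [Finset.sum_fin_eq_sum_range, L.M_eq h2, hx]
  have h3 := hc x hxz
  rw [div_div, mul_comm] at h3
  refine h3.trans ?_
  congr 1
  exact Finset.sum_congr rfl fun ν hν => by rw [dif_pos (Finset.mem_range.1 hν)]

theorem exists_isSpectralData : ∃ (N : Fin 2 → ℤ) (ρ μ : Fin 2 → ℤ → ℂ),
    L.IsSpectralData N ρ μ ∧ L.HasEigenvalueAsymptotics ρ := by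
  obtain ⟨K, z, hz, hinj, hone, hfin⟩ := L.exists_root_families
  obtain ⟨N, ρ, hρ, he⟩ := exists_arrangement hinj hone hfin
  choose e he hr using he
  choose c g hg hM using L.exists_principal_part_M
  have hmem : ∀ lam ν, N (e lam ν).1 ≤ (e lam ν).2 ∧ ρ (e lam ν).1 (e lam ν).2 ^ 2 = lam :=
    fun lam ν => by
      have : e lam ν ∈ Set.range (e lam) := ⟨ν, rfl⟩
      rwa [hr lam] at this
  let E : (Σ lam, Fin (L.mult lam)) → Fin 2 × ℤ := fun s => e s.1 s.2
  -- An index determines its eigenvalue and its copy, so the principal part coefficients can be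
  -- carried over to the indices; unused indices get 0.
  have hE : Function.Injective E := by
    rintro ⟨lam, ν⟩ ⟨lam', ν'⟩ h
    dsimp only [E] at h
    obtain rfl : lam = lam' := by rw [← (hmem lam ν).2, ← (hmem lam' ν').2, h]
    rw [he lam h]
  let m : Fin 2 × ℤ → ℂ := Function.extend E (fun s => c s.1 s.2) 0
  have hm : ∀ lam ν, m (e lam ν) = c lam ν := fun lam ν =>
    hE.extend_apply (fun s => c s.1 s.2) 0 ⟨lam, ν⟩
  have hev : ∀ j : Fin 2, ∀ᶠ k in atTop, z j k = ρ j k := fun j => by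
    filter_upwards [eventually_ge_atTop K] with k hk using (hρ j k hk).symm
  refine ⟨N, ρ, fun j k => m (j, k), ⟨fun lam => ?_, fun lam => ⟨e lam, he lam, hr lam, g lam,
    hg lam, ?_⟩⟩, ⟨?_, ?_⟩⟩
  · rw [isEigenvalue_iff, ← mult_ne_zero_iff]
    constructor
    · intro h0
      exact ⟨_, _, hmem lam ⟨0, Nat.pos_of_ne_zero h0⟩⟩
    · rintro ⟨j, k, hk⟩ h0
      have h1 : (j, k) ∈ Set.range (e lam) := by rw [hr lam]; exact hk
      obtain ⟨ν, -⟩ := h1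
      have := ν.2
      omega
  · simpa only [hm] using hM lam
  · refine hz.first.congr' ?_ EventuallyEq.rfl
    filter_upwards [hev 0] with k hk
    rw [hk]
  · refine hz.second.congr' ?_ EventuallyEq.rfl
    filter_upwards [hev 1] with k hk
    rw [hk]

end ComplexWeightBVP

/-! ### The main theorem -/

theorem mainTheorem4 (L : ComplexWeightBVP) :
    -- the spectrum splits into two sequences with the stated asymptotics
    (∃ (N : Fin 2 → ℤ) (ρ μ : Fin 2 → ℤ → ℂ),
      L.IsSpectralData N ρ μ ∧ L.HasEigenvalueAsymptotics ρ) ∧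
    -- consequences, for every such splitting
    (∀ (N : Fin 2 → ℤ) (ρ μ : Fin 2 → ℤ → ℂ),
      L.IsSpectralData N ρ μ → L.HasEigenvalueAsymptotics ρ →
      -- all but finitely many eigenvalues are simple
      (∀ j, ∀ᶠ k : ℤ in atTop, L.mult (ρ j k ^ 2) = 1) ∧
      -- asymptotics of the Weyl sequence
      (fun k : ℤ => μ 0 k / (2 / (L.a₁ ^ 2 * L.l₁)) - 1) =O[atTop] (fun k : ℤ => (1 / k : ℝ)) ∧
      (fun k : ℤ => μ 1 k / (8 / (L.ωm * L.ωp * L.l₂) * exp (2 * I * L.a₁ * L.l₁ * L.C₂) *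
          exp ((2 * k * Real.pi * L.r₁ * L.l₁ / (L.r₂ * L.l₂) : ℝ) *
            (Real.cos L.α + I * Real.sin L.α))) - 1)
        =O[atTop] (fun k : ℤ => (1 / k : ℝ)) ∧
      Real.cos L.α < 0 ∧
      -- recovery of `b`, `a₂` and `d₁`
      Tendsto (fun k : ℤ => -((k : ℂ) * Real.pi / (L.a₁ * ρ 0 k))) atTop (𝓝 (L.b : ℂ)) ∧
      Tendsto (fun k : ℤ => (k : ℂ) * Real.pi / ((L.T - L.b : ℝ) * ρ 1 k)) atTop (𝓝 L.a₂) ∧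
      ∃ A : ℂ, A = L.ωp / L.ωm ∧ A ≠ 1 ∧
        Tendsto (fun k : ℤ => exp (2 * I * ρ 1 k * L.a₂ * L.l₂)) atTop (𝓝 A) ∧
        L.d₁ = upperSqrt (L.a₁ * (A + 1) / (L.a₂ * (A - 1)))) ∧
    -- recovery of `a₁`
    (∀ δ : ℝ, 0 < δ → Tendsto (fun ρ : ℂ => (I * ρ * L.M (ρ ^ 2))⁻¹)
      (Bornology.cobounded ℂ ⊓ 𝓟 (L.region δ)) (𝓝 L.a₁)) := by
  refine ⟨L.exists_isSpectralData, fun N ρ μ h ha => ⟨fun j => ?_, h.weyl_first ha,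
    h.weyl_second ha, L.cos_α_neg, L.tendsto_b ha, L.tendsto_a₂ ha, L.ωp / L.ωm, rfl,
    L.ωp_div_ωm_ne_one, L.tendsto_exp ha, L.d₁_eq_upperSqrt⟩, fun δ hδ => L.tendsto_a₁ hδ⟩
  filter_upwards [h.eventually_simple ha j] with k hk
  exact L.mult_eq_one hk.2.1 hk.2.2.1
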